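/- **Setting.** Let $H$ be a real infinite-dimensional separable Hilbert space and let $\mathcal A$ be a self-adjoint operator on $H$ with eigenvalues $0<\lambda_1\le\lambda_2\le\dots$, $\lambda_k\to\infty$, and an orthonormal basis of eigenvectors $\phi_k$. For $s\ge 0$ let $D(\mathcal A^s)=\{u\in H:\sum_k\lambda_k^{2s}\langle u,\phi_k\rangle^2<\infty\}$ with norm $\|\mathcal A^s u\|_H=(\sum_k\lambda_k^{2s}\langle u,\phi_k\rangle^2)^{1/2}$. Let $\mathscr A:D(\mathcal A)\to H$ be linear and skew symmetric with $\|\mathscr A u\|_H\le C\|\mathcal A^{1/2}u\|_H$, and put $\mathfrak A=\mathcal A+\mathscr A$. Let $\sigma\in[0,1]$ and let $\mathfrak B:D(\mathcal A)\times D(\mathcal A)\to H$ be bilinear with $$|\langle\mathfrak B[u,w],v\rangle|\le C\,\|\mathcal A^{\frac{\sigma+1}2}u\|_H\,\|\mathcal A^{\frac\sigma2}w\|_H\,\|\mathcal A^{\frac{1-\sigma}2}v\|_H .$$ Put $U=D(\mathcal A^{\frac{1+\sigma}2})$, $V=D(\mathcal A^{\frac{1-\sigma}2})$, $W=D(\mathcal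 A^{\frac\sigma2})$, all regarded as subspaces of $V^*$ through $H\hookrightarrow V^*$. Let $T>0$, $X=L^2(0,T;U)\cap H^1(0,T;V^*)$ and $Y=L^2(0,T;V^*)$. The operators $\mathcal A$, $\mathscr A$, $\mathfrak B$ extend continuously to $U\to V^*$, $U\to V^*$, $U\times W\to V^*$; all operators act on functions of time pointwise in time. **Lifting framework.** Assume: 1. $\tilde U,\tilde W$ are Banach spaces, continuously embedded in $V^*$, containing $U$ and $W$ respectively as closed subspaces (with equivalent norms); with $\tilde X=L^2(0,T;\tilde U)\cap H^1(0,T;V^*)$ one has a continuous embedding $\tilde X\hookrightarrow C([0,T];\tilde W)$. 2. $\mathfrak T$ is a linear map from $\tilde X$ to a real vector space, and for $u\in\tilde X$ one has $\mathfrak T(u)=0$ if and only if $u\in X$. 3. $\tilde{\mathcal A},\tilde{\mathscr A}$ are linear maps $\tilde U\to V^*$ which extend $\mathcal A$ and $\mathscr A$ from $U$ and which (pointwise in time) map $\tilde X$ into $Y$, $\tilde{\mathscr A}:\tilde X\to Y$ being bounded; $\tilde{\mathfrak B}$ is a bilinear map $\tilde U\times\tilde U\to V^*$ which extends $\mathfrak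 B$ from $U\times U$ and which (pointwise in time) defines a bounded bilinear map $\tilde X\times\tilde X\to Y$. Put $\tilde{\mathfrak A}=\tilde{\mathcal A}+\tilde{\mathscr A}$. 4. $X_{\mathfrak T}\subseteq\mathfrak T(\tilde X)$ is a Banach space such that for every $h\in X_{\mathfrak T}$ there is a unique $\tilde h\in\tilde X$ with $\tilde{\mathcal A}\tilde h=0$ and $\mathfrak T(\tilde h)=h$, and $\|\tilde h\|_{\tilde X}\le c_h\|h\|_{X_{\mathfrak T}}$ with $c_h$ independent of $h$. **Theorem.** There is $\tilde r>0$ such that for all $f\in Y$, $g\in\tilde W$, $h\in X_{\mathfrak T}$ with $\tilde h(0)-g\in W$ and $$\|f\|_Y+\|g\|_{\tilde W}+\|h\|_{X_{\mathfrak T}}<\tilde r$$ there exists a unique $u\in\tilde X$ with $$\partial_t u+\tilde{\mathfrak A}u+\tilde{\mathfrak B}[u,u]=f\ \text{ in } Y,\qquad u(0)=g,\qquad \mathfrak T(u)=h .$$ -/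

import Mathlib

open MeasureTheory Set
open scoped ContDiff ENNReal RealInnerProductSpace

noncomputable section

namespace NonhomBVP

/-! ### Positive self-adjoint operators with discrete spectrum, and their fractional domains -/

/-- A (densely defined) self-adjoint operator on a real Hilbert space `H` with pure point spectrum:
eigenvalues `0 < eigval 0 ≤ eigval 1 ≤ …` tending to `∞`, and a Hilbert basis of eigenvectors.
Since the basis is indexed by `ℕ`, the space `H` is separable and infinite dimensional. -/
structure SpectralOperator (H : Type*) [NormedAddCommGroup H] [InnerProductSpace ℝ H]
    [CompleteSpace H] where
  op : H →ₗ.[ℝ] H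
  selfAdjoint : IsSelfAdjoint op
  eigval : ℕ → ℝ
  eigvec : HilbertBasis ℕ ℝ H
  eigval_pos : 0 < eigval 0
  eigval_mono : Monotone eigval
  eigval_tendsto : Filter.Tendsto eigval Filter.atTop Filter.atTop
  eigvec_mem : ∀ k, eigvec k ∈ op.domain
  op_eigvec : ∀ k, op ⟨eigvec k, eigvec_mem k⟩ = eigval k • eigvec k

namespace SpectralOperator

variable {H : Type*} [NormedAddCommGroup H] [InnerProductSpace ℝ H] [CompleteSpace H]
  (A : SpectralOperator H)

theorem eigval_pos' (k : ℕ) : 0 < A.eigval k :=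
  A.eigval_pos.trans_le (A.eigval_mono (Nat.zero_le k))

/-- The coordinates `λ_k ^ s ⟨φ_k, u⟩` of `𝒜 ^ s u` in the eigenbasis. -/
def coeff (s : ℝ) (u : H) (k : ℕ) : ℝ := A.eigval k ^ s * ⟪A.eigvec k, u⟫

/-- `‖𝒜 ^ s u‖ = (∑ λ_k ^ (2 s) ⟨φ_k, u⟩ ^ 2) ^ (1/2)`; meaningful for `u ∈ D(𝒜 ^ s)`. -/
def fracNorm (s : ℝ) (u : H) : ℝ := Real.sqrt (∑' k, A.coeff s u k ^ 2)

theorem memℓp_coeff_iff (s : ℝ) (u : H) :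
    Memℓp (E := fun _ : ℕ => ℝ) (A.coeff s u) 2 ↔ Summable fun k => A.coeff s u k ^ 2 := by
  rw [memℓp_gen_iff (by simp)]
  simp

theorem coeff_add (s : ℝ) (u v : H) : A.coeff s (u + v) = A.coeff s u + A.coeff s v := by
  funext k
  simp [coeff, inner_add_right, mul_add]

theorem coeff_smul (s c : ℝ) (u : H) : A.coeff s (c • u) = c • A.coeff s u := by
  funext k
  simp only [coeff, inner_smul_right, Pi.smul_apply, smul_eq_mul]
  ring

/-- The domain `D(𝒜 ^ s)`, `s ≥ 0`, as a linear subspace of `H`. -/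
def fracSubmodule (s : ℝ) : Submodule ℝ H where
  carrier := {u | Summable fun k => A.coeff s u k ^ 2}
  zero_mem' := by simp [coeff]
  add_mem' := by
    intro u v hu hv
    simp only [mem_ofPred_eq, ← memℓp_coeff_iff] at *
    rw [coeff_add]
    exact hu.add hv
  smul_mem' := by
    intro c u hu
    simp only [mem_ofPred_eq, ← memℓp_coeff_iff] at *
    rw [coeff_smul]
    exact hu.const_smul c

/-- The space `D(𝒜 ^ s)`, `s ≥ 0`, with its own norm `‖u‖ = ‖𝒜 ^ s u‖_H`
(a type synonym, so that the norm of `H` is not used). -/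
def FracDom (s : ℝ) : Type _ := A.fracSubmodule s

namespace FracDom

variable {A} {s : ℝ}

instance : AddCommGroup (A.FracDom s) := inferInstanceAs (AddCommGroup (A.fracSubmodule s))

instance : Module ℝ (A.FracDom s) := inferInstanceAs (Module ℝ (A.fracSubmodule s))

/-- The inclusion `D(𝒜 ^ s) ⊂ H`. -/
def val : A.FracDom s →ₗ[ℝ] H := (A.fracSubmodule s).subtype

theorem val_injective : Function.Injective (val : A.FracDom s → H) :=
  (A.fracSubmodule s).subtype_injective

theorem summable_coeff (u : A.FracDom s) : Summable fun k => A.coeff s (val u) k ^ 2 := u.2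

/-- The coordinate map `u ↦ (λ_k ^ s ⟨φ_k, u⟩)_k` from `D(𝒜 ^ s)` to `ℓ²`. -/
def toLp : A.FracDom s →ₗ[ℝ] lp (fun _ : ℕ => ℝ) 2 where
  toFun u := ⟨A.coeff s (val u), (A.memℓp_coeff_iff s _).2 (summable_coeff u)⟩
  map_add' u v := by
    ext k
    simp only [map_add, coeff_add]
    rfl
  map_smul' c u := by
    ext k
    simp only [map_smul, coeff_smul]
    rfl

theorem toLp_apply (u : A.FracDom s) (k : ℕ) : toLp u k = A.coeff s (val u) k := rfl

theorem toLp_injective : Function.Injective (toLp : A.FracDom s → lp (fun _ : ℕ => ℝ) 2) := by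
  intro u v h
  apply val_injective
  apply A.eigvec.repr.injective
  ext k
  have hk : toLp u k = toLp v k := by rw [h]
  rw [toLp_apply, toLp_apply] at hk
  rw [HilbertBasis.repr_apply_apply, HilbertBasis.repr_apply_apply]
  exact mul_left_cancel₀ (Real.rpow_pos_of_pos (A.eigval_pos' k) s).ne' hk

instance : NormedAddCommGroup (A.FracDom s) :=
  NormedAddCommGroup.induced _ _ (toLp : A.FracDom s →ₗ[ℝ] lp (fun _ : ℕ => ℝ) 2) toLp_injective

instance : NormedSpace ℝ (A.FracDom s) :=
  NormedSpace.induced ℝ _ _ (toLp : A.FracDom s →ₗ[ℝ] lp (fun _ : ℕ => ℝ) 2)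

theorem norm_toLp (u : A.FracDom s) : ‖toLp u‖ = ‖u‖ := rfl

theorem norm_eq_fracNorm (u : A.FracDom s) : ‖u‖ = A.fracNorm s (val u) := by
  rw [← norm_toLp, lp.norm_eq_tsum_rpow (by simp), fracNorm, Real.sqrt_eq_rpow]
  simp [toLp_apply]

/-- The coordinate map as an isometry. -/
def toLpₗᵢ : A.FracDom s →ₗᵢ[ℝ] lp (fun _ : ℕ => ℝ) 2 := ⟨toLp, norm_toLp⟩

theorem norm_val_le (hs : 0 ≤ s) (u : A.FracDom s) : ‖val u‖ ≤ A.eigval 0 ^ (-s) * ‖u‖ := by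
  have h0 := Real.rpow_pos_of_pos A.eigval_pos (-s)
  calc ‖val u‖ = ‖A.eigvec.repr (val u)‖ := (A.eigvec.repr.norm_map _).symm
    _ ≤ ‖(A.eigval 0 ^ (-s)) • toLp u‖ := by
        refine lp.norm_mono (by simp) fun k => ?_
        rw [HilbertBasis.repr_apply_apply, lp.coeFn_smul, Pi.smul_apply, norm_smul, toLp_apply,
          coeff, norm_mul, ← mul_assoc]
        refine le_mul_of_one_le_left (norm_nonneg _) ?_
        rw [Real.norm_of_nonneg h0.le,
          Real.norm_of_nonneg (Real.rpow_pos_of_pos (A.eigval_pos' k) s).le,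
          Real.rpow_neg A.eigval_pos.le, inv_mul_eq_div, one_le_div
          (Real.rpow_pos_of_pos A.eigval_pos s)]
        exact Real.rpow_le_rpow A.eigval_pos.le (A.eigval_mono (Nat.zero_le k)) hs
    _ = A.eigval 0 ^ (-s) * ‖u‖ := by rw [norm_smul, Real.norm_of_nonneg h0.le, norm_toLp]

/-- The continuous embedding `D(𝒜 ^ s) ↪ H` for `s ≥ 0`. -/
def valL (hs : 0 ≤ s) : A.FracDom s →L[ℝ] H :=
  (val : A.FracDom s →ₗ[ℝ] H).mkContinuous _ (norm_val_le hs)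

end FracDom

end SpectralOperator

/-! ### The data of the semilinear problem -/

/-- The operator `𝔄 = 𝒜 + 𝒮` and the bilinear map `𝔅` on `D(𝔄) = D(𝒜)`: `𝒜` as in
`SpectralOperator`, `𝒮` linear, skew symmetric and bounded from `D(𝒜 ^ (1/2))` to `H`, and
`|⟨𝔅[u, w], v⟩| ≤ C ‖𝒜 ^ ((σ + 1)/2) u‖ ‖𝒜 ^ (σ/2) w‖ ‖𝒜 ^ ((1 - σ)/2) v‖`. -/
structure SemilinearData (H : Type*) [NormedAddCommGroup H] [InnerProductSpace ℝ H]
    [CompleteSpace H] where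
  A : SpectralOperator H
  S : A.op.domain →ₗ[ℝ] H
  S_skew : ∀ u v : A.op.domain, ⟪S u, (v : H)⟫ = -⟪(u : H), S v⟫
  S_bound : ∃ C : ℝ, ∀ u : A.op.domain, ‖S u‖ ≤ C * A.fracNorm (1 / 2) u
  σ : ℝ
  σ_mem : σ ∈ Icc (0 : ℝ) 1
  B : A.op.domain →ₗ[ℝ] A.op.domain →ₗ[ℝ] H
  B_bound : ∃ C : ℝ, ∀ u w : A.op.domain, ∀ v ∈ A.fracSubmodule ((1 - σ) / 2),
    |⟪B u w, v⟫| ≤ C * A.fracNorm ((σ + 1) / 2) u * A.fracNorm (σ / 2) w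
      * A.fracNorm ((1 - σ) / 2) v

namespace SemilinearData

variable {H : Type*} [NormedAddCommGroup H] [InnerProductSpace ℝ H] [CompleteSpace H]
  (P : SemilinearData H)

/-- `U = D(𝒜 ^ ((1 + σ)/2))`. -/
abbrev U : Type _ := P.A.FracDom ((1 + P.σ) / 2)

/-- `V = D(𝒜 ^ ((1 - σ)/2))`. -/
abbrev V : Type _ := P.A.FracDom ((1 - P.σ) / 2)

/-- `W = D(𝒜 ^ (σ/2))`. -/
abbrev W : Type _ := P.A.FracDom (P.σ / 2)

/-- `V*`, the dual space of `V`. -/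
abbrev Vdual : Type _ := StrongDual ℝ P.V

theorem U_nonneg : 0 ≤ (1 + P.σ) / 2 := by linarith [P.σ_mem.1]

theorem V_nonneg : 0 ≤ (1 - P.σ) / 2 := by linarith [P.σ_mem.2]

theorem W_nonneg : 0 ≤ P.σ / 2 := by linarith [P.σ_mem.1]

/-- The embedding `H ↪ V*`, `x ↦ (v ↦ ⟨x, v⟩)`. -/
def toVdual : H →L[ℝ] P.Vdual :=
  (ContinuousLinearMap.precomp ℝ (SpectralOperator.FracDom.valL (A := P.A) P.V_nonneg)) ∘L
    innerSL ℝ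

theorem toVdual_apply (x : H) (v : P.V) : P.toVdual x v = ⟪x, SpectralOperator.FracDom.val v⟫ :=
  rfl

/-- The embedding `U ↪ V*` (through `H`). -/
def UtoVdual : P.U →L[ℝ] P.Vdual :=
  P.toVdual ∘L SpectralOperator.FracDom.valL (A := P.A) P.U_nonneg

/-- The embedding `W ↪ V*` (through `H`). -/
def WtoVdual : P.W →L[ℝ] P.Vdual :=
  P.toVdual ∘L SpectralOperator.FracDom.valL (A := P.A) P.W_nonneg

/-- `𝒜` as a bounded operator `U → V*`:
`⟨𝒜 u, v⟩ = ⟨𝒜 ^ ((1 + σ)/2) u, 𝒜 ^ ((1 - σ)/2) v⟩ = ∑ λ_k ⟨φ_k, u⟩ ⟨φ_k, v⟩`. -/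
def extA : P.U →L[ℝ] P.Vdual :=
  (ContinuousLinearMap.precomp ℝ
    (SpectralOperator.FracDom.toLpₗᵢ (A := P.A)).toContinuousLinearMap) ∘L innerSL ℝ ∘L
    (SpectralOperator.FracDom.toLpₗᵢ (A := P.A)).toContinuousLinearMap

theorem extA_apply (u : P.U) (v : P.V) :
    P.extA u v = ∑' k, P.A.eigval k * (⟪P.A.eigvec k, SpectralOperator.FracDom.val u⟫ *
      ⟪P.A.eigvec k, SpectralOperator.FracDom.val v⟫) := by
  change ⟪SpectralOperator.FracDom.toLp u, SpectralOperator.FracDom.toLp v⟫ = _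
  rw [lp.inner_eq_tsum]
  refine tsum_congr fun k => ?_
  rw [SpectralOperator.FracDom.toLp_apply, SpectralOperator.FracDom.toLp_apply,
    SpectralOperator.coeff, SpectralOperator.coeff]
  have h : P.A.eigval k ^ ((1 + P.σ) / 2) * P.A.eigval k ^ ((1 - P.σ) / 2) = P.A.eigval k := by
    rw [← Real.rpow_add (P.A.eigval_pos' k)]
    ring_nf
    exact Real.rpow_one _
  rw [real_inner_eq_re_inner, RCLike.inner_apply]
  simp only [conj_trivial, RCLike.re_to_real]
  rw [show ∀ a b c d : ℝ, a * b * (c * d) = (c * a) * (d * b) by intros; ring, h]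

end SemilinearData

/-! ### Bochner spaces on `(0, T)` -/

/-- Lebesgue measure on the interval `(0, T)`. -/
abbrev timeMeasure (T : ℝ) : Measure ℝ := volume.restrict (Ioo 0 T)

/-- The Bochner space `L²(0, T; E)`. -/
abbrev L2 (T : ℝ) (E : Type*) [NormedAddCommGroup E] : Type _ := Lp E 2 (timeMeasure T)

/-- `v'` is the weak derivative of `v` on `(0, T)`. -/
def IsWeakDeriv {F : Type*} [NormedAddCommGroup F] [NormedSpace ℝ F] (T : ℝ) (v v' : ℝ → F) :
    Prop :=
  ∀ η : ℝ → ℝ, ContDiff ℝ ∞ η → HasCompactSupport η → tsupport η ⊆ Ioo 0 T →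
    ∫ t in Ioo 0 T, deriv η t • v t = -∫ t in Ioo 0 T, η t • v' t

section Bochner

variable {E F : Type*} [NormedAddCommGroup E] [NormedSpace ℝ E] [NormedAddCommGroup F]
  [NormedSpace ℝ F]

theorem integrable_test {T : ℝ} {η : ℝ → ℝ} (hη : Continuous η) (hc : HasCompactSupport η)
    (v : L2 T F) : Integrable (fun t => η t • v t) (timeMeasure T) := by
  obtain ⟨C, hC⟩ := hc.exists_bound_of_continuous hη
  exact ((Lp.memLp v).integrable (by norm_num)).bdd_smul C hη.aestronglyMeasurable
    (Filter.Eventually.of_forall hC)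

/-- The space `L²(0, T; E) ∩ H¹(0, T; F)`, where `E` is embedded in `F` by `j`: pairs `(u, u')` of
`u ∈ L²(0, T; E)` and its weak derivative `u' ∈ L²(0, T; F)`. The norm is
`max ‖u‖_{L²(0,T;E)} ‖u'‖_{L²(0,T;F)}`, which is equivalent to the usual one since `j` is bounded. -/
def evolSpace (T : ℝ) (j : E →L[ℝ] F) : Submodule ℝ (L2 T E × L2 T F) where
  carrier := {p | IsWeakDeriv T (fun t => j (p.1 t)) p.2}
  zero_mem' := by
    intro η _ _ _
    have h1 : (fun t => deriv η t • j (((0 : L2 T E × L2 T F)).1 t)) =ᵐ[timeMeasure T] 0 := by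
      filter_upwards [Lp.coeFn_zero E 2 (timeMeasure T)] with t ht
      rw [Prod.fst_zero, ht, Pi.zero_apply, Pi.zero_apply, map_zero, smul_zero]
    have h2 : (fun t => η t • ((0 : L2 T E × L2 T F)).2 t) =ᵐ[timeMeasure T] 0 := by
      filter_upwards [Lp.coeFn_zero F 2 (timeMeasure T)] with t ht
      rw [Prod.snd_zero, ht, Pi.zero_apply, smul_zero]
    rw [integral_congr_ae h1, integral_congr_ae h2]
    simp
  add_mem' := by
    intro p q hp hq η h1 h2 h3
    have hd : Continuous (deriv η) := h1.continuous_deriv (by simp)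
    have e1 : (fun t => deriv η t • j ((p + q).1 t)) =ᵐ[timeMeasure T]
        fun t => deriv η t • j.compLp p.1 t + deriv η t • j.compLp q.1 t := by
      filter_upwards [Lp.coeFn_add p.1 q.1, j.coeFn_compLp p.1, j.coeFn_compLp q.1]
        with t ht hp' hq'
      rw [hp', hq', Prod.fst_add, ht, Pi.add_apply, map_add, smul_add]
    have e2 : (fun t => η t • (p + q).2 t) =ᵐ[timeMeasure T]
        fun t => η t • p.2 t + η t • q.2 t := by
      filter_upwards [Lp.coeFn_add p.2 q.2] with t ht
      rw [Prod.snd_add, ht, Pi.add_apply, smul_add]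
    have c1 : ∀ r : L2 T E × L2 T F, ∫ t in Ioo 0 T, deriv η t • j.compLp r.1 t
        = ∫ t in Ioo 0 T, deriv η t • j (r.1 t) := fun r => integral_congr_ae (by
      filter_upwards [j.coeFn_compLp r.1] with t ht
      rw [ht])
    rw [integral_congr_ae e1, integral_congr_ae e2,
      integral_add (integrable_test hd h2.deriv _) (integrable_test hd h2.deriv _),
      integral_add (integrable_test h1.continuous h2 _) (integrable_test h1.continuous h2 _),
      c1, c1, hp η h1 h2 h3, hq η h1 h2 h3, neg_add]
  smul_mem' := by
    intro c p hp η h1 h2 h3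
    have e1 : (fun t => deriv η t • j ((c • p).1 t)) =ᵐ[timeMeasure T]
        fun t => c • (deriv η t • j (p.1 t)) := by
      filter_upwards [Lp.coeFn_smul c p.1] with t ht
      rw [Prod.smul_fst, ht, Pi.smul_apply, map_smul, smul_comm]
    have e2 : (fun t => η t • (c • p).2 t) =ᵐ[timeMeasure T] fun t => c • (η t • p.2 t) := by
      filter_upwards [Lp.coeFn_smul c p.2] with t ht
      rw [Prod.smul_snd, ht, Pi.smul_apply, smul_comm]
    rw [integral_congr_ae e1, integral_congr_ae e2, integral_smul, integral_smul,
      hp η h1 h2 h3, smul_neg]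

/-- `u(0) = a` in `G`, for `u ∈ L²(0, T; E) ∩ H¹(0, T; F)` (with `E`, `G` embedded in `F` by
`j`, `k`): some continuous function `[0, T] → G` agrees with `u` almost everywhere and takes the
value `a` at `0`. -/
def HasInitialValue {G : Type*} [NormedAddCommGroup G] [NormedSpace ℝ G] {T : ℝ} (j : E →L[ℝ] F)
    (k : G →L[ℝ] F) (u : evolSpace T j) (a : G) : Prop :=
  ∃ c : ℝ → G, ContinuousOn c (Icc 0 T) ∧ (∀ᵐ t ∂timeMeasure T, k (c t) = j (u.1.1 t)) ∧ c 0 = a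

end Bochner

/-! ### The lifting framework -/

/-- The framework for the nonhomogeneous problem: Banach spaces `Ut ⊇ U`, `Wt ⊇ W` (embedded in
`V*`, so that the intersection of Bochner spaces makes sense), extended operators
`𝒜̃, 𝒮̃ : X̃ → L²(0, T; V*)`, `𝔅̃ : X̃ × X̃ → L²(0, T; V*)` acting pointwise in time, where
`X̃ = L²(0, T; Ut) ∩ H¹(0, T; V*)`, a boundary operator `𝔗 : X̃ → Z`, and a Banach space `XT` of
boundary data embedded in `Z`. -/
structure LiftingFramework {H : Type*} [NormedAddCommGroup H] [InnerProductSpace ℝ H]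
    [CompleteSpace H] (P : SemilinearData H) (T : ℝ)
    (Ut : Type*) [NormedAddCommGroup Ut] [NormedSpace ℝ Ut]
    (Wt : Type*) [NormedAddCommGroup Wt] [NormedSpace ℝ Wt]
    (Z : Type*) [AddCommGroup Z] [Module ℝ Z]
    (XT : Type*) [NormedAddCommGroup XT] [NormedSpace ℝ XT] where
  /-- `Ut ↪ V*` -/
  jU : Ut →L[ℝ] P.Vdual
  jU_injective : Function.Injective jU
  /-- `U` is a closed subspace of `Ut` -/
  iU : P.U →L[ℝ] Ut
  iU_closed : Topology.IsClosedEmbedding iU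
  jU_comp_iU : jU ∘L iU = P.UtoVdual
  /-- `Wt ↪ V*` -/
  jW : Wt →L[ℝ] P.Vdual
  jW_injective : Function.Injective jW
  /-- `W` is a closed subspace of `Wt` -/
  iW : P.W →L[ℝ] Wt
  iW_closed : Topology.IsClosedEmbedding iW
  jW_comp_iW : jW ∘L iW = P.WtoVdual
  /-- the embedding `X̃ ↪ C([0, T]; Wt)` -/
  embed : ∃ C : ℝ, ∀ u : evolSpace T jU, ∃ c : ℝ → Wt, ContinuousOn c (Icc 0 T) ∧
    (∀ᵐ t ∂timeMeasure T, jW (c t) = jU (u.1.1 t)) ∧ ∀ t ∈ Icc 0 T, ‖c t‖ ≤ C * ‖u‖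
  /-- the boundary operator `𝔗` -/
  trace : evolSpace T jU →ₗ[ℝ] Z
  /-- `𝔗(u) = 0` if and only if `u ∈ X = L²(0, T; U) ∩ H¹(0, T; V*)` -/
  trace_eq_zero_iff : ∀ u : evolSpace T jU,
    trace u = 0 ↔ ∃ v : evolSpace T P.UtoVdual, ∀ᵐ t ∂timeMeasure T, iU (v.1.1 t) = u.1.1 t
  /-- the extension `𝒜̃` of `𝒜 : U → V*` -/
  At : Ut →ₗ[ℝ] P.Vdual
  At_mapsTo : ∀ u : evolSpace T jU, ∃ y : L2 T P.Vdual, ∀ᵐ t ∂timeMeasure T, y t = At (u.1.1 t)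
  At_iU : ∀ x : P.U, At (iU x) = P.extA x
  /-- the extension `𝒮̃` of `𝒮`; since it is bounded, it is enough to prescribe it on `D(𝒜)` -/
  St : Ut →ₗ[ℝ] P.Vdual
  St_bounded : ∃ C : ℝ, ∀ u : evolSpace T jU, ∃ y : L2 T P.Vdual,
    (∀ᵐ t ∂timeMeasure T, y t = St (u.1.1 t)) ∧ ‖y‖ ≤ C * ‖u‖
  St_iU : ∀ (x : P.U) (hx : SpectralOperator.FracDom.val x ∈ P.A.op.domain),
    St (iU x) = P.toVdual (P.S ⟨_, hx⟩)
  /-- the extension `𝔅̃` of `𝔅`; since it is bounded, it is enough to prescribe it on `D(𝒜)` -/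
  Bt : Ut →ₗ[ℝ] Ut →ₗ[ℝ] P.Vdual
  Bt_bounded : ∃ C : ℝ, ∀ u w : evolSpace T jU, ∃ y : L2 T P.Vdual,
    (∀ᵐ t ∂timeMeasure T, y t = Bt (u.1.1 t) (w.1.1 t)) ∧ ‖y‖ ≤ C * ‖u‖ * ‖w‖
  Bt_iU : ∀ (x y : P.U) (hx : SpectralOperator.FracDom.val x ∈ P.A.op.domain)
    (hy : SpectralOperator.FracDom.val y ∈ P.A.op.domain),
    Bt (iU x) (iU y) = P.toVdual (P.B ⟨_, hx⟩ ⟨_, hy⟩)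
  /-- boundary data form a subspace of `Z` -/
  iT : XT →ₗ[ℝ] Z
  iT_injective : Function.Injective iT
  /-- the unique `𝒜̃`-harmonic extension of boundary data -/
  lift_unique : ∀ h : XT, ∃! ht : evolSpace T jU,
    (∀ᵐ t ∂timeMeasure T, At (ht.1.1 t) = 0) ∧ trace ht = iT h
  /-- its boundedness -/
  lift_bounded : ∃ C : ℝ, ∀ (h : XT) (ht : evolSpace T jU),
    (∀ᵐ t ∂timeMeasure T, At (ht.1.1 t) = 0) → trace ht = iT h → ‖ht‖ ≤ C * ‖h‖

namespace LiftingFramework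

variable {H : Type*} [NormedAddCommGroup H] [InnerProductSpace ℝ H] [CompleteSpace H]
  {P : SemilinearData H} {T : ℝ}
  {Ut : Type*} [NormedAddCommGroup Ut] [NormedSpace ℝ Ut]
  {Wt : Type*} [NormedAddCommGroup Wt] [NormedSpace ℝ Wt]
  {Z : Type*} [AddCommGroup Z] [Module ℝ Z]
  {XT : Type*} [NormedAddCommGroup XT] [NormedSpace ℝ XT]
  (L : LiftingFramework P T Ut Wt Z XT)

/-- `X̃ = L²(0, T; Ut) ∩ H¹(0, T; V*)`. -/
abbrev Xt : Type _ := evolSpace T L.jU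

/-- `ht` is the `𝒜̃`-harmonic extension `h̃` of `h`: `𝒜̃ h̃ = 0` and `𝔗(h̃) = h`. -/
def IsHarmonicExtension (h : XT) (ht : L.Xt) : Prop :=
  (∀ᵐ t ∂timeMeasure T, L.At (ht.1.1 t) = 0) ∧ L.trace ht = L.iT h

/-- `u ∈ X̃` solves `∂ₜ u + (𝒜̃ + 𝒮̃) u + 𝔅̃[u, u] = f` in `L²(0, T; V*)`, `u(0) = g`,
`𝔗(u) = h`. -/
def IsSolution (f : L2 T P.Vdual) (g : Wt) (h : XT) (u : L.Xt) : Prop :=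
  (∀ᵐ t ∂timeMeasure T,
    u.1.2 t + (L.At (u.1.1 t) + L.St (u.1.1 t)) + L.Bt (u.1.1 t) (u.1.1 t) = f t) ∧
  HasInitialValue L.jU L.jW u g ∧
  L.trace u = L.iT h

end LiftingFramework

end NonhomBVP

end

/-!
Write `v = u - h̃`, where `h̃` is the `𝒜̃`-harmonic extension of the boundary datum `h`. Then `u`
solves the nonhomogeneous problem if and only if `v ∈ X = L²(0, T; U) ∩ H¹(0, T; V*)` and
`v' + (𝒜 + 𝒮) v = f - h̃' - 𝒮̃ h̃ - 𝔅̃[h̃ + v, h̃ + v]`, `v(0) = g - h̃(0)`: the boundary condition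
has become membership in `X`, and the initial value lies in `W` by the compatibility condition.

*Linear problem.* In the coordinates of the eigenbasis, with `U`, `W` and `V*` identified with `ℓ²`,
the equation `v' + 𝒜 v = F` splits into the scalar equations `c' + λ c = f`. The energy inequality
`mul_norm_duhamelₗ_sq_le` gives `‖λ c‖ ≤ ‖f‖` for zero initial value, uniformly in `λ`, which is
maximal regularity. The operator `𝒮` is of order `1/2`: with `Q = 𝒮 𝒜 ^ (-1/2)`, which is bounded,
solving the equation with `𝒮` amounts to inverting `1 + Q 𝒜 ^ (1/2) (∂ₜ + 𝒜)⁻¹` on `L²(0, T; H)`.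
The weight `exp (-μ t)` replaces `(∂ₜ + 𝒜)⁻¹` by `(∂ₜ + 𝒜 + μ)⁻¹`, and `√λ / (λ + μ) ≤ 1 / (2 √μ)`,
so that the Neumann series converges for large `μ` (`exists_weight`). Thus the linear problem is
uniquely solvable on all of `(0, T)` with bounds (`exists_solvesLinear`), and its solution before a
time `τ` depends only on the data before `τ` (`ae_eq_zero_of_linear`).

*Extended operators.* The hypotheses bound `𝒮̃` and `𝔅̃` on `X̃` and prescribe them on `D(𝒜)`.
Applied to time-independent functions, they yield bounds on `Ut`; by density of `D(𝒜)` in `U`, the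
operator `𝒮̃` is the extension of `𝒮` on `U`, and `‖𝔅̃[x, y]‖ ≤ C ‖x‖_U ‖y‖_W` there
(`norm_Bt_iU_le`).

*Existence.* For small data the contraction principle, applied to the right-hand side, gives a
solution of small norm (`exists_quadratic_fixedPoint`, `exists_small_solution`).

*Uniqueness.* The other solution need not be small. The difference `v ∈ X` of the two solutions
vanishes at time `0`, is continuous with values in the closed subspace `W` of `Wt`, and solves
`v' + (𝒜 + 𝒮) v = -(𝔅̃[u, v] + 𝔅̃[v, u] + 𝔅̃[v, v])`, where `u` is small. As long as `v` is small in
`W`, the term `𝔅̃[v, v]` is a small multiple of `v` as well, hence `v` vanishes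
(`ae_eq_zero_of_small`); the bound on `X̃ × X̃` is used on `(0, τ)` by cutting the right-hand side
off at `τ`. Therefore the set of times up to which `v` vanishes is open and closed in `[0, T]`
(`exists_difference_eq_zero`).
-/

noncomputable section

namespace NonhomBVP

/-! ### Functions on a time interval -/

section Time

variable {T : ℝ} {E F : Type*} [NormedAddCommGroup E] [NormedAddCommGroup F]

theorem L2.integrable (f : L2 T E) : Integrable f (timeMeasure T) :=
  (Lp.memLp f).integrable (by norm_num)

theorem L2.intervalIntegrable (hT : 0 < T) (f : L2 T E) : IntervalIntegrable f volume 0 T := by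
  rw [intervalIntegrable_iff_integrableOn_Ioo_of_le hT.le]
  exact L2.integrable f

theorem _root_.ContinuousOn.memLp_timeMeasure {c : ℝ → E} (hc : ContinuousOn c (Icc 0 T))
    (p : ℝ≥0∞) : MemLp c p (timeMeasure T) := by
  obtain ⟨C, hC⟩ := isCompact_Icc.exists_bound_of_continuousOn hc
  refine MemLp.of_bound ((hc.mono Ioo_subset_Icc_self).aestronglyMeasurable measurableSet_Ioo) C ?_
  filter_upwards [ae_restrict_mem measurableSet_Ioo] with t ht
  exact hC t (Ioo_subset_Icc_self ht)

variable [NormedSpace ℝ E] [NormedSpace ℝ F]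

/-- Pointwise multiplication by an essentially bounded scalar function, as a bounded operator on
`L²(0, T; E)`. -/
def mulLp (m : ℝ → ℝ) (hm : MemLp m ∞ (timeMeasure T)) : L2 T E →L[ℝ] L2 T E :=
  LinearMap.mkContinuous
    { toFun := fun f => (hm.toLp m • f : L2 T E)
      map_add' := fun f g => Lp.add_smul _ f g
      map_smul' := fun c f => (Lp.smul_comm c (hm.toLp m) f).symm }
    ‖hm.toLp m‖ fun _ => Lp.norm_smul_le _ _

theorem coeFn_mulLp (m : ℝ → ℝ) (hm : MemLp m ∞ (timeMeasure T)) (f : L2 T E) :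
    ∀ᵐ t ∂timeMeasure T, mulLp m hm f t = m t • f t := by
  filter_upwards [Lp.coeFn_lpSMul (r := 2) (hm.toLp m) f, hm.coeFn_toLp] with t h1 h2
  change (hm.toLp m • f : Lp E 2 (timeMeasure T)) t = _
  rw [h1, Pi.smul_apply', h2]

theorem mulLp_comp (m : ℝ → ℝ) (hm : MemLp m ∞ (timeMeasure T)) (A : E →L[ℝ] F) (f : L2 T E) :
    mulLp m hm (A.compLpL 2 (timeMeasure T) f) = A.compLpL 2 (timeMeasure T) (mulLp m hm f) := by
  apply Lp.ext
  filter_upwards [coeFn_mulLp m hm f, coeFn_mulLp m hm (A.compLpL 2 (timeMeasure T) f),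
    A.coeFn_compLpL f, A.coeFn_compLpL (mulLp m hm f)] with t h1 h2 h3 h4
  rw [h2, h4, h1, h3, map_smul]

theorem memLp_exp (μ : ℝ) : MemLp (fun t => Real.exp (μ * t)) ∞ (timeMeasure T) :=
  ContinuousOn.memLp_timeMeasure (by fun_prop) _

/-- Multiplication by `t ↦ exp (μ t)`. -/
def expMul (μ : ℝ) : L2 T E →L[ℝ] L2 T E := mulLp (fun t => Real.exp (μ * t)) (memLp_exp μ)

theorem expMul_expMul_neg (μ : ℝ) (f : L2 T E) : expMul μ (expMul (-μ) f) = f := by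
  apply Lp.ext
  filter_upwards [coeFn_mulLp _ (memLp_exp μ) (expMul (-μ) f), coeFn_mulLp _ (memLp_exp (-μ)) f]
    with t h1 h2
  unfold expMul at *
  rw [h1, h2, smul_smul, ← Real.exp_add]
  simp

theorem memLp_cut (τ : ℝ) : MemLp ((Iio τ).indicator (fun _ => (1 : ℝ))) ∞ (timeMeasure T) := by
  refine MemLp.of_bound
    (measurable_const.indicator measurableSet_Iio).aestronglyMeasurable 1 (.of_forall fun t => ?_)
  by_cases h : t ∈ Iio τ <;> simp [h]

/-- Restriction to the times before `τ` (and extension by zero). -/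
def cut (τ : ℝ) : L2 T E →L[ℝ] L2 T E := mulLp _ (memLp_cut τ)

theorem coeFn_cut (τ : ℝ) (f : L2 T E) :
    ∀ᵐ t ∂timeMeasure T, cut τ f t = (Iio τ).indicator (fun _ => (1 : ℝ)) t • f t :=
  coeFn_mulLp _ _ f

theorem coeFn_cut_of_lt (τ : ℝ) (f : L2 T E) :
    ∀ᵐ t ∂timeMeasure T, t < τ → cut τ f t = f t := by
  filter_upwards [coeFn_cut τ f] with t h ht
  rw [h, indicator_of_mem (mem_Iio.2 ht), one_smul]

theorem cut_eq_zero_iff (τ : ℝ) (f : L2 T E) :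
    cut τ f = 0 ↔ ∀ᵐ t ∂timeMeasure T, t < τ → f t = 0 := by
  constructor
  · intro h
    filter_upwards [coeFn_cut_of_lt τ f, Lp.coeFn_zero E 2 (timeMeasure T)] with t h1 h2 ht
    rw [← h1 ht, h, h2, Pi.zero_apply]
  · intro h
    apply Lp.ext
    filter_upwards [coeFn_cut τ f, Lp.coeFn_zero E 2 (timeMeasure T), h] with t h1 h2 h3
    rw [h1, h2, Pi.zero_apply]
    by_cases ht : t < τ
    · rw [h3 ht, smul_zero]
    · simp [ht]

theorem norm_cut_le (τ : ℝ) (f : L2 T E) : ‖cut τ f‖ ≤ ‖f‖ := by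
  apply Lp.norm_le_norm_of_ae_le
  filter_upwards [coeFn_cut τ f] with t h1
  rw [h1, norm_smul]
  refine mul_le_of_le_one_left (norm_nonneg _) ?_
  by_cases ht : t < τ <;> simp [ht]

theorem cut_expMul (τ μ : ℝ) (f : L2 T E) : cut τ (expMul μ f) = expMul μ (cut τ f) := by
  apply Lp.ext
  filter_upwards [coeFn_cut τ f, coeFn_cut τ (expMul μ f), coeFn_mulLp _ (memLp_exp μ) f,
    coeFn_mulLp _ (memLp_exp μ) (cut τ f)] with t h1 h2 h3 h4
  unfold expMul at *
  rw [h2, h3, h4, h1, smul_comm]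

end Time

/-! ### The scalar equation `c' + λ c = f` -/

section Scalar

variable {T : ℝ}

/-- An absolutely continuous function has its almost everywhere derivative as weak derivative. -/
theorem isWeakDeriv_of_absolutelyContinuous (hT : 0 < T) {c g : ℝ → ℝ}
    (hc : AbsolutelyContinuousOnInterval c 0 T)
    (hg : ∀ᵐ t ∂timeMeasure T, HasDerivAt c (g t) t) : IsWeakDeriv T c g := by
  intro η h1 _ h3
  have hη : AbsolutelyContinuousOnInterval η 0 T :=
    ContDiffOn.absolutelyContinuousOnInterval (h1.contDiffOn.of_le (by norm_cast))
  have h := hη.integral_mul_deriv_eq_deriv_mul hc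
  have e0 : η 0 = 0 := image_eq_zero_of_notMem_tsupport fun h => (h3 h).1.false
  have eT : η T = 0 := image_eq_zero_of_notMem_tsupport fun h => (h3 h).2.false
  rw [e0, eT, intervalIntegral.integral_of_le hT.le, intervalIntegral.integral_of_le hT.le,
    integral_Ioc_eq_integral_Ioo, integral_Ioc_eq_integral_Ioo] at h
  have e : ∫ t in Ioo 0 T, η t • g t = ∫ t in Ioo 0 T, η t * deriv c t := by
    refine integral_congr_ae ?_
    filter_upwards [hg] with t ht
    rw [ht.deriv, smul_eq_mul]
  rw [e, h]
  simp

/-- The solution `t ↦ ∫₀ᵗ exp (-λ (t - s)) f s ds` of `c' + λ c = f`, `c 0 = 0`. -/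
def duhamel (lam : ℝ) (f : ℝ → ℝ) (t : ℝ) : ℝ :=
  Real.exp (-lam * t) * ∫ s in (0 : ℝ)..t, Real.exp (lam * s) * f s

theorem duhamel_zero (lam : ℝ) (f : ℝ → ℝ) : duhamel lam f 0 = 0 := by
  simp [duhamel]

theorem duhamel_congr {lam : ℝ} {f g : ℝ → ℝ} {τ t : ℝ}
    (h : ∀ᵐ s ∂timeMeasure T, s < τ → f s = g s) (h0 : 0 ≤ t) (hT : t ≤ T) (ht : t ≤ τ) :
    duhamel lam f t = duhamel lam g t := by
  unfold duhamel
  congr 1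
  rw [intervalIntegral.integral_of_le h0, intervalIntegral.integral_of_le h0,
    integral_Ioc_eq_integral_Ioo, integral_Ioc_eq_integral_Ioo]
  have h' := ae_restrict_of_ae_restrict_of_subset (Ioo_subset_Ioo_right hT) h
  refine integral_congr_ae ?_
  filter_upwards [h', ae_restrict_mem measurableSet_Ioo] with s h1 h2
  rw [h1 (h2.2.trans_le ht)]

theorem absolutelyContinuous_exp (a : ℝ) :
    AbsolutelyContinuousOnInterval (fun t => Real.exp (a * t)) 0 T :=
  ContDiffOn.absolutelyContinuousOnInterval (by fun_prop)

variable (hT : 0 < T)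
include hT

theorem intervalIntegrable_exp_mul (lam : ℝ) (f : L2 T ℝ) :
    IntervalIntegrable (fun s => Real.exp (lam * s) * f s) volume 0 T :=
  (L2.intervalIntegrable hT f).continuousOn_mul (by fun_prop)

theorem absolutelyContinuous_duhamel (lam : ℝ) (f : L2 T ℝ) :
    AbsolutelyContinuousOnInterval (duhamel lam f) 0 T :=
  (absolutelyContinuous_exp (-lam)).fun_mul
    ((intervalIntegrable_exp_mul hT lam f).absolutelyContinuousOnInterval_intervalIntegral
      left_mem_uIcc)

theorem continuousOn_duhamel (lam : ℝ) (f : L2 T ℝ) : ContinuousOn (duhamel lam f) (Icc 0 T) := by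
  rw [← uIcc_of_le hT.le]
  exact (absolutelyContinuous_duhamel hT lam f).continuousOn

theorem hasDerivAt_duhamel (lam : ℝ) (f : L2 T ℝ) :
    ∀ᵐ t ∂timeMeasure T, HasDerivAt (duhamel lam f) (f t - lam * duhamel lam f t) t := by
  rw [ae_restrict_iff' measurableSet_Ioo]
  filter_upwards [(intervalIntegrable_exp_mul hT lam f).ae_hasDerivAt_integral] with t h ht
  have h1 := h (by rw [uIcc_of_le hT.le]; exact Ioo_subset_Icc_self ht) 0 left_mem_uIcc
  have h2 : HasDerivAt (fun t => Real.exp (-lam * t)) (Real.exp (-lam * t) * (-lam * 1)) t :=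
    ((hasDerivAt_id t).const_mul (-lam)).exp
  convert! h2.mul h1 using 1
  unfold duhamel
  have : Real.exp (-lam * t) * Real.exp (lam * t) = 1 := by rw [← Real.exp_add]; simp
  linear_combination (-f t) * this

/-- The solution operator of `c' + λ c = f`, `c 0 = 0` on `L²(0, T)`, as a linear map. -/
def duhamelₗ (lam : ℝ) : L2 T ℝ →ₗ[ℝ] L2 T ℝ where
  toFun f := ((continuousOn_duhamel hT lam f).memLp_timeMeasure 2).toLp _
  map_add' f g := by
    apply Lp.ext
    filter_upwards [((continuousOn_duhamel hT lam (f + g)).memLp_timeMeasure 2).coeFn_toLp,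
      ((continuousOn_duhamel hT lam f).memLp_timeMeasure 2).coeFn_toLp,
      ((continuousOn_duhamel hT lam g).memLp_timeMeasure 2).coeFn_toLp, Lp.coeFn_add
      (((continuousOn_duhamel hT lam f).memLp_timeMeasure 2).toLp _)
      (((continuousOn_duhamel hT lam g).memLp_timeMeasure 2).toLp _),
      ae_restrict_mem measurableSet_Ioo] with t h1 h2 h3 h4 ht
    rw [h1, h4, Pi.add_apply, h2, h3, duhamel_congr (g := fun s => f s + g s) (τ := t)
      (by filter_upwards [Lp.coeFn_add f g] with s hs _ using hs) ht.1.le ht.2.le le_rfl]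
    have hs : uIcc 0 t ⊆ uIcc 0 T := by
      rw [uIcc_of_le ht.1.le, uIcc_of_le hT.le]
      exact Icc_subset_Icc_right ht.2.le
    simp only [duhamel, mul_add]
    rw [intervalIntegral.integral_add ((intervalIntegrable_exp_mul hT lam f).mono_set hs)
      ((intervalIntegrable_exp_mul hT lam g).mono_set hs), mul_add]
  map_smul' a f := by
    apply Lp.ext
    filter_upwards [((continuousOn_duhamel hT lam (a • f)).memLp_timeMeasure 2).coeFn_toLp,
      ((continuousOn_duhamel hT lam f).memLp_timeMeasure 2).coeFn_toLp, Lp.coeFn_smul a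
      (((continuousOn_duhamel hT lam f).memLp_timeMeasure 2).toLp _),
      ae_restrict_mem measurableSet_Ioo] with t h1 h2 h4 ht
    rw [RingHom.id_apply, h1, h4, Pi.smul_apply, h2, duhamel_congr (g := fun s => a * f s) (τ := t)
      (by filter_upwards [Lp.coeFn_smul a f] with s hs _ using hs) ht.1.le ht.2.le le_rfl]
    simp only [duhamel, smul_eq_mul, mul_left_comm _ a, intervalIntegral.integral_const_mul]

theorem coeFn_duhamelₗ (lam : ℝ) (f : L2 T ℝ) :
    ∀ᵐ t ∂timeMeasure T, duhamelₗ hT lam f t = duhamel lam f t :=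
  ((continuousOn_duhamel hT lam f).memLp_timeMeasure 2).coeFn_toLp

/-- The energy inequality: multiply the equation by `c` and integrate. -/
theorem mul_norm_duhamelₗ_sq_le (lam : ℝ) (f : L2 T ℝ) :
    lam * ‖duhamelₗ hT lam f‖ ^ 2 ≤ ⟪f, duhamelₗ hT lam f⟫ := by
  set c := duhamel lam f with hc
  have hac := absolutelyContinuous_duhamel hT lam f
  have h := hac.integral_deriv_mul_eq_sub hac
  rw [intervalIntegral.integral_of_le hT.le, integral_Ioc_eq_integral_Ioo, duhamel_zero] at h
  have i1 : Integrable (fun t => f t * c t) (timeMeasure T) :=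
    (Lp.memLp f).integrable_mul ((continuousOn_duhamel hT lam f).memLp_timeMeasure 2)
  have i2 : Integrable (fun t => c t * c t) (timeMeasure T) :=
    ((continuousOn_duhamel hT lam f).memLp_timeMeasure 2).integrable_mul
      ((continuousOn_duhamel hT lam f).memLp_timeMeasure 2)
  have e : ∫ t in Ioo 0 T, (deriv c t * c t + c t * deriv c t)
      = 2 * (∫ t in Ioo 0 T, f t * c t) - 2 * lam * ∫ t in Ioo 0 T, c t * c t := by
    rw [← integral_const_mul, ← integral_const_mul,
      ← integral_sub (i1.const_mul _) (i2.const_mul _)]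
    refine integral_congr_ae ?_
    filter_upwards [hasDerivAt_duhamel hT lam f] with t ht
    rw [ht.deriv]
    ring
  rw [← real_inner_self_eq_norm_sq, L2.inner_def, L2.inner_def]
  have e1 : ∫ t in Ioo 0 T, ⟪duhamelₗ hT lam f t, duhamelₗ hT lam f t⟫
      = ∫ t in Ioo 0 T, c t * c t := integral_congr_ae (by
    filter_upwards [coeFn_duhamelₗ hT lam f] with t ht
    simp [ht, hc, sq])
  have e2 : ∫ t in Ioo 0 T, ⟪f t, duhamelₗ hT lam f t⟫
      = ∫ t in Ioo 0 T, f t * c t := integral_congr_ae (by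
    filter_upwards [coeFn_duhamelₗ hT lam f] with t ht
    simp [ht, hc, mul_comm])
  rw [e1, e2]
  rw [e] at h
  nlinarith [mul_self_nonneg (c T)]

theorem norm_duhamelₗ_le {lam : ℝ} (hl : 0 < lam) (f : L2 T ℝ) :
    ‖duhamelₗ hT lam f‖ ≤ lam⁻¹ * ‖f‖ := by
  have h := (mul_norm_duhamelₗ_sq_le hT lam f).trans (real_inner_le_norm _ _)
  rw [inv_mul_eq_div, le_div_iff₀ hl]
  rcases (norm_nonneg (duhamelₗ hT lam f)).eq_or_lt with h0 | h0
  · rw [← h0, zero_mul]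
    exact norm_nonneg f
  · nlinarith

/-- The solution operator of `c' + λ c = f`, `c 0 = 0` on `L²(0, T)`, for `λ > 0`. -/
def duhamelL {lam : ℝ} (hl : 0 < lam) : L2 T ℝ →L[ℝ] L2 T ℝ :=
  (duhamelₗ hT lam).mkContinuous _ (norm_duhamelₗ_le hT hl)

theorem norm_duhamelL_le {lam : ℝ} (hl : 0 < lam) : ‖duhamelL hT hl‖ ≤ lam⁻¹ :=
  LinearMap.mkContinuous_norm_le _ (inv_nonneg.2 hl.le) _

theorem coeFn_duhamelL {lam : ℝ} (hl : 0 < lam) (f : L2 T ℝ) :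
    ∀ᵐ t ∂timeMeasure T, duhamelL hT hl f t = duhamel lam f t := coeFn_duhamelₗ hT lam f

/-- The solution before the time `τ` depends only on the right-hand side before `τ`. -/
theorem cut_duhamelL {lam : ℝ} (hl : 0 < lam) (τ : ℝ) (f : L2 T ℝ) :
    cut τ (duhamelL hT hl (cut τ f)) = cut τ (duhamelL hT hl f) := by
  rw [← sub_eq_zero, ← map_sub, cut_eq_zero_iff]
  filter_upwards [coeFn_duhamelL hT hl f, coeFn_duhamelL hT hl (cut τ f),
    Lp.coeFn_sub (duhamelL hT hl (cut τ f)) (duhamelL hT hl f), ae_restrict_mem measurableSet_Ioo]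
    with t h1 h2 h3 ht htτ
  rw [h3, Pi.sub_apply, h1, h2, sub_eq_zero]
  exact duhamel_congr (coeFn_cut_of_lt τ f) ht.1.le ht.2.le htτ.le

/-- An exponential weight in time shifts the spectral parameter. -/
theorem expMul_duhamelL {lam μ : ℝ} (hl : 0 < lam) (hm : 0 < lam + μ) (f : L2 T ℝ) :
    expMul (-μ) (duhamelL hT hl f) = duhamelL hT hm (expMul (-μ) f) := by
  apply Lp.ext
  filter_upwards [coeFn_duhamelL hT hl f, coeFn_duhamelL hT hm (expMul (-μ) f),
    coeFn_mulLp _ (memLp_exp (-μ)) (duhamelL hT hl f), ae_restrict_mem measurableSet_Ioo]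
    with t h1 h2 h3 ht
  rw [expMul, h3, h1, ← expMul, h2, duhamel_congr (f := expMul (-μ) f)
    (g := fun s => Real.exp (-μ * s) * f s) (τ := t)
    (by filter_upwards [coeFn_mulLp _ (memLp_exp (-μ)) f] with s hs _ using hs)
    ht.1.le ht.2.le le_rfl]
  simp only [duhamel, ← mul_assoc, smul_eq_mul, ← Real.exp_add]
  congr 2
  · ring_nf
  · ext s
    congr 2
    ring_nf

end Scalar

theorem exists_Icc_of_isCompact_subset_Ioo {T : ℝ} (hT : 0 < T) {K : Set ℝ} (hK : IsCompact K)
    (h : K ⊆ Ioo 0 T) : ∃ a b, 0 < a ∧ b < T ∧ K ⊆ Icc a b := by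
  rcases K.eq_empty_or_nonempty with rfl | hne
  · exact ⟨T, 0, hT, hT, empty_subset _⟩
  · obtain ⟨a, ha⟩ := hK.exists_isLeast hne
    obtain ⟨b, hb⟩ := hK.exists_isGreatest hne
    exact ⟨a, b, (h ha.1).1, (h hb.1).2, fun x hx => ⟨ha.2 hx, hb.2 hx⟩⟩

/-- A test function on `(0, T)` with vanishing integral is the derivative of a test function. -/
theorem exists_primitive_test {T : ℝ} (hT : 0 < T) {χ : ℝ → ℝ} (h1 : ContDiff ℝ ∞ χ)
    (h2 : HasCompactSupport χ) (h3 : tsupport χ ⊆ Ioo 0 T) (h0 : ∫ t, χ t = 0) :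
    ∃ η : ℝ → ℝ, ContDiff ℝ ∞ η ∧ HasCompactSupport η ∧ tsupport η ⊆ Ioo 0 T ∧ deriv η = χ := by
  obtain ⟨a, b, ha, hb, hab⟩ := exists_Icc_of_isCompact_subset_Ioo hT h2 h3
  have hχ : ∀ t, t ∉ Icc a b → χ t = 0 := fun t ht =>
    image_eq_zero_of_notMem_tsupport fun h => ht (hab h)
  set η : ℝ → ℝ := fun t => ∫ s in (0 : ℝ)..t, χ s with hη
  have hd : ∀ t, HasDerivAt η (χ t) t := fun t =>
    (h1.continuous.integral_hasStrictDerivAt 0 t).hasDerivAt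
  have hd' : deriv η = χ := funext fun t => (hd t).deriv
  have hsupp : Function.support η ⊆ Icc a b := by
    intro t ht
    by_contra hn
    refine ht ?_
    by_cases hta : t < a
    · rw [hη]
      refine intervalIntegral.integral_zero_ae (.of_forall fun s hs => hχ s fun h => ?_)
      exact absurd (hs.2.trans_lt (max_lt ha hta)) (not_lt.2 h.1)
    · have hbt : b < t := by
        by_contra hbt
        exact hn ⟨not_lt.1 hta, not_lt.1 hbt⟩
      rw [hη]
      simp only
      rw [intervalIntegral.integral_eq_integral_of_support_subset, h0]
      intro s hs
      have hs' : s ∈ Icc a b := by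
        by_contra h
        exact hs (hχ s h)
      exact ⟨ha.trans_le hs'.1, hs'.2.trans hbt.le⟩
  have hts : tsupport η ⊆ Icc a b := closure_minimal hsupp isClosed_Icc
  refine ⟨η, ?_, HasCompactSupport.of_support_subset_isCompact isCompact_Icc hsupp,
    hts.trans fun t ht => ⟨ha.trans_le ht.1, ht.2.trans_lt hb⟩, hd'⟩
  rw [contDiff_infty_iff_deriv]
  exact ⟨fun t => (hd t).differentiableAt, hd' ▸ h1⟩

/-- The lemma of du Bois-Reymond: a function with vanishing weak derivative is constant. -/
theorem exists_ae_eq_const_of_isWeakDeriv_zero {T : ℝ} (hT : 0 < T) {ψ : ℝ → ℝ}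
    (hψ : Integrable ψ (timeMeasure T)) (h : IsWeakDeriv T ψ 0) :
    ∃ κ : ℝ, ∀ᵐ t ∂timeMeasure T, ψ t = κ := by
  let θb : ContDiffBump (T / 2) := ⟨T / 8, T / 4, by linarith, by linarith⟩
  set θ : ℝ → ℝ := θb.normed volume
  have t1 : ContDiff ℝ ∞ θ := θb.contDiff_normed
  have t2 : HasCompactSupport θ := θb.hasCompactSupport_normed
  have t3 : tsupport θ ⊆ Ioo 0 T := by
    rw [θb.tsupport_normed_eq, Real.closedBall_eq_Icc]
    intro t ht
    have h1 : T / 2 - T / 4 ≤ t := ht.1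
    have h2 : t ≤ T / 2 + T / 4 := ht.2
    exact ⟨by linarith, by linarith⟩
  have t4 : ∫ t, θ t = 1 := θb.integral_normed
  have int : ∀ φ : ℝ → ℝ, ContDiff ℝ ∞ φ → HasCompactSupport φ →
      Integrable (fun t => φ t * ψ t) (timeMeasure T) := by
    intro φ h1 h2
    obtain ⟨C, hC⟩ := h2.exists_bound_of_continuous h1.continuous
    exact hψ.bdd_mul h1.continuous.aestronglyMeasurable (Filter.Eventually.of_forall hC)
  set κ := ∫ t in Ioo 0 T, θ t * ψ t
  refine ⟨κ, ?_⟩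
  have key : ∀ φ : ℝ → ℝ, ContDiff ℝ ∞ φ → HasCompactSupport φ → tsupport φ ⊆ Ioo 0 T →
      ∫ t in Ioo 0 T, φ t • (ψ t - κ) = 0 := by
    intro φ h1 h2 h3
    set m := ∫ t, φ t
    have i1 : Integrable φ := h1.continuous.integrable_of_hasCompactSupport h2
    have i2 : Integrable θ := t1.continuous.integrable_of_hasCompactSupport t2
    -- `φ - m θ` has integral zero, hence is the derivative of a test function
    obtain ⟨η, e1, e2, e3, e4⟩ := exists_primitive_test hT (χ := fun t => φ t - m * θ t)
      (h1.sub (contDiff_const.mul t1)) (h2.sub (t2.mul_left (f := fun _ => m)))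
      ((tsupport_sub _ _).trans (union_subset h3 ((tsupport_mul_subset_right
        (f := fun _ => m)).trans t3)))
      (by rw [integral_sub i1 (i2.const_mul m), integral_const_mul, t4]; ring)
    have h' := h η e1 e2 e3
    rw [e4] at h'
    have hm : m = ∫ t in Ioo 0 T, φ t :=
      (setIntegral_eq_integral_of_forall_compl_eq_zero fun t ht =>
        image_eq_zero_of_notMem_tsupport fun h => ht (h3 h)).symm
    have e5 : ∫ t in Ioo 0 T, (φ t - m * θ t) • ψ t
        = (∫ t in Ioo 0 T, φ t * ψ t) - m * κ := by
      rw [← integral_const_mul, ← integral_sub (int φ h1 h2) ((int θ t1 t2).const_mul m)]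
      exact integral_congr_ae (.of_forall fun t => by simp only [smul_eq_mul]; ring)
    rw [e5] at h'
    have e6 : ∫ t in Ioo 0 T, φ t • (ψ t - κ) = (∫ t in Ioo 0 T, φ t * ψ t) - m * κ := by
      rw [hm, ← integral_mul_const, ← integral_sub (int φ h1 h2) (i1.integrableOn.mul_const κ)]
      exact integral_congr_ae (.of_forall fun t => by simp only [smul_eq_mul]; ring)
    rw [e6, h']
    simp
  have := isOpen_Ioo.ae_eq_zero_of_integral_contDiff_smul_eq_zero (μ := timeMeasure T)
    ((hψ.sub (integrable_const κ)).locallyIntegrable.locallyIntegrableOn (Ioo 0 T)) key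
  filter_upwards [this, ae_restrict_mem measurableSet_Ioo] with t ht h2
  exact sub_eq_zero.1 (ht h2)

/-- Two functions that are continuous on `[0, T]` and agree almost everywhere agree on `[0, T]`. -/
theorem eqOn_Icc_of_ae_eq {T : ℝ} (hT : 0 < T) {X : Type*} [TopologicalSpace X] [T2Space X]
    {c d : ℝ → X} (hc : ContinuousOn c (Icc 0 T)) (hd : ContinuousOn d (Icc 0 T))
    (h : ∀ᵐ t ∂timeMeasure T, c t = d t) : EqOn c d (Icc 0 T) := by
  have h' : c =ᵐ[volume.restrict (Icc 0 T)] d := by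
    rw [← restrict_Ioo_eq_restrict_Icc]
    exact h
  exact Measure.eqOn_Icc_of_ae_eq volume hT.ne h' hc hd

/-- Uniqueness for the weak form of `c' + λ c = f`, `c 0 = 0`. -/
theorem eqOn_duhamel_of_isWeakDeriv {T : ℝ} (hT : 0 < T) {lam : ℝ} {f u : L2 T ℝ} {c : ℝ → ℝ}
    (hc : ContinuousOn c (Icc 0 T)) (hu : ∀ᵐ t ∂timeMeasure T, c t = u t) (h0 : c 0 = 0)
    (h : IsWeakDeriv T u fun t => f t - lam * u t) : EqOn c (duhamel lam f) (Icc 0 T) := by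
  set d := duhamel lam f
  have hd := continuousOn_duhamel hT lam f
  have hdw := isWeakDeriv_of_absolutelyContinuous hT (absolutelyContinuous_duhamel hT lam f)
    (hasDerivAt_duhamel hT lam f)
  set ψ : ℝ → ℝ := fun t => Real.exp (lam * t) * (c t - d t) with hψd
  have hψc : ContinuousOn ψ (Icc 0 T) := by
    refine ContinuousOn.mul (by fun_prop) (hc.sub hd)
  have ic : Integrable c (timeMeasure T) := by
    simpa [memLp_one_iff_integrable] using hc.memLp_timeMeasure 1
  have id : Integrable d (timeMeasure T) := by
    simpa [memLp_one_iff_integrable] using hd.memLp_timeMeasure 1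
  have hψ : Integrable ψ (timeMeasure T) := by
    simpa [memLp_one_iff_integrable] using hψc.memLp_timeMeasure 1
  have hw : IsWeakDeriv T ψ 0 := by
    intro η h1 h2 h3
    -- the exponential is an integrating factor: test with `exp (λ t) η t`
    set ζ : ℝ → ℝ := fun t => Real.exp (lam * t) * η t with hζ
    have z1 : ContDiff ℝ ∞ ζ := by fun_prop
    have z2 : HasCompactSupport ζ := h2.mul_left
    have z3 : tsupport ζ ⊆ Ioo 0 T := tsupport_mul_subset_right.trans h3
    have zd : ∀ t, deriv ζ t = Real.exp (lam * t) * deriv η t + lam * ζ t := by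
      intro t
      have hη : HasDerivAt η (deriv η t) t :=
        ((h1.differentiable (by simp)) t).hasDerivAt
      have he : HasDerivAt (fun t => Real.exp (lam * t)) (Real.exp (lam * t) * (lam * 1)) t :=
        ((hasDerivAt_id t).const_mul lam).exp
      have hm : deriv ζ t = _ := (he.mul hη).deriv
      rw [hm, hζ]
      ring
    have bdd : ∀ {φ k : ℝ → ℝ}, Continuous φ → HasCompactSupport φ →
        Integrable k (timeMeasure T) → Integrable (fun t => φ t * k t) (timeMeasure T) := by
      intro φ k p1 p2 hk
      obtain ⟨C, hC⟩ := p2.exists_bound_of_continuous p1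
      exact hk.bdd_mul p1.aestronglyMeasurable (Filter.Eventually.of_forall hC)
    have zdc : Continuous (deriv ζ) := z1.continuous_deriv (by simp)
    have w1 := h ζ z1 z2 z3
    have w2 := hdw ζ z1 z2 z3
    have e1 : ∫ t in Ioo 0 T, deriv ζ t • u t = ∫ t in Ioo 0 T, deriv ζ t * c t :=
      integral_congr_ae (by filter_upwards [hu] with t ht; rw [ht, smul_eq_mul])
    have e2 : ∫ t in Ioo 0 T, ζ t • (f t - lam * u t)
        = (∫ t in Ioo 0 T, ζ t * f t) - lam * ∫ t in Ioo 0 T, ζ t * c t := by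
      rw [← integral_const_mul, ← integral_sub (bdd z1.continuous z2 (L2.integrable f))
        ((bdd z1.continuous z2 ic).const_mul lam)]
      refine integral_congr_ae ?_
      filter_upwards [hu] with t ht
      rw [ht, smul_eq_mul]
      ring
    have e3 : ∫ t in Ioo 0 T, ζ t • (f t - lam * d t)
        = (∫ t in Ioo 0 T, ζ t * f t) - lam * ∫ t in Ioo 0 T, ζ t * d t := by
      rw [← integral_const_mul, ← integral_sub (bdd z1.continuous z2 (L2.integrable f))
        ((bdd z1.continuous z2 id).const_mul lam)]
      refine integral_congr_ae (.of_forall fun t => ?_)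
      simp only [smul_eq_mul]
      ring
    have e4 : ∫ t in Ioo 0 T, deriv η t • ψ t
        = (∫ t in Ioo 0 T, deriv ζ t * c t) - (∫ t in Ioo 0 T, deriv ζ t * d t)
          - lam * ((∫ t in Ioo 0 T, ζ t * c t) - ∫ t in Ioo 0 T, ζ t * d t) := by
      rw [← integral_sub (bdd z1.continuous z2 ic) (bdd z1.continuous z2 id), ← integral_const_mul,
        ← integral_sub (bdd zdc z2.deriv ic) (bdd zdc z2.deriv id), ← integral_sub]
      · refine integral_congr_ae (.of_forall fun t => ?_)
        simp only [smul_eq_mul, zd, hψd]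
        ring
      · exact (bdd zdc z2.deriv ic).sub (bdd zdc z2.deriv id)
      · exact ((bdd z1.continuous z2 ic).sub (bdd z1.continuous z2 id)).const_mul lam
    rw [e1, e2] at w1
    rw [e3] at w2
    simp only [smul_eq_mul] at w2
    rw [e4, w1, w2]
    simp only [Pi.zero_apply, smul_zero, integral_zero, neg_zero]
    ring
  obtain ⟨κ, hκ⟩ := exists_ae_eq_const_of_isWeakDeriv_zero hT hψ hw
  have hall := eqOn_Icc_of_ae_eq hT hψc continuousOn_const hκ
  have hκ0 : κ = 0 := by
    have := hall (left_mem_Icc.2 hT.le)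
    simp only [hψd, h0, d, duhamel_zero, sub_zero, mul_zero] at this
    exact this.symm
  intro t ht
  have h1 : Real.exp (lam * t) * (c t - d t) = 0 := (hall ht).trans hκ0
  exact sub_eq_zero.1 ((mul_eq_zero.1 h1).resolve_left (Real.exp_pos _).ne')

/-! ### Diagonal operators -/

/-- The space `ℓ²` of real sequences, in which all functions are expanded. -/
abbrev Ell2 : Type := lp (fun _ : ℕ => ℝ) 2

section Diagonal

variable {G : Type*} [NormedAddCommGroup G] [NormedSpace ℝ G]

theorem memℓp_diag {R : ℕ → G →L[ℝ] G} (hR : ∃ C, ∀ k, ‖R k‖ ≤ C)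
    (f : lp (fun _ : ℕ => G) 2) : Memℓp (E := fun _ : ℕ => G) (fun k => R k (f k)) 2 := by
  obtain ⟨C, hC⟩ := hR
  rw [memℓp_gen_iff (by simp)]
  have hs := (memℓp_gen_iff (p := 2) (by simp)).1 ((lp.memℓp f).const_smul C)
  refine Summable.of_nonneg_of_le (fun k => by positivity) (fun k => ?_) hs
  refine Real.rpow_le_rpow (norm_nonneg _) ?_ (by simp)
  rw [Pi.smul_apply, norm_smul]
  refine ((R k).le_opNorm _).trans (mul_le_mul_of_nonneg_right ?_ (norm_nonneg _))
  exact (hC k).trans (le_abs_self C)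

theorem norm_diag_le {R : ℕ → G →L[ℝ] G} {C : ℝ} (hC : ∀ k, ‖R k‖ ≤ C)
    (f g : lp (fun _ : ℕ => G) 2) (hg : ∀ k, g k = R k (f k)) : ‖g‖ ≤ C * ‖f‖ := by
  have hC0 : 0 ≤ C := (norm_nonneg _).trans (hC 0)
  calc ‖g‖ ≤ ‖C • f‖ := by
        refine lp.norm_mono (by simp) fun k => ?_
        rw [hg, lp.coeFn_smul, Pi.smul_apply, norm_smul, Real.norm_of_nonneg hC0]
        exact ((R k).le_opNorm _).trans (mul_le_mul_of_nonneg_right (hC k) (norm_nonneg _))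
    _ = C * ‖f‖ := by rw [norm_smul, Real.norm_of_nonneg hC0]

/-- The diagonal operator on `ℓ²(ℕ; G)` with the uniformly bounded entries `R k`. -/
def diag (R : ℕ → G →L[ℝ] G) (hR : ∃ C, ∀ k, ‖R k‖ ≤ C) :
    lp (fun _ : ℕ => G) 2 →L[ℝ] lp (fun _ : ℕ => G) 2 :=
  LinearMap.mkContinuousOfExistsBound
    { toFun := fun f => ⟨fun k => R k (f k), memℓp_diag hR f⟩
      map_add' := fun f g => by
        ext k
        exact map_add (R k) (f k) (g k)
      map_smul' := fun c f => by
        ext k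
        exact map_smul (R k) c (f k) }
    (hR.imp fun _ hC f => norm_diag_le hC f _ fun _ => rfl)

end Diagonal

/-! ### Coordinates in `L²(0, T; ℓ²)` -/

section Coordinates

variable {T : ℝ}

/-- The `k`-th coordinate of a function in `L²(0, T; ℓ²)`. -/
def coord (k : ℕ) : L2 T Ell2 →L[ℝ] L2 T ℝ :=
  (lp.evalCLM ℝ (fun _ : ℕ => ℝ) 2 k).compLpL 2 (timeMeasure T)

theorem coeFn_coord (k : ℕ) (f : L2 T Ell2) : ∀ᵐ t ∂timeMeasure T, coord k f t = f t k :=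
  (lp.evalCLM ℝ (fun _ : ℕ => ℝ) 2 k).coeFn_compLpL f

theorem coord_ext {f g : L2 T Ell2} (h : ∀ k, coord k f = coord k g) : f = g := by
  apply Lp.ext
  have h1 : ∀ᵐ t ∂timeMeasure T, ∀ k, coord k f t = f t k := ae_all_iff.2 fun k => coeFn_coord k f
  have h2 : ∀ᵐ t ∂timeMeasure T, ∀ k, coord k g t = g t k := ae_all_iff.2 fun k => coeFn_coord k g
  filter_upwards [h1, h2] with t h1 h2
  ext k
  rw [← h1, ← h2, h]

/-- Functions with values in the `k`-th coordinate axis of `ℓ²`. -/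
def axis (k : ℕ) : L2 T ℝ →L[ℝ] L2 T Ell2 :=
  (lp.singleContinuousLinearMap ℝ (fun _ : ℕ => ℝ) 2 k).compLpL 2 (timeMeasure T)

theorem coeFn_axis (k : ℕ) (f : L2 T ℝ) :
    ∀ᵐ t ∂timeMeasure T, axis k f t = lp.single 2 k (f t) :=
  (lp.singleContinuousLinearMap ℝ (fun _ : ℕ => ℝ) 2 k).coeFn_compLpL f

theorem inner_axis (k : ℕ) (f : L2 T ℝ) (g : L2 T Ell2) :
    ⟪axis k f, g⟫ = ⟪f, coord k g⟫ := by
  rw [L2.inner_def, L2.inner_def]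
  refine integral_congr_ae ?_
  filter_upwards [coeFn_axis k f, coeFn_coord k g] with t h1 h2
  rw [h1, h2, lp.inner_single_left]

theorem coord_axis (k : ℕ) (f : L2 T ℝ) : coord k (axis k f) = f := by
  apply Lp.ext
  filter_upwards [coeFn_axis k f, coeFn_coord k (axis k f)] with t h1 h2
  rw [h2, h1, lp.single_apply_self]

theorem coord_axis_of_ne {j k : ℕ} (h : j ≠ k) (f : L2 T ℝ) : coord j (axis k f) = 0 := by
  apply Lp.ext
  filter_upwards [coeFn_axis k f, coeFn_coord j (axis k f), Lp.coeFn_zero ℝ 2 (timeMeasure T)]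
    with t h1 h2 h3
  rw [h2, h1, lp.single_apply_ne _ _ _ h, h3, Pi.zero_apply]

/-- `axis` as an isometry. -/
def axisₗᵢ (k : ℕ) : L2 T ℝ →ₗᵢ[ℝ] L2 T Ell2 where
  toLinearMap := (axis k).toLinearMap
  norm_map' f := by
    have h := inner_axis k f (axis k f)
    rw [coord_axis, real_inner_self_eq_norm_sq, real_inner_self_eq_norm_sq] at h
    exact (sq_eq_sq₀ (norm_nonneg _) (norm_nonneg _)).1 h

theorem axisₗᵢ_apply (k : ℕ) (f : L2 T ℝ) : axisₗᵢ k f = axis k f := rfl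

/-- `L²(0, T; ℓ²)` is the Hilbert sum of its coordinate axes. -/
theorem isHilbertSum_axis :
    IsHilbertSum ℝ (fun _ : ℕ => L2 T ℝ) (axisₗᵢ (T := T)) := by
  refine IsHilbertSum.mk ?_ ?_
  · intro j k hjk f g
    rw [axisₗᵢ_apply, axisₗᵢ_apply, inner_axis, coord_axis_of_ne hjk, inner_zero_right]
  · rw [top_le_iff, Submodule.topologicalClosure_eq_top_iff, Submodule.eq_bot_iff]
    intro g hg
    refine coord_ext fun k => ?_
    have hm : axisₗᵢ k (coord k g) ∈ ⨆ i, LinearMap.range (axisₗᵢ (T := T) i).toLinearMap :=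
      Submodule.mem_iSup_of_mem k ⟨coord k g, rfl⟩
    have h := (Submodule.mem_orthogonal _ _).1 hg _ hm
    rw [axisₗᵢ_apply, inner_axis, inner_self_eq_zero] at h
    rw [h, map_zero]

/-- The isometry `L²(0, T; ℓ²) ≃ ℓ²(ℕ; L²(0, T))`. -/
def coordEquiv : L2 T Ell2 ≃ₗᵢ[ℝ] lp (fun _ : ℕ => L2 T ℝ) 2 :=
  isHilbertSum_axis.linearIsometryEquiv

theorem coordEquiv_apply (f : L2 T Ell2) (k : ℕ) : coordEquiv f k = coord k f := by
  refine ext_inner_left ℝ fun g => ?_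
  have h : coordEquiv.symm (lp.single 2 k g) = axis k g :=
    isHilbertSum_axis.linearIsometryEquiv_symm_apply_single g
  calc ⟪g, coordEquiv f k⟫ = ⟪lp.single 2 k g, coordEquiv f⟫ :=
        (lp.inner_single_left (𝕜 := ℝ) (G := fun _ : ℕ => L2 T ℝ) k g (coordEquiv f)).symm
    _ = ⟪axis k g, f⟫ := by
        rw [← h, ← coordEquiv.inner_map_map (coordEquiv.symm _),
          LinearIsometryEquiv.apply_symm_apply]
    _ = ⟪g, coord k f⟫ := inner_axis k g f

theorem coord_coordEquiv_symm (g : lp (fun _ : ℕ => L2 T ℝ) 2) (k : ℕ) :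
    coord k (coordEquiv.symm g) = g k := by
  rw [← coordEquiv_apply, LinearIsometryEquiv.apply_symm_apply]

/-- The operator on `L²(0, T; ℓ²)` that acts by `R k` on the `k`-th coordinate. -/
def timeDiag (R : ℕ → L2 T ℝ →L[ℝ] L2 T ℝ) (hR : ∃ C, ∀ k, ‖R k‖ ≤ C) :
    L2 T Ell2 →L[ℝ] L2 T Ell2 :=
  coordEquiv.symm.toContinuousLinearEquiv.toContinuousLinearMap ∘L diag R hR ∘L
    coordEquiv.toContinuousLinearEquiv.toContinuousLinearMap

theorem coord_timeDiag (R : ℕ → L2 T ℝ →L[ℝ] L2 T ℝ) (hR : ∃ C, ∀ k, ‖R k‖ ≤ C) (f : L2 T Ell2)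
    (k : ℕ) : coord k (timeDiag R hR f) = R k (coord k f) := by
  rw [← coordEquiv_apply f]
  exact coord_coordEquiv_symm _ k

theorem norm_timeDiag_le {R : ℕ → L2 T ℝ →L[ℝ] L2 T ℝ} {C : ℝ} (hC : ∀ k, ‖R k‖ ≤ C)
    (f : L2 T Ell2) : ‖timeDiag R ⟨C, hC⟩ f‖ ≤ C * ‖f‖ := by
  have h := norm_diag_le hC (coordEquiv f) (diag R ⟨C, hC⟩ (coordEquiv f)) fun _ => rfl
  rw [LinearIsometryEquiv.norm_map] at h
  refine le_trans (le_of_eq ?_) h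
  exact coordEquiv.symm.norm_map _

theorem coord_mulLp (m : ℝ → ℝ) (hm : MemLp m ∞ (timeMeasure T)) (k : ℕ) (f : L2 T Ell2) :
    coord k (mulLp m hm f) = mulLp m hm (coord k f) :=
  (mulLp_comp m hm _ f).symm

end Coordinates

/-! ### Weak derivatives -/

section Weak

variable {T : ℝ} {E F : Type*} [NormedAddCommGroup E] [NormedSpace ℝ E] [NormedAddCommGroup F]
  [NormedSpace ℝ F]

theorem IsWeakDeriv.congr {u u' v v' : ℝ → F} (h : IsWeakDeriv T u v)
    (hu : ∀ᵐ t ∂timeMeasure T, u t = u' t) (hv : ∀ᵐ t ∂timeMeasure T, v t = v' t) :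
    IsWeakDeriv T u' v' := by
  intro η h1 h2 h3
  have e1 : ∫ t in Ioo 0 T, deriv η t • u' t = ∫ t in Ioo 0 T, deriv η t • u t :=
    integral_congr_ae (by filter_upwards [hu] with t ht; rw [ht])
  have e2 : ∫ t in Ioo 0 T, η t • v' t = ∫ t in Ioo 0 T, η t • v t :=
    integral_congr_ae (by filter_upwards [hv] with t ht; rw [ht])
  rw [e1, e2, h η h1 h2 h3]

theorem IsWeakDeriv.clm_comp [CompleteSpace E] [CompleteSpace F] {u v : L2 T E}
    (h : IsWeakDeriv T u v) (A : E →L[ℝ] F) :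
    IsWeakDeriv T (fun t => A (u t)) fun t => A (v t) := by
  intro η h1 h2 h3
  have hd : Continuous (deriv η) := h1.continuous_deriv (by simp)
  have e1 := A.integral_comp_comm (integrable_test hd h2.deriv u)
  have e2 := A.integral_comp_comm (integrable_test h1.continuous h2 v)
  simp only [map_smul] at e1 e2
  rw [e1, e2, h η h1 h2 h3, map_neg]

/-- Weak derivatives in `ℓ²` can be computed coordinatewise. -/
theorem isWeakDeriv_of_coord {u v : L2 T Ell2}
    (h : ∀ k, IsWeakDeriv T (coord k u) (coord k v)) : IsWeakDeriv T u v := by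
  intro η h1 h2 h3
  have hd : Continuous (deriv η) := h1.continuous_deriv (by simp)
  ext k
  have e1 := (lp.evalCLM ℝ (fun _ : ℕ => ℝ) 2 k).integral_comp_comm (integrable_test hd h2.deriv u)
  have e2 := (lp.evalCLM ℝ (fun _ : ℕ => ℝ) 2 k).integral_comp_comm
    (integrable_test h1.continuous h2 v)
  have h' := (h k).congr (coeFn_coord k u) (coeFn_coord k v) η h1 h2 h3
  simp only [map_smul] at e1 e2
  have e3 : lp.evalCLM ℝ (fun _ : ℕ => ℝ) 2 k (∫ t in Ioo 0 T, deriv η t • u t)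
      = lp.evalCLM ℝ (fun _ : ℕ => ℝ) 2 k (-∫ t in Ioo 0 T, η t • v t) := by
    rw [map_neg, ← e1, ← e2]
    exact h'
  exact e3

end Weak

/-! ### The linear problem in coordinates -/

namespace SpectralOperator

variable {H : Type*} [NormedAddCommGroup H] [InnerProductSpace ℝ H] [CompleteSpace H]
  (A : SpectralOperator H)

theorem rpow_neg_eigval_le {s : ℝ} (hs : 0 ≤ s) (k : ℕ) :
    A.eigval k ^ (-s) ≤ A.eigval 0 ^ (-s) :=
  Real.rpow_le_rpow_of_nonpos A.eigval_pos (A.eigval_mono (Nat.zero_le k)) (by linarith)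

/-- The operator `𝒜 ^ (-s)`, `s ≥ 0`, in the coordinates of the eigenbasis. -/
def negPow (s : ℝ) (hs : 0 ≤ s) : Ell2 →L[ℝ] Ell2 :=
  diag (fun k => (A.eigval k ^ (-s)) • ContinuousLinearMap.id ℝ ℝ)
    ⟨A.eigval 0 ^ (-s), fun k => by
      rw [norm_smul, ContinuousLinearMap.norm_id, mul_one,
        Real.norm_of_nonneg (Real.rpow_pos_of_pos (A.eigval_pos' k) _).le]
      exact A.rpow_neg_eigval_le hs k⟩

theorem negPow_apply {s : ℝ} (hs : 0 ≤ s) (x : Ell2) (k : ℕ) :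
    A.negPow s hs x k = A.eigval k ^ (-s) * x k := rfl

variable {T : ℝ}

theorem coord_negPow {s : ℝ} (hs : 0 ≤ s) (f : L2 T Ell2) (k : ℕ) :
    coord k ((A.negPow s hs).compLpL 2 (timeMeasure T) f) = A.eigval k ^ (-s) • coord k f := by
  apply Lp.ext
  filter_upwards [coeFn_coord k f, coeFn_coord k ((A.negPow s hs).compLpL 2 (timeMeasure T) f),
    (A.negPow s hs).coeFn_compLpL f, Lp.coeFn_smul (A.eigval k ^ (-s)) (coord k f)]
    with t h1 h2 h3 h4
  rw [h2, h3, h4, Pi.smul_apply, h1, negPow_apply, smul_eq_mul]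

variable (hT : 0 < T)

theorem norm_rpow_smul_duhamelL_le {lam r : ℝ} (hl : 0 < lam) {μ : ℝ} (hμ : 0 ≤ μ) :
    ‖lam ^ r • duhamelL hT (show 0 < lam + μ by positivity)‖ ≤ lam ^ r * (lam + μ)⁻¹ := by
  rw [norm_smul, Real.norm_of_nonneg (Real.rpow_pos_of_pos hl r).le]
  exact mul_le_mul_of_nonneg_left (norm_duhamelL_le hT _) (Real.rpow_pos_of_pos hl r).le

/-- Maximal regularity for one eigenvalue: `‖λ c‖ ≤ ‖f‖` if `c' + λ c = f`, `c 0 = 0`. -/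
theorem norm_smul_duhamelL_le {lam : ℝ} (hl : 0 < lam) : ‖lam • duhamelL hT hl‖ ≤ 1 := by
  rw [norm_smul, Real.norm_of_nonneg hl.le]
  calc lam * ‖duhamelL hT hl‖ ≤ lam * lam⁻¹ :=
        mul_le_mul_of_nonneg_left (norm_duhamelL_le hT _) hl.le
    _ = 1 := mul_inv_cancel₀ hl.ne'

/-- The operator `f ↦ 𝒜 v`, where `v' + 𝒜 v = f`, `v 0 = 0`, in coordinates. -/
def maxReg : L2 T Ell2 →L[ℝ] L2 T Ell2 :=
  timeDiag (fun k => A.eigval k • duhamelL hT (A.eigval_pos' k))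
    ⟨1, fun k => norm_smul_duhamelL_le hT (A.eigval_pos' k)⟩

theorem coord_maxReg (f : L2 T Ell2) (k : ℕ) :
    coord k (A.maxReg hT f) = A.eigval k • duhamelL hT (A.eigval_pos' k) (coord k f) :=
  coord_timeDiag _ _ _ _

theorem norm_maxReg_le (f : L2 T Ell2) : ‖A.maxReg hT f‖ ≤ ‖f‖ := by
  have h := norm_timeDiag_le (fun k => norm_smul_duhamelL_le hT (A.eigval_pos' k)) f
  rwa [one_mul] at h

theorem norm_halfReg_entry_le {μ : ℝ} (hμ : 0 ≤ μ) (k : ℕ) :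
    ‖A.eigval k ^ (1 / 2 : ℝ) • duhamelL hT (show 0 < A.eigval k + μ by
      have := A.eigval_pos' k; positivity)‖ ≤ A.eigval 0 ^ (-(1 / 2) : ℝ) := by
  have h := A.eigval_pos' k
  refine (norm_rpow_smul_duhamelL_le hT h hμ).trans ?_
  refine le_trans ?_ (A.rpow_neg_eigval_le (by norm_num) k)
  calc A.eigval k ^ (1 / 2 : ℝ) * (A.eigval k + μ)⁻¹
      ≤ A.eigval k ^ (1 / 2 : ℝ) * (A.eigval k)⁻¹ := by
        gcongr
        linarith
    _ = A.eigval k ^ (-(1 / 2) : ℝ) := by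
        rw [← Real.rpow_neg_one, ← Real.rpow_add h]
        norm_num

/-- The operator `f ↦ 𝒜 ^ (1/2) v`, where `v' + (𝒜 + μ) v = f`, `v 0 = 0`, in coordinates. -/
def halfReg (μ : ℝ) (hμ : 0 ≤ μ) : L2 T Ell2 →L[ℝ] L2 T Ell2 :=
  timeDiag (fun k => A.eigval k ^ (1 / 2 : ℝ) • duhamelL hT (show 0 < A.eigval k + μ by
      have := A.eigval_pos' k; positivity))
    ⟨_, A.norm_halfReg_entry_le hT hμ⟩

theorem coord_halfReg {μ : ℝ} (hμ : 0 ≤ μ) (f : L2 T Ell2) (k : ℕ) :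
    coord k (A.halfReg hT μ hμ f) = A.eigval k ^ (1 / 2 : ℝ) • duhamelL hT
      (show 0 < A.eigval k + μ by have := A.eigval_pos' k; positivity) (coord k f) :=
  coord_timeDiag _ _ _ _

/-- As `√λ / (λ + μ) ≤ 1 / (2 √μ)`, the operator `halfReg` is small for large `μ`. -/
theorem norm_halfReg_le {m : ℝ} (hm : 0 < m) (f : L2 T Ell2) :
    ‖A.halfReg hT (m ^ 2) (sq_nonneg m) f‖ ≤ (2 * m)⁻¹ * ‖f‖ := by
  refine norm_timeDiag_le (fun k => ?_) f
  have h := A.eigval_pos' k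
  refine (norm_rpow_smul_duhamelL_le hT h (sq_nonneg m)).trans ?_
  rw [← Real.sqrt_eq_rpow, ← div_eq_mul_inv, div_le_iff₀ (by positivity), inv_mul_eq_div,
    le_div_iff₀ (by positivity)]
  nlinarith [Real.sq_sqrt h.le, sq_nonneg (Real.sqrt (A.eigval k) - m)]

/-- The weight `exp (-μ t)` replaces `𝒜` by `𝒜 + μ`. -/
theorem expMul_halfReg {μ : ℝ} (hμ : 0 ≤ μ) (f : L2 T Ell2) :
    expMul (-μ) (A.halfReg hT 0 le_rfl f) = A.halfReg hT μ hμ (expMul (-μ) f) := by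
  refine coord_ext fun k => ?_
  have h := A.eigval_pos' k
  rw [expMul, coord_mulLp, coord_halfReg, coord_halfReg, coord_mulLp, map_smul]
  congr 1
  have h' := expMul_duhamelL hT (lam := A.eigval k + 0) (μ := μ) (by linarith) (by linarith)
    (coord k f)
  simpa only [add_zero, expMul] using h'

theorem cut_maxReg (τ : ℝ) (f : L2 T Ell2) :
    cut τ (A.maxReg hT (cut τ f)) = cut τ (A.maxReg hT f) := by
  refine coord_ext fun k => ?_
  rw [cut, coord_mulLp, coord_mulLp, coord_maxReg, coord_maxReg, map_smul, map_smul, coord_mulLp]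
  congr 1
  exact cut_duhamelL hT _ τ _

/-- The loss of `𝒜 ^ (-1/2)` turns maximal regularity into `𝒜 ^ (1/2) (∂ₜ + 𝒜)⁻¹`. -/
theorem negPow_maxReg_negPow {s t : ℝ} (hs : 0 ≤ s) (ht : 0 ≤ t) (hst : s + t = 1 / 2)
    (f : L2 T Ell2) :
    (A.negPow s hs).compLpL 2 (timeMeasure T)
      (A.maxReg hT ((A.negPow t ht).compLpL 2 (timeMeasure T) f)) = A.halfReg hT 0 le_rfl f := by
  refine coord_ext fun k => ?_
  have h := A.eigval_pos' k
  rw [coord_negPow, coord_maxReg, coord_negPow, coord_halfReg, map_smul, smul_smul, smul_smul]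
  simp only [add_zero]
  congr 1
  nth_rw 2 [← Real.rpow_one (A.eigval k)]
  rw [← Real.rpow_add h, ← Real.rpow_add h]
  congr 1
  linarith

/-- In the weighted norm `‖exp (-μ t) f‖` with large `μ`, the operator `Q ∘ 𝒜 ^ (1/2) (∂ₜ + 𝒜)⁻¹`
on `L²(0, T; H)` is a contraction. -/
theorem exists_weight (Q : Ell2 →L[ℝ] Ell2) : ∃ μ : ℝ, ∃ hμ : 0 ≤ μ, ∀ f : L2 T Ell2,
    ‖Q.compLpL 2 (timeMeasure T) (A.halfReg hT μ hμ f)‖ ≤ 1 / 2 * ‖f‖ := by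
  have hm : 0 < ‖Q‖ + 1 := by positivity
  refine ⟨(‖Q‖ + 1) ^ 2, sq_nonneg _, fun f => ?_⟩
  calc ‖Q.compLpL 2 (timeMeasure T) (A.halfReg hT _ (sq_nonneg _) f)‖
      ≤ ‖Q‖ * ‖A.halfReg hT _ (sq_nonneg _) f‖ := Q.norm_compLp_le _
    _ ≤ ‖Q‖ * ((2 * (‖Q‖ + 1))⁻¹ * ‖f‖) := by gcongr; exact A.norm_halfReg_le hT hm f
    _ = ‖Q‖ * (2 * (‖Q‖ + 1))⁻¹ * ‖f‖ := by ring
    _ ≤ 1 / 2 * ‖f‖ := by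
        gcongr
        rw [← div_eq_mul_inv, div_le_iff₀ (by positivity)]
        linarith

/-- The equation `y + Q 𝒜 ^ (1/2) (∂ₜ + 𝒜)⁻¹ y = z` is solvable in `L²(0, T; H)`, by the Neumann
series in a weighted norm. -/
theorem exists_solution_operator (Q : Ell2 →L[ℝ] Ell2) :
    ∃ S : L2 T Ell2 →L[ℝ] L2 T Ell2, ∀ z : L2 T Ell2,
      S z + Q.compLpL 2 (timeMeasure T) (A.halfReg hT 0 le_rfl (S z)) = z := by
  obtain ⟨μ, hμ, h⟩ := A.exists_weight hT Q
  set W : L2 T Ell2 →L[ℝ] L2 T Ell2 := (Q.compLpL 2 (timeMeasure T)) ∘L A.halfReg hT μ hμ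
  have hW : ‖-W‖ < 1 := by
    rw [norm_neg]
    exact (W.opNorm_le_bound (by norm_num) h).trans_lt (by norm_num)
  set u := Units.oneSub (-W) hW
  set B : L2 T Ell2 →L[ℝ] L2 T Ell2 := ↑u⁻¹
  have hB : ∀ x, B x + W (B x) = x := by
    intro x
    have : (1 - -W) * B = 1 := u.mul_inv
    have h' := congrArg (fun L : L2 T Ell2 →L[ℝ] L2 T Ell2 => L x) this
    simpa using h'
  refine ⟨expMul μ ∘L B ∘L expMul (-μ), fun z => ?_⟩
  set y := B (expMul (-μ) z)
  have hy : y + W y = expMul (-μ) z := hB _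
  have h1 : expMul (-μ) (expMul μ y) = y := by
    simpa using expMul_expMul_neg (-μ) y
  have h2 : expMul (-μ) (Q.compLpL 2 (timeMeasure T) (A.halfReg hT 0 le_rfl (expMul μ y)))
      = W y := by
    rw [expMul, mulLp_comp, ← expMul, A.expMul_halfReg hT hμ, h1]
    rfl
  change expMul μ y + _ = z
  have h3 := congrArg (expMul μ) hy
  rw [expMul_expMul_neg, map_add, ← h2, expMul_expMul_neg] at h3
  exact h3

/-- The homogeneous equation, cut off at the time `τ`, has only the trivial solution: the cut-off
does not increase the weighted norm. -/
theorem eq_zero_of_eq_neg_cut (Q : Ell2 →L[ℝ] Ell2) (τ : ℝ) {y : L2 T Ell2}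
    (hy : y = -cut τ (Q.compLpL 2 (timeMeasure T) (A.halfReg hT 0 le_rfl y))) : y = 0 := by
  obtain ⟨μ, hμ, h⟩ := A.exists_weight hT Q
  have h1 : expMul (-μ) y = -cut τ (Q.compLpL 2 (timeMeasure T)
      (A.halfReg hT μ hμ (expMul (-μ) y))) := by
    nth_rw 1 [hy]
    rw [map_neg, ← cut_expMul, expMul, mulLp_comp, ← expMul, A.expMul_halfReg hT hμ]
  have h2 : ‖expMul (-μ) y‖ ≤ 1 / 2 * ‖expMul (-μ) y‖ := by
    nth_rw 1 [h1]
    rw [norm_neg]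
    exact (norm_cut_le _ _).trans (h _)
  have h3 : expMul (-μ) y = 0 := by
    rw [← norm_le_zero_iff]
    linarith
  rw [← expMul_expMul_neg μ y, h3, map_zero]

/-- The energy identity for `t ↦ exp (-λ t)`: the solution of `c' + λ c = 0`, `c 0 = 1` satisfies
`‖λ ^ (1/2) c‖ ≤ 1`. -/
theorem mul_norm_exp_sq_le {lam : ℝ} (hl : 0 < lam) (hT : 0 < T) :
    ‖lam ^ (1 / 2 : ℝ) • ((memLp_exp (T := T) (-lam)).mono_exponent
      (p := 2) le_top).toLp (fun t => Real.exp (-lam * t))‖ ≤ 1 := by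
  set e : L2 T ℝ := ((memLp_exp (T := T) (-lam)).mono_exponent
      (p := 2) le_top).toLp (fun t => Real.exp (-lam * t))
  have hac := absolutelyContinuous_exp (T := T) (-lam)
  have h := hac.integral_deriv_mul_eq_sub hac
  rw [intervalIntegral.integral_of_le hT.le, integral_Ioc_eq_integral_Ioo] at h
  have e1 : ⟪e, e⟫ = ∫ t in Ioo 0 T, Real.exp (-lam * t) * Real.exp (-lam * t) := by
    rw [L2.inner_def]
    refine integral_congr_ae ?_
    filter_upwards [((memLp_exp (T := T) (-lam)).mono_exponent
      (p := 2) le_top).coeFn_toLp] with t ht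
    rw [show e t = Real.exp (-lam * t) from ht, real_inner_self_eq_norm_mul_norm,
      Real.norm_of_nonneg (Real.exp_pos _).le]
  have e2 : ∀ t, deriv (fun t => Real.exp (-lam * t)) t = -lam * Real.exp (-lam * t) := by
    intro t
    have : HasDerivAt (fun t => Real.exp (-lam * t)) (Real.exp (-lam * t) * (-lam * 1)) t :=
      ((hasDerivAt_id t).const_mul (-lam)).exp
    rw [this.deriv]
    ring
  have e3 : ∫ t in Ioo 0 T, (deriv (fun t => Real.exp (-lam * t)) t * Real.exp (-lam * t)
      + Real.exp (-lam * t) * deriv (fun t => Real.exp (-lam * t)) t) = -(2 * lam) * ⟪e, e⟫ := by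
    rw [e1, ← integral_const_mul]
    refine integral_congr_ae (.of_forall fun t => ?_)
    simp only [e2]
    ring
  rw [e3, real_inner_self_eq_norm_sq] at h
  simp only [mul_zero, Real.exp_zero, mul_one] at h
  have h2 : lam * ‖e‖ ^ 2 ≤ 1 := by nlinarith [mul_self_nonneg (Real.exp (-lam * T))]
  rw [norm_smul, Real.norm_of_nonneg (Real.rpow_nonneg hl.le _), ← Real.sqrt_eq_rpow]
  have h3 : (Real.sqrt lam * ‖e‖) ^ 2 ≤ 1 := by rw [mul_pow, Real.sq_sqrt hl.le]; exact h2
  exact (sq_le_one_iff₀ (by positivity)).1 h3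

/-- For an initial value with `ℓ²`-coordinates `w`, the solution of `v' + 𝒜 v = 0` lies in the
space of maximal regularity. -/
theorem exists_initial_lift (hT : 0 < T) (w : Ell2) : ∃ a : L2 T Ell2, ‖a‖ ≤ ‖w‖ ∧
    ∀ k, ∀ᵐ t ∂timeMeasure T,
      coord k a t = A.eigval k ^ (1 / 2 : ℝ) * w k * Real.exp (-A.eigval k * t) := by
  set e : ℕ → L2 T ℝ := fun k => A.eigval k ^ (1 / 2 : ℝ) •
    ((memLp_exp (T := T) (-A.eigval k)).mono_exponent (p := 2) le_top).toLp
      (fun t => Real.exp (-A.eigval k * t))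
  have he : ∀ k, ‖w k • e k‖ ≤ ‖w k‖ := fun k => by
    rw [norm_smul]
    exact mul_le_of_le_one_right (norm_nonneg _) (mul_norm_exp_sq_le (A.eigval_pos' k) hT)
  have hmem : Memℓp (E := fun _ : ℕ => L2 T ℝ) (fun k => w k • e k) 2 := by
    rw [memℓp_gen_iff (by simp)]
    refine Summable.of_nonneg_of_le (fun k => by positivity) (fun k => ?_)
      ((memℓp_gen_iff (p := 2) (by simp)).1 (lp.memℓp w))
    exact Real.rpow_le_rpow (norm_nonneg _) (he k) (by simp)
  refine ⟨coordEquiv.symm ⟨_, hmem⟩, ?_, fun k => ?_⟩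
  · rw [LinearIsometryEquiv.norm_map]
    exact lp.norm_mono (by simp) he
  · rw [coord_coordEquiv_symm]
    filter_upwards [Lp.coeFn_smul (w k) (e k), Lp.coeFn_smul (A.eigval k ^ (1 / 2 : ℝ))
      (((memLp_exp (T := T) (-A.eigval k)).mono_exponent (p := 2) le_top).toLp
      (fun t => Real.exp (-A.eigval k * t))), ((memLp_exp (T := T)
      (-A.eigval k)).mono_exponent (p := 2) le_top).coeFn_toLp] with t h1 h2 h3
    change (w k • e k : Lp ℝ 2 (timeMeasure T)) t = _
    rw [h1, Pi.smul_apply, h2, Pi.smul_apply, h3, smul_eq_mul, smul_eq_mul]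
    ring

/-- The initial condition `v 0 = v₀` in coordinates: `a` represents `𝒜 ^ ((1 + σ)/2) v` and `w`
represents `𝒜 ^ (σ/2) v₀`, and every coordinate of `v` has a continuous representative on `[0, T]`
with the right initial value. The coordinates compared are those of `𝒜 ^ (-(1 - σ)/2) v`, so that
`σ` does not appear. -/
def CoordInit (a : L2 T Ell2) (w : Ell2) : Prop :=
  ∀ k, ∃ c : ℝ → ℝ, ContinuousOn c (Icc 0 T) ∧
    (∀ᵐ t ∂timeMeasure T, c t = A.eigval k ^ (-1 : ℝ) * a t k) ∧
    c 0 = A.eigval k ^ (-(1 / 2) : ℝ) * w k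

variable {σ : ℝ} (hσ0 : 0 ≤ σ / 2) (hσ1 : 0 ≤ (1 - σ) / 2) (Q : Ell2 →L[ℝ] Ell2)
include hT

/-- Solvability and maximal regularity of `v' + 𝒜 v + 𝒮 v = F`, `v 0 = v₀`, in coordinates: `a`
represents `𝒜 ^ ((1 + σ)/2) v`, and `F`, `v'` and the equation are read in
`V* = D(𝒜 ^ (-(1 - σ)/2))`. The operator `𝒮` is represented by `Q = 𝒮 𝒜 ^ (-1/2)`. -/
theorem exists_coord_solution :
    ∃ C : ℝ, 0 ≤ C ∧ ∀ (F : L2 T Ell2) (w : Ell2), ∃ a b : L2 T Ell2,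
      ‖a‖ ≤ C * (‖F‖ + ‖w‖) ∧ ‖b‖ ≤ C * (‖F‖ + ‖w‖) ∧
      IsWeakDeriv T ((A.negPow 1 zero_le_one).compLpL 2 (timeMeasure T) a) b ∧
      (∀ᵐ t ∂timeMeasure T, b t + a t + A.negPow _ hσ1 (Q (A.negPow _ hσ0 (a t))) = F t) ∧
      A.CoordInit a w := by
  obtain ⟨S, hS⟩ := A.exists_solution_operator hT Q
  set N := (A.negPow _ hσ1).compLpL 2 (timeMeasure T)
  set G := (A.negPow _ hσ0).compLpL 2 (timeMeasure T)
  set Q' := Q.compLpL 2 (timeMeasure T)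
  set R := A.maxReg hT
  set C := 1 + ‖N‖ * (‖S‖ * (‖Q'‖ * ‖G‖)) with hC
  refine ⟨2 * C, by positivity, fun F w => ?_⟩
  obtain ⟨a₀, ha₀, hk₀⟩ := A.exists_initial_lift hT w
  -- with `y = 𝒮 v` as unknown, `a = R (F - N y) + a₀` solves the equation with right-hand
  -- side `F - N y`; the consistency `y = Q' (G a)` is the equation that `S` solves, as
  -- `Q' ∘ G ∘ R ∘ N` is `Q' ∘ 𝒜 ^ (1/2) (∂ₜ + 𝒜)⁻¹`
  set y := S (Q' (G (R F + a₀))) with hy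
  set g := F - N y with hg
  set a := R g + a₀ with ha
  have hQG : Q' (G a) = y := by
    have h1 : G (R (N y)) = A.halfReg hT 0 le_rfl y :=
      A.negPow_maxReg_negPow hT hσ0 hσ1 (by ring) y
    have h2 : a = (R F + a₀) - R (N y) := by
      rw [ha, hg, map_sub]
      abel
    rw [h2, map_sub, map_sub, h1, sub_eq_iff_eq_add]
    exact (hS _).symm
  have hcoord : ∀ k, ∀ᵐ t ∂timeMeasure T, a t k = A.eigval k * (duhamel (A.eigval k) (coord k g) t
      + A.eigval k ^ (-(1 / 2) : ℝ) * w k * Real.exp (-A.eigval k * t)) := by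
    intro k
    have hp : A.eigval k * A.eigval k ^ (-(1 / 2) : ℝ) = A.eigval k ^ (1 / 2 : ℝ) := by
      nth_rw 1 [← Real.rpow_one (A.eigval k)]
      rw [← Real.rpow_add (A.eigval_pos' k)]
      norm_num
    have h1 : coord k a = A.eigval k • duhamelL hT (A.eigval_pos' k) (coord k g) + coord k a₀ := by
      rw [ha, map_add, A.coord_maxReg]
    filter_upwards [coeFn_coord k a, Lp.coeFn_add (A.eigval k • duhamelL hT (A.eigval_pos' k)
      (coord k g)) (coord k a₀), Lp.coeFn_smul (A.eigval k) (duhamelL hT (A.eigval_pos' k)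
      (coord k g)), coeFn_duhamelL hT (A.eigval_pos' k) (coord k g), hk₀ k] with t e1 e2 e3 e4 e5
    rw [← e1, h1, e2, Pi.add_apply, e3, Pi.smul_apply, e4, e5, smul_eq_mul, ← hp]
    ring
  have hac : ∀ k, AbsolutelyContinuousOnInterval (fun t => duhamel (A.eigval k) (coord k g) t
      + A.eigval k ^ (-(1 / 2) : ℝ) * w k * Real.exp (-A.eigval k * t)) 0 T := fun k =>
    (absolutelyContinuous_duhamel hT _ _).fun_add ((absolutelyContinuous_exp _).const_mul _)
  have hs : 0 ≤ ‖F‖ + ‖w‖ := by positivity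
  have n2 : ‖N y‖ ≤ ‖N‖ * (‖S‖ * (‖Q'‖ * (‖G‖ * (‖F‖ + ‖w‖)))) := by
    refine (N.le_opNorm _).trans ?_
    gcongr
    refine (S.le_opNorm _).trans ?_
    gcongr
    refine (Q'.le_opNorm _).trans ?_
    gcongr
    refine (G.le_opNorm _).trans ?_
    gcongr
    exact (norm_add_le _ _).trans (add_le_add (A.norm_maxReg_le hT F) ha₀)
  have n3 : ‖g‖ + ‖w‖ ≤ C * (‖F‖ + ‖w‖) := by
    have := norm_sub_le F (N y)
    rw [← hg] at this
    calc ‖g‖ + ‖w‖ ≤ ‖F‖ + ‖w‖ + ‖N‖ * (‖S‖ * (‖Q'‖ * (‖G‖ * (‖F‖ + ‖w‖)))) := by linarith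
      _ = C * (‖F‖ + ‖w‖) := by rw [hC]; ring
  have n4 : ‖a‖ ≤ C * (‖F‖ + ‖w‖) :=
    ((norm_add_le _ _).trans (add_le_add (A.norm_maxReg_le hT g) ha₀)).trans n3
  refine ⟨a, g - a, ?_, ?_, ?_, ?_, fun k => ⟨fun t => duhamel (A.eigval k) (coord k g) t
      + A.eigval k ^ (-(1 / 2) : ℝ) * w k * Real.exp (-A.eigval k * t), ?_, ?_, ?_⟩⟩
  · linarith [norm_nonneg a]
  · linarith [norm_sub_le g a, norm_nonneg w]
  · set D := (A.negPow 1 zero_le_one).compLpL 2 (timeMeasure T)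
    refine isWeakDeriv_of_coord fun k => ?_
    have hl := A.eigval_pos' k
    refine (isWeakDeriv_of_absolutelyContinuous hT (hac k) (g := fun t => coord k g t - a t k)
      ?_).congr ?_ ?_
    · filter_upwards [hasDerivAt_duhamel hT (A.eigval k) (coord k g), hcoord k] with t h1 h2
      have h3 : HasDerivAt (fun t => Real.exp (-A.eigval k * t))
          (Real.exp (-A.eigval k * t) * (-A.eigval k * 1)) t :=
        ((hasDerivAt_id t).const_mul (-A.eigval k)).exp
      convert! h1.add (h3.const_mul (A.eigval k ^ (-(1 / 2) : ℝ) * w k)) using 1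
      rw [h2]
      ring
    · filter_upwards [hcoord k, coeFn_coord k (D a), (A.negPow 1 zero_le_one).coeFn_compLpL a]
        with t h1 h2 h3
      rw [h2, h3, A.negPow_apply, h1, Real.rpow_neg_one, inv_mul_cancel_left₀ hl.ne']
    · filter_upwards [coeFn_coord k (g - a), coeFn_coord k g, Lp.coeFn_sub g a] with t h1 h2 h3
      rw [h1, h2, h3]
      rfl
  · filter_upwards [Lp.coeFn_sub g a, Lp.coeFn_sub F (N y), (A.negPow _ hσ1).coeFn_compLpL y,
      Q.coeFn_compLpL (G a), (A.negPow _ hσ0).coeFn_compLpL a] with t h1 h2 h3 h4 h5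
    have h6 : y t = Q (A.negPow _ hσ0 (a t)) := by
      rw [← h5, ← h4, ← hQG]
    rw [h1, Pi.sub_apply, hg, h2, Pi.sub_apply, h3, h6]
    abel
  · rw [← uIcc_of_le hT.le]
    exact (hac k).continuousOn
  · filter_upwards [hcoord k] with t h1
    rw [h1, Real.rpow_neg_one, inv_mul_cancel_left₀ (A.eigval_pos' k).ne']
  · simp [duhamel_zero]

/-- Causal uniqueness for the linear problem in coordinates. -/
theorem cut_eq_zero_of_coord_solution {a b : L2 T Ell2}
    (hw : IsWeakDeriv T ((A.negPow 1 zero_le_one).compLpL 2 (timeMeasure T) a) b)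
    (h0 : A.CoordInit a 0) {τ : ℝ}
    (h : ∀ᵐ t ∂timeMeasure T, t < τ →
      b t + a t + A.negPow _ hσ1 (Q (A.negPow _ hσ0 (a t))) = 0) :
    cut τ a = 0 := by
  set N := (A.negPow _ hσ1).compLpL 2 (timeMeasure T)
  set G := (A.negPow _ hσ0).compLpL 2 (timeMeasure T)
  set Q' := Q.compLpL 2 (timeMeasure T)
  set D := (A.negPow 1 zero_le_one).compLpL 2 (timeMeasure T)
  set R := A.maxReg hT
  -- in every coordinate the equation `v' + 𝒜 v = b + a` is uniquely solved by Duhamel's formula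
  have hR : a = R (b + a) := by
    refine coord_ext fun k => ?_
    have hl := A.eigval_pos' k
    obtain ⟨c, hc, hca, hc0⟩ := h0 k
    have hDa : ∀ᵐ t ∂timeMeasure T, coord k (D a) t = A.eigval k ^ (-1 : ℝ) * a t k := by
      filter_upwards [coeFn_coord k (D a), (A.negPow 1 zero_le_one).coeFn_compLpL a] with t h2 h3
      rw [h2, h3, A.negPow_apply]
    have hwk : IsWeakDeriv T (coord k (D a))
        fun t => coord k (b + a) t - A.eigval k * coord k (D a) t := by
      refine (hw.clm_comp (lp.evalCLM ℝ (fun _ : ℕ => ℝ) 2 k)).congr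
        ((coeFn_coord k (D a)).mono fun _ h => h.symm) ?_
      filter_upwards [hDa, coeFn_coord k (b + a), Lp.coeFn_add b a] with t e1 e2 e3
      rw [e1, e2, e3, Real.rpow_neg_one, mul_inv_cancel_left₀ hl.ne']
      change b t k = b t k + a t k - a t k
      ring
    have hcd := eqOn_duhamel_of_isWeakDeriv hT hc
      (by filter_upwards [hca, hDa] with t e1 e2; rw [e1, e2]) (by rw [hc0]; simp) hwk
    rw [A.coord_maxReg]
    apply Lp.ext
    filter_upwards [hca, coeFn_coord k a, coeFn_duhamelL hT hl (coord k (b + a)),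
      Lp.coeFn_smul (A.eigval k) (duhamelL hT hl (coord k (b + a))),
      ae_restrict_mem measurableSet_Ioo] with t e1 e2 e3 e4 ht
    rw [e4, Pi.smul_apply, e3, ← hcd (Ioo_subset_Icc_self ht), e1, e2, smul_eq_mul,
      Real.rpow_neg_one, mul_inv_cancel_left₀ hl.ne']
  have hcut : cut τ (b + a) = -N (cut τ (Q' (G a))) := by
    have : cut τ (b + a + N (Q' (G a))) = 0 := by
      rw [cut_eq_zero_iff]
      filter_upwards [h, Lp.coeFn_add (b + a) (N (Q' (G a))), Lp.coeFn_add b a,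
        (A.negPow _ hσ1).coeFn_compLpL (Q' (G a)), Q.coeFn_compLpL (G a),
        (A.negPow _ hσ0).coeFn_compLpL a] with t e1 e2 e3 e4 e5 e6 ht
      rw [e2, Pi.add_apply, e3, Pi.add_apply, e4, e5, e6]
      exact e1 ht
    rw [map_add, ← eq_neg_iff_add_eq_zero] at this
    rw [this, cut, mulLp_comp]
  set y := cut τ (Q' (G a)) with hy
  have ha : cut τ a = -cut τ (R (N y)) := by
    nth_rw 1 [hR]
    rw [← A.cut_maxReg hT, hcut, map_neg, map_neg]
  have hyz : y = -cut τ (Q' (A.halfReg hT 0 le_rfl y)) := by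
    have h1 : G (R (N y)) = A.halfReg hT 0 le_rfl y :=
      A.negPow_maxReg_negPow hT hσ0 hσ1 (by ring) y
    rw [← h1]
    have h2 : ∀ f : L2 T Ell2, cut τ (Q' (G f)) = Q' (G (cut τ f)) := fun f => by
      rw [cut, mulLp_comp, mulLp_comp]
    calc y = Q' (G (cut τ a)) := h2 a
      _ = -Q' (G (cut τ (R (N y)))) := by rw [ha, map_neg, map_neg]
      _ = -cut τ (Q' (G (R (N y)))) := by rw [h2]
  rw [ha, A.eq_zero_of_eq_neg_cut hT Q τ hyz]
  simp

end SpectralOperator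

/-! ### The spaces `U`, `V*`, `W` in coordinates -/

theorem dense_of_single_mem {K : Submodule ℝ Ell2} (h : ∀ k c, lp.single 2 k c ∈ K) :
    Dense (K : Set Ell2) := fun x =>
  mem_closure_of_tendsto (lp.hasSum_single (by simp) x)
    (.of_forall fun s => K.sum_mem fun k _ => h k _)

namespace SpectralOperator

variable {H : Type*} [NormedAddCommGroup H] [InnerProductSpace ℝ H] [CompleteSpace H]
  (A : SpectralOperator H)

theorem rpow_mul_rpow_neg_mul (s : ℝ) (k : ℕ) (x : ℝ) :
    A.eigval k ^ s * (A.eigval k ^ (-s) * x) = x := by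
  rw [← mul_assoc, ← Real.rpow_add (A.eigval_pos' k), add_neg_cancel, Real.rpow_zero, one_mul]

theorem toLp_surjective {s : ℝ} (hs : 0 ≤ s) :
    Function.Surjective (FracDom.toLp : A.FracDom s → Ell2) := by
  intro x
  set u : H := A.eigvec.repr.symm (A.negPow s hs x) with hu
  have hc : A.coeff s u = x := by
    funext k
    rw [coeff, ← HilbertBasis.repr_apply_apply, hu, LinearIsometryEquiv.apply_symm_apply,
      negPow_apply, rpow_mul_rpow_neg_mul]
  have hmem : u ∈ A.fracSubmodule s := by
    change Summable fun k => A.coeff s u k ^ 2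
    rw [← memℓp_coeff_iff, hc]
    exact lp.memℓp x
  refine ⟨⟨u, hmem⟩, ?_⟩
  ext k
  exact congrFun hc k

/-- `u ↦ 𝒜 ^ s u` as an isometry from `D(𝒜 ^ s)` onto `ℓ²`, for `s ≥ 0`. -/
def toLpEquiv {s : ℝ} (hs : 0 ≤ s) : A.FracDom s ≃ₗᵢ[ℝ] Ell2 :=
  LinearIsometryEquiv.ofSurjective FracDom.toLpₗᵢ (A.toLp_surjective hs)

/-- The eigenbasis diagonalizes `𝒜` on all of its domain, by symmetry. -/
theorem inner_eigvec_op (k : ℕ) (u : A.op.domain) :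
    ⟪A.eigvec k, A.op u⟫ = A.eigval k * ⟪A.eigvec k, (u : H)⟫ := by
  have hd : Dense (A.op.domain : Set H) := A.selfAdjoint.dense_domain
  have h := LinearPMap.adjoint_isFormalAdjoint hd
  have h2 : A.op.IsFormalAdjoint A.op := by
    have h3 : A.op.adjoint = A.op := A.selfAdjoint
    rwa [h3] at h
  rw [← h2 ⟨A.eigvec k, A.eigvec_mem k⟩ u, A.op_eigvec, real_inner_smul_left]

/-- `D(𝒜) ⊂ D(𝒜 ^ (1/2))`, as `∑ λ_k ⟨φ_k, u⟩ ^ 2 = ⟨𝒜 u, u⟩`. -/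
theorem mem_fracSubmodule_half (u : A.op.domain) : (u : H) ∈ A.fracSubmodule (1 / 2) := by
  change Summable fun k => A.coeff (1 / 2) u k ^ 2
  refine (A.eigvec.summable_inner_mul_inner (A.op u) (u : H)).congr fun k => ?_
  rw [real_inner_comm, A.inner_eigvec_op, coeff, mul_pow, ← Real.rpow_natCast, ← Real.rpow_mul
    (A.eigval_pos' k).le]
  norm_num
  ring

/-- The coordinates of `𝒜 ^ (1/2) u`, for `u ∈ D(𝒜)`. -/
def halfCoords : A.op.domain →ₗ[ℝ] Ell2 :=
  FracDom.toLp ∘ₗ (A.op.domain.subtype.codRestrict (A.fracSubmodule (1 / 2))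
    A.mem_fracSubmodule_half : A.op.domain →ₗ[ℝ] A.FracDom (1 / 2))

theorem halfCoords_apply (u : A.op.domain) (k : ℕ) :
    A.halfCoords u k = A.eigval k ^ (1 / 2 : ℝ) * ⟪A.eigvec k, (u : H)⟫ := rfl

theorem norm_halfCoords (u : A.op.domain) : ‖A.halfCoords u‖ = A.fracNorm (1 / 2) u :=
  FracDom.norm_eq_fracNorm (s := 1 / 2) (A := A) ⟨u, A.mem_fracSubmodule_half u⟩

theorem coeff_smul_eigvec (s c : ℝ) (k j : ℕ) :
    A.coeff s (c • A.eigvec k) j = A.eigval k ^ s * lp.single (E := fun _ : ℕ => ℝ) 2 k c j := by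
  rw [coeff, inner_smul_right, ← HilbertBasis.repr_apply_apply, HilbertBasis.repr_self,
    lp.single_apply, lp.single_apply]
  by_cases h : j = k
  · subst h
    simp
  · simp [h]

theorem denseRange_halfCoords : DenseRange A.halfCoords := by
  have h := dense_of_single_mem (K := LinearMap.range A.halfCoords) fun k c => by
    refine ⟨⟨(A.eigval k ^ (-(1 / 2) : ℝ) * c) • A.eigvec k,
      A.op.domain.smul_mem _ (A.eigvec_mem k)⟩, ?_⟩
    ext j
    change A.coeff (1 / 2) ((A.eigval k ^ (-(1 / 2) : ℝ) * c) • A.eigvec k) j = _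
    rw [coeff_smul_eigvec, lp.single_apply, lp.single_apply]
    by_cases h : j = k
    · subst h
      simp only [Pi.single_eq_same]
      exact A.rpow_mul_rpow_neg_mul _ _ _
    · simp [h]
  rwa [LinearMap.coe_range] at h

/-- `D(𝒜)` is dense in `D(𝒜 ^ s)`. -/
theorem dense_val_mem_domain {s : ℝ} (hs : 0 ≤ s) :
    Dense {u : A.FracDom s | FracDom.val u ∈ A.op.domain} := by
  set e := A.toLpEquiv hs
  set K : Submodule ℝ (A.FracDom s) := A.op.domain.comap FracDom.val
  have h := dense_of_single_mem (K := K.map (e : A.FracDom s →ₗ[ℝ] Ell2)) fun k c => by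
    have hm : (A.eigval k ^ (-s) * c) • A.eigvec k ∈ A.fracSubmodule s := by
      change Summable fun j => A.coeff s _ j ^ 2
      rw [← memℓp_coeff_iff]
      have : A.coeff s ((A.eigval k ^ (-s) * c) • A.eigvec k) =
          A.eigval k ^ s • ⇑(lp.single (E := fun _ : ℕ => ℝ) 2 k (A.eigval k ^ (-s) * c)) :=
        funext fun j => A.coeff_smul_eigvec s _ k j
      rw [this]
      exact (lp.memℓp _).const_smul _
    refine ⟨⟨_, hm⟩, A.op.domain.smul_mem _ (A.eigvec_mem k), ?_⟩
    ext j
    change A.coeff s ((A.eigval k ^ (-s) * c) • A.eigvec k) j = _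
    rw [coeff_smul_eigvec, lp.single_apply, lp.single_apply]
    by_cases h : j = k
    · subst h
      simp only [Pi.single_eq_same]
      exact A.rpow_mul_rpow_neg_mul _ _ _
    · simp [h]
  have h2 := h.preimage e.toHomeomorph.isOpenMap
  convert! h2 using 1
  ext u
  constructor
  · intro hu
    exact ⟨u, hu, rfl⟩
  · rintro ⟨v, hv, hvu⟩
    have : v = u := e.injective hvu
    exact this ▸ hv

end SpectralOperator

namespace SemilinearData

open SpectralOperator

variable {H : Type*} [NormedAddCommGroup H] [InnerProductSpace ℝ H] [CompleteSpace H]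
  (P : SemilinearData H)

/-- The map `ℓ² → V*` which sends the coordinates of `𝒜 ^ (-(1 - σ)/2) x` to `x`. -/
def dualMap : Ell2 →L[ℝ] P.Vdual :=
  (ContinuousLinearMap.precomp ℝ (FracDom.toLpₗᵢ (A := P.A)).toContinuousLinearMap) ∘L innerSL ℝ

theorem dualMap_apply (a : Ell2) (v : P.V) : P.dualMap a v = ⟪a, FracDom.toLp v⟫ := rfl

theorem norm_dualMap (a : Ell2) : ‖P.dualMap a‖ = ‖a‖ := by
  refine le_antisymm (ContinuousLinearMap.opNorm_le_bound _ (norm_nonneg _) fun v => ?_) ?_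
  · rw [dualMap_apply, ← FracDom.norm_toLp]
    exact norm_inner_le_norm _ _
  · obtain ⟨v, hv⟩ := P.A.toLp_surjective P.V_nonneg a
    have h := (P.dualMap a).le_opNorm v
    rw [dualMap_apply, hv, real_inner_self_eq_norm_mul_norm, ← FracDom.norm_toLp, hv,
      norm_mul, norm_norm] at h
    rcases (norm_nonneg a).eq_or_lt with h0 | h0
    · rw [← h0]
      exact norm_nonneg _
    · exact le_of_mul_le_mul_right h h0

theorem dualMap_surjective : Function.Surjective P.dualMap := by
  intro φ
  set e := P.A.toLpEquiv P.V_nonneg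
  refine ⟨(InnerProductSpace.toDual ℝ Ell2).symm
    (φ ∘L e.symm.toContinuousLinearEquiv.toContinuousLinearMap), ?_⟩
  ext v
  rw [dualMap_apply, InnerProductSpace.toDual_symm_apply]
  change φ (e.symm (e v)) = φ v
  rw [LinearIsometryEquiv.symm_apply_apply]

/-- `dualMap` as an isometry. -/
def dualEquiv : Ell2 ≃ₗᵢ[ℝ] P.Vdual :=
  LinearIsometryEquiv.ofSurjective ⟨P.dualMap.toLinearMap, P.norm_dualMap⟩ P.dualMap_surjective

theorem dualEquiv_apply (a : Ell2) : P.dualEquiv a = P.dualMap a := rfl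

theorem extA_eq (u : P.U) : P.extA u = P.dualMap (FracDom.toLp u) := rfl

theorem toVdual_eq (x : H) :
    P.toVdual x = P.dualMap (P.A.negPow _ P.V_nonneg (P.A.eigvec.repr x)) := by
  ext v
  rw [toVdual_apply, dualMap_apply, ← P.A.eigvec.repr.inner_map_map, lp.inner_eq_tsum,
    lp.inner_eq_tsum]
  refine tsum_congr fun k => ?_
  rw [negPow_apply, FracDom.toLp_apply, coeff, HilbertBasis.repr_apply_apply,
    HilbertBasis.repr_apply_apply]
  have h : P.A.eigval k ^ (-((1 - P.σ) / 2)) * P.A.eigval k ^ ((1 - P.σ) / 2) = 1 := by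
    rw [← Real.rpow_add (P.A.eigval_pos' k), neg_add_cancel, Real.rpow_zero]
  simp only [RCLike.inner_apply, conj_trivial]
  linear_combination (-(⟪P.A.eigvec k, x⟫ * ⟪P.A.eigvec k, FracDom.val v⟫)) * h

theorem UtoVdual_eq (u : P.U) :
    P.UtoVdual u = P.dualMap (P.A.negPow 1 zero_le_one (FracDom.toLp u)) := by
  change P.toVdual (FracDom.val u) = _
  rw [toVdual_eq]
  congr 1
  ext k
  rw [negPow_apply, negPow_apply, FracDom.toLp_apply, coeff, HilbertBasis.repr_apply_apply,
    ← mul_assoc, ← Real.rpow_add (P.A.eigval_pos' k)]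
  ring_nf

/-- The embedding `U ↪ W`. -/
def UtoW : P.U →L[ℝ] P.W :=
  (P.A.toLpEquiv P.W_nonneg).symm.toContinuousLinearEquiv.toContinuousLinearMap ∘L
    P.A.negPow (1 / 2) (by norm_num) ∘L (FracDom.toLpₗᵢ (A := P.A)).toContinuousLinearMap

theorem toLp_UtoW (u : P.U) :
    FracDom.toLp (P.UtoW u) = P.A.negPow (1 / 2) (by norm_num) (FracDom.toLp u) :=
  (P.A.toLpEquiv P.W_nonneg).apply_symm_apply _

theorem val_UtoW (u : P.U) : FracDom.val (P.UtoW u) = FracDom.val u := by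
  apply P.A.eigvec.repr.injective
  ext k
  have h : FracDom.toLp (P.UtoW u) k =
      P.A.eigval k ^ (-(1 / 2) : ℝ) * FracDom.toLp u k := by rw [toLp_UtoW, negPow_apply]
  rw [FracDom.toLp_apply, FracDom.toLp_apply, coeff, coeff, ← mul_assoc,
    ← Real.rpow_add (P.A.eigval_pos' k),
    show (-(1 / 2 : ℝ) + (1 + P.σ) / 2) = P.σ / 2 by ring] at h
  rw [HilbertBasis.repr_apply_apply, HilbertBasis.repr_apply_apply]
  exact mul_left_cancel₀ (Real.rpow_pos_of_pos (P.A.eigval_pos' k) _).ne' h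

theorem WtoVdual_UtoW (u : P.U) : P.WtoVdual (P.UtoW u) = P.UtoVdual u := by
  change P.toVdual (FracDom.val (P.UtoW u)) = P.toVdual (FracDom.val u)
  rw [val_UtoW]

/-- The operator `𝒮 𝒜 ^ (-1/2)`, bounded on `H`, in coordinates: the continuous extension of
`𝒜 ^ (1/2) u ↦ 𝒮 u` from the dense range of `𝒜 ^ (1/2)` on `D(𝒜)`. -/
def opQ : Ell2 →L[ℝ] Ell2 :=
  ((P.A.eigvec.repr : H →ₗ[ℝ] Ell2) ∘ₗ P.S).extendOfNorm P.A.halfCoords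

theorem opQ_halfCoords (u : P.A.op.domain) :
    P.opQ (P.A.halfCoords u) = P.A.eigvec.repr (P.S u) := by
  refine LinearMap.extendOfNorm_eq P.A.denseRange_halfCoords ?_ u
  obtain ⟨C, hC⟩ := P.S_bound
  refine ⟨C, fun x => ?_⟩
  rw [P.A.norm_halfCoords]
  refine le_trans (le_of_eq ?_) (hC x)
  exact P.A.eigvec.repr.norm_map (P.S x)

/-- The extension `U → V*` of the operator `𝒮`, factored through
`𝒜 ^ (-(1 - σ)/2) ∘ 𝒮 𝒜 ^ (-1/2) ∘ 𝒜 ^ (-σ/2)` on the coordinates of `𝒜 ^ ((1 + σ)/2) u`. -/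
def extS : P.U →L[ℝ] P.Vdual :=
  P.dualMap ∘L P.A.negPow _ P.V_nonneg ∘L P.opQ ∘L P.A.negPow _ P.W_nonneg ∘L
    (FracDom.toLpₗᵢ (A := P.A)).toContinuousLinearMap

theorem extS_eq (u : P.U) : P.extS u = P.dualMap (P.A.negPow _ P.V_nonneg
    (P.opQ (P.A.negPow _ P.W_nonneg (FracDom.toLp u)))) := rfl

theorem extS_eq_of_mem (u : P.U) (hu : FracDom.val u ∈ P.A.op.domain) :
    P.extS u = P.toVdual (P.S ⟨_, hu⟩) := by
  rw [extS_eq, toVdual_eq, ← opQ_halfCoords]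
  congr 3
  ext k
  rw [negPow_apply, FracDom.toLp_apply, coeff, halfCoords_apply, ← mul_assoc,
    ← Real.rpow_add (P.A.eigval_pos' k)]
  ring_nf

/-- The estimate for `𝔅` on `D(𝒜)`, in the norms of `U`, `W` and `V*`. -/
theorem norm_toVdual_B_le : ∃ C : ℝ, 0 ≤ C ∧ ∀ (x y : P.U) (hx : FracDom.val x ∈ P.A.op.domain)
    (hy : FracDom.val y ∈ P.A.op.domain),
    ‖P.toVdual (P.B ⟨_, hx⟩ ⟨_, hy⟩)‖ ≤ C * ‖x‖ * ‖P.UtoW y‖ := by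
  obtain ⟨C, hC⟩ := P.B_bound
  refine ⟨|C|, abs_nonneg C, fun x y hx hy => ?_⟩
  refine ContinuousLinearMap.opNorm_le_bound _ (by positivity) fun v => ?_
  have h := hC ⟨_, hx⟩ ⟨_, hy⟩ (FracDom.val v) v.2
  have h1 : P.A.fracNorm ((P.σ + 1) / 2) (FracDom.val x) = ‖x‖ := by
    rw [FracDom.norm_eq_fracNorm, add_comm]
  have h2 : P.A.fracNorm (P.σ / 2) (FracDom.val y) = ‖P.UtoW y‖ := by
    rw [FracDom.norm_eq_fracNorm, val_UtoW]
  simp only [h1, h2, ← FracDom.norm_eq_fracNorm v] at h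
  rw [toVdual_apply]
  refine h.trans ?_
  gcongr
  exact le_abs_self C

end SemilinearData

/-! ### The linear problem in `X = L²(0, T; U) ∩ H¹(0, T; V*)` -/

theorem SpectralOperator.CoordInit.combination {H : Type*} [NormedAddCommGroup H]
    [InnerProductSpace ℝ H] [CompleteSpace H] {A : SpectralOperator H} {T : ℝ}
    {a a' : L2 T Ell2} {w w' : Ell2} (h : A.CoordInit a w) (h' : A.CoordInit a' w') (r : ℝ) :
    A.CoordInit (r • a + a') (r • w + w') := by
  intro k
  obtain ⟨c, h1, h2, h3⟩ := h k
  obtain ⟨c', h1', h2', h3'⟩ := h' k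
  refine ⟨fun t => r * c t + c' t, (continuousOn_const.mul h1).add h1', ?_, ?_⟩
  · filter_upwards [h2, h2', Lp.coeFn_add (r • a) a', Lp.coeFn_smul r a] with t e1 e2 e3 e4
    rw [e1, e2, e3, Pi.add_apply, e4]
    change _ = A.eigval k ^ (-1 : ℝ) * (r * a t k + a' t k)
    ring
  · change r * c 0 + c' 0 = A.eigval k ^ (-(1 / 2) : ℝ) * (r * w k + w' k)
    rw [h3, h3']
    ring

namespace SemilinearData

open SpectralOperator

variable {H : Type*} [NormedAddCommGroup H] [InnerProductSpace ℝ H] [CompleteSpace H]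
  (P : SemilinearData H) {T : ℝ}

/-- The isometry `u ↦ 𝒜 ^ ((1 + σ)/2) u` from `U` to `ℓ²`. -/
def coordsU : P.U →L[ℝ] Ell2 := (FracDom.toLpₗᵢ (A := P.A)).toContinuousLinearMap

theorem coordsU_apply (u : P.U) : P.coordsU u = FracDom.toLp u := rfl

/-- `v ∈ L²(0, T; U) ∩ H¹(0, T; V*)` solves `v' + 𝒜 v + 𝒮 v = F`, `v 0 = w`; the initial condition
is read in the coordinates of the eigenbasis. -/
def SolvesLinear (F : L2 T P.Vdual) (w : P.W) (v : evolSpace T P.UtoVdual) : Prop :=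
  (∀ᵐ t ∂timeMeasure T, v.1.2 t + (P.extA (v.1.1 t) + P.extS (v.1.1 t)) = F t) ∧
  P.A.CoordInit (P.coordsU.compLpL 2 (timeMeasure T) v.1.1) (FracDom.toLp w)

variable {P}

theorem SolvesLinear.combination {F F' : L2 T P.Vdual} {w w' : P.W} {v v' : evolSpace T P.UtoVdual}
    (h : P.SolvesLinear F w v) (h' : P.SolvesLinear F' w' v') (r : ℝ) :
    P.SolvesLinear (r • F + F') (r • w + w') (r • v + v') := by
  refine ⟨?_, ?_⟩
  · filter_upwards [h.1, h'.1, Lp.coeFn_add (r • F) F', Lp.coeFn_smul r F,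
      Lp.coeFn_add (r • v.1.1) v'.1.1, Lp.coeFn_smul r v.1.1,
      Lp.coeFn_add (r • v.1.2) v'.1.2, Lp.coeFn_smul r v.1.2] with t e1 e2 e3 e4 e5 e6 e7 e8
    have e9 : (r • v + v').1.1 t = r • v.1.1 t + v'.1.1 t := by
      rw [← Pi.smul_apply, ← e6, ← Pi.add_apply]
      exact e5
    have e10 : (r • v + v').1.2 t = r • v.1.2 t + v'.1.2 t := by
      rw [← Pi.smul_apply, ← e8, ← Pi.add_apply]
      exact e7
    rw [e3, Pi.add_apply, e4, Pi.smul_apply, ← e1, ← e2, e9, e10, map_add, map_add, map_smul,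
      map_smul, smul_add, smul_add]
    abel
  · have e : P.coordsU.compLpL 2 (timeMeasure T) (r • v + v').1.1
        = r • P.coordsU.compLpL 2 (timeMeasure T) v.1.1
          + P.coordsU.compLpL 2 (timeMeasure T) v'.1.1 := by
      rw [← map_smul, ← map_add]
      rfl
    rw [e, map_add, map_smul]
    exact h.2.combination h'.2 r

variable (hT : 0 < T)
include hT

variable (P) in
/-- Solvability and maximal regularity of the linear problem. -/
theorem exists_solvesLinear : ∃ C : ℝ, 0 ≤ C ∧ ∀ (F : L2 T P.Vdual) (w : P.W),
    ∃ v : evolSpace T P.UtoVdual, P.SolvesLinear F w v ∧ ‖v‖ ≤ C * (‖F‖ + ‖w‖) := by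
  obtain ⟨C, hC0, hC⟩ := P.A.exists_coord_solution hT P.W_nonneg P.V_nonneg P.opQ
  refine ⟨C, hC0, fun F w => ?_⟩
  set e := P.dualEquiv
  set eU := P.A.toLpEquiv P.U_nonneg
  set F' : L2 T Ell2 := e.symm.toContinuousLinearEquiv.toContinuousLinearMap.compLpL 2
    (timeMeasure T) F
  have hF' : ∀ᵐ t ∂timeMeasure T, F' t = e.symm (F t) :=
    e.symm.toContinuousLinearEquiv.toContinuousLinearMap.coeFn_compLpL F
  have nF : ‖F'‖ ≤ ‖F‖ := by
    apply Lp.norm_le_norm_of_ae_le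
    filter_upwards [hF'] with t ht
    rw [ht, LinearIsometryEquiv.norm_map]
  obtain ⟨a, b, ha, hb, hw, heq, hi⟩ := hC F' (FracDom.toLp w)
  set v₁ : L2 T P.U := eU.symm.toContinuousLinearEquiv.toContinuousLinearMap.compLpL 2
    (timeMeasure T) a
  have hv₁ : ∀ᵐ t ∂timeMeasure T, v₁ t = eU.symm (a t) :=
    eU.symm.toContinuousLinearEquiv.toContinuousLinearMap.coeFn_compLpL a
  have hv₁' : ∀ᵐ t ∂timeMeasure T, FracDom.toLp (v₁ t) = a t := by
    filter_upwards [hv₁] with t ht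
    rw [ht]
    exact eU.apply_symm_apply (a t)
  set v₂ : L2 T P.Vdual := P.dualMap.compLpL 2 (timeMeasure T) b
  have hv₂ : ∀ᵐ t ∂timeMeasure T, v₂ t = P.dualMap (b t) := P.dualMap.coeFn_compLpL b
  have hweak : IsWeakDeriv T (fun t => P.UtoVdual (v₁ t)) v₂ := by
    refine (hw.clm_comp P.dualMap).congr ?_ (hv₂.mono fun t ht => ht.symm)
    filter_upwards [hv₁', (P.A.negPow 1 zero_le_one).coeFn_compLpL a] with t e1 e2
    rw [e2, UtoVdual_eq, e1]
  refine ⟨⟨(v₁, v₂), hweak⟩, ⟨?_, ?_⟩, ?_⟩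
  · filter_upwards [hv₁', hv₂, heq, hF'] with t e1 e2 e3 e4
    change v₂ t + (P.extA (v₁ t) + P.extS (v₁ t)) = F t
    rw [e2, extA_eq, extS_eq, e1, ← map_add, ← map_add, ← add_assoc, e3, e4, ← dualEquiv_apply,
      LinearIsometryEquiv.apply_symm_apply]
  · have : P.coordsU.compLpL 2 (timeMeasure T) v₁ = a := by
      apply Lp.ext
      filter_upwards [P.coordsU.coeFn_compLpL v₁, hv₁'] with t e1 e2
      rw [e1, coordsU_apply, e2]
    change P.A.CoordInit (P.coordsU.compLpL 2 (timeMeasure T) v₁) _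
    rw [this]
    exact hi
  · have n1 : ‖v₁‖ ≤ ‖a‖ := by
      apply Lp.norm_le_norm_of_ae_le
      filter_upwards [hv₁] with t ht
      rw [ht, LinearIsometryEquiv.norm_map]
    have n2 : ‖v₂‖ ≤ ‖b‖ := by
      apply Lp.norm_le_norm_of_ae_le
      filter_upwards [hv₂] with t ht
      rw [ht, norm_dualMap]
    have n3 : C * (‖F'‖ + ‖FracDom.toLp w‖) ≤ C * (‖F‖ + ‖w‖) := by
      rw [FracDom.norm_toLp]
      gcongr
    exact max_le ((n1.trans ha).trans n3) ((n2.trans hb).trans n3)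

/-- Causal uniqueness: a solution with zero initial value vanishes as long as the right-hand side
does. -/
theorem ae_eq_zero_of_linear {v : evolSpace T P.UtoVdual} {τ : ℝ}
    (h0 : P.A.CoordInit (P.coordsU.compLpL 2 (timeMeasure T) v.1.1) 0)
    (h : ∀ᵐ t ∂timeMeasure T, t < τ → v.1.2 t + (P.extA (v.1.1 t) + P.extS (v.1.1 t)) = 0) :
    ∀ᵐ t ∂timeMeasure T, t < τ → v.1.1 t = 0 := by
  set e := P.dualEquiv
  set a := P.coordsU.compLpL 2 (timeMeasure T) v.1.1
  have ha : ∀ᵐ t ∂timeMeasure T, a t = FracDom.toLp (v.1.1 t) := P.coordsU.coeFn_compLpL v.1.1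
  set eL := e.symm.toContinuousLinearEquiv.toContinuousLinearMap
  set b : L2 T Ell2 := eL.compLpL 2 (timeMeasure T) v.1.2
  have hb : ∀ᵐ t ∂timeMeasure T, b t = e.symm (v.1.2 t) := eL.coeFn_compLpL v.1.2
  have hw : IsWeakDeriv T (P.UtoVdual.compLpL 2 (timeMeasure T) v.1.1) v.1.2 :=
    IsWeakDeriv.congr (u := fun t => P.UtoVdual (v.1.1 t)) v.2
      ((P.UtoVdual.coeFn_compLpL v.1.1).mono fun t ht => ht.symm) (.of_forall fun _ => rfl)
  have hw' : IsWeakDeriv T ((P.A.negPow 1 zero_le_one).compLpL 2 (timeMeasure T) a) b := by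
    refine (hw.clm_comp eL).congr ?_ (hb.mono fun t ht => ht.symm)
    filter_upwards [ha, (P.A.negPow 1 zero_le_one).coeFn_compLpL a, P.UtoVdual.coeFn_compLpL v.1.1]
      with t e1 e2 e3
    rw [e2, e3, UtoVdual_eq, e1]
    exact e.symm_apply_apply _
  have hc := P.A.cut_eq_zero_of_coord_solution hT P.W_nonneg P.V_nonneg P.opQ hw' h0 (τ := τ) (by
    filter_upwards [h, ha, hb] with t e1 e2 e3 ht
    apply e.injective
    have e4 := e1 ht
    rw [extA_eq, extS_eq, ← e2] at e4
    rw [e3, map_add, map_add, LinearIsometryEquiv.apply_symm_apply, map_zero, add_assoc]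
    exact e4)
  rw [cut_eq_zero_iff] at hc
  filter_upwards [hc, ha] with t e1 e2 ht
  apply FracDom.toLp_injective
  rw [← e2, e1 ht, map_zero]

theorem SolvesLinear.eq_zero {v : evolSpace T P.UtoVdual} (h : P.SolvesLinear 0 0 v) : v = 0 := by
  have h0 := h.2
  rw [map_zero] at h0
  have heq : ∀ᵐ t ∂timeMeasure T, v.1.2 t + (P.extA (v.1.1 t) + P.extS (v.1.1 t)) = 0 := by
    filter_upwards [h.1, Lp.coeFn_zero P.Vdual 2 (timeMeasure T)] with t e1 e2
    rw [e1, e2, Pi.zero_apply]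
  have h1 := ae_eq_zero_of_linear hT (τ := T) h0 (heq.mono fun t ht _ => ht)
  have h2 : ∀ᵐ t ∂timeMeasure T, v.1.1 t = 0 := by
    filter_upwards [h1, ae_restrict_mem measurableSet_Ioo] with t e1 e2 using e1 e2.2
  refine Subtype.ext (Prod.ext (Lp.ext ?_) (Lp.ext ?_))
  · filter_upwards [h2, Lp.coeFn_zero P.U 2 (timeMeasure T)] with t e1 e2
    rw [e1]
    exact e2.symm
  · filter_upwards [h2, heq, Lp.coeFn_zero P.Vdual 2 (timeMeasure T)] with t e1 e2 e3
    rw [e1, map_zero, map_zero, add_zero, add_zero] at e2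
    rw [e2]
    exact e3.symm

theorem SolvesLinear.unique {F : L2 T P.Vdual} {w : P.W} {v v' : evolSpace T P.UtoVdual}
    (h : P.SolvesLinear F w v) (h' : P.SolvesLinear F w v') : v = v' := by
  have h2 := h.combination h' (-1)
  have e1 : (-1 : ℝ) • F + F = 0 := by module
  have e2 : (-1 : ℝ) • w + w = 0 := by module
  rw [e1, e2] at h2
  have h3 := h2.eq_zero hT
  have h4 : v' - v = 0 := by
    rw [← h3]
    module
  exact (sub_eq_zero.1 h4).symm

variable (P) in
/-- The bounded solution operator of the linear problem with zero initial value. -/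
theorem exists_linear_solution_operator :
    ∃ S : L2 T P.Vdual →L[ℝ] evolSpace T P.UtoVdual, ∀ F, P.SolvesLinear F 0 (S F) := by
  obtain ⟨C, _, hC⟩ := P.exists_solvesLinear hT
  choose s hs hn using fun F => hC F 0
  have hadd : ∀ F G, s (F + G) = s F + s G := fun F G => by
    refine (hs (F + G)).unique hT ?_
    simpa using (hs F).combination (hs G) 1
  have hsmul : ∀ (r : ℝ) F, s (r • F) = r • s F := fun r F => by
    have h0 : P.SolvesLinear (0 : L2 T P.Vdual) 0 0 := by
      have h := (hs 0).combination (hs 0) (-1)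
      have e : (-1 : ℝ) • s 0 + s 0 = 0 := by module
      rw [e] at h
      simpa using h
    refine (hs (r • F)).unique hT ?_
    simpa using (hs F).combination h0 r
  refine ⟨LinearMap.mkContinuous ⟨⟨s, hadd⟩, hsmul⟩ C fun F => ?_, hs⟩
  simpa using hn F

end SemilinearData

/-! ### The lifting framework -/

theorem norm_const_timeMeasure {T : ℝ} (hT : 0 < T) {E : Type*} [NormedAddCommGroup E] (x : E)
    {y : L2 T E} (hy : ∀ᵐ t ∂timeMeasure T, y t = x) : ‖y‖ = Real.sqrt T * ‖x‖ := by
  have h : y = Lp.const 2 (timeMeasure T) x := by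
    apply Lp.ext
    filter_upwards [hy, Lp.coeFn_const 2 (timeMeasure T) x] with t e1 e2
    rw [e1, e2]
    rfl
  rw [h, Lp.norm_const' _ _ _ (by simp) (by simp), mul_comm, Real.sqrt_eq_rpow]
  congr 1
  rw [Measure.real, Measure.restrict_apply_univ, Real.volume_Ioo]
  simp [ENNReal.toReal_ofReal hT.le]

/-- Time-independent functions lie in `L²(0, T; E) ∩ H¹(0, T; F)`. -/
theorem exists_evolSpace_const {T : ℝ} (hT : 0 < T) {E F : Type*} [NormedAddCommGroup E]
    [NormedSpace ℝ E] [NormedAddCommGroup F] [NormedSpace ℝ F] [CompleteSpace F] (j : E →L[ℝ] F)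
    (x : E) : ∃ u : evolSpace T j, (∀ᵐ t ∂timeMeasure T, u.1.1 t = x) ∧
      ‖u‖ = Real.sqrt T * ‖x‖ := by
  have hx : ∀ᵐ t ∂timeMeasure T, Lp.const 2 (timeMeasure T) x t = x :=
    Lp.coeFn_const _ _ _
  have hw : IsWeakDeriv T (fun t => j (Lp.const 2 (timeMeasure T) x t))
      (0 : L2 T F) := by
    refine IsWeakDeriv.congr (u := fun _ => j x) (v := fun _ => 0) ?_
      (hx.mono fun t ht => by rw [ht])
      ((Lp.coeFn_zero F 2 (timeMeasure T)).mono fun t ht => ht.symm)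
    intro η h1 h2 h3
    have e0 : η 0 = 0 := image_eq_zero_of_notMem_tsupport fun h => (h3 h).1.false
    have eT : η T = 0 := image_eq_zero_of_notMem_tsupport fun h => (h3 h).2.false
    have hd : Continuous (deriv η) := h1.continuous_deriv (by simp)
    have hi := intervalIntegral.integral_deriv_eq_sub (a := 0) (b := T) (f := η)
      (fun t _ => (h1.differentiable (by simp)) t) (hd.intervalIntegrable _ _)
    rw [intervalIntegral.integral_of_le hT.le, integral_Ioc_eq_integral_Ioo, e0, eT, sub_zero] at hi
    rw [integral_smul_const, hi]
    simp
  refine ⟨⟨(Lp.const 2 (timeMeasure T) x, 0), hw⟩, hx, ?_⟩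
  have h1 := norm_const_timeMeasure hT x hx
  change max ‖Lp.const 2 (timeMeasure T) x‖ ‖(0 : L2 T F)‖ = _
  rw [norm_zero, max_eq_left (norm_nonneg _)]
  exact h1

section InitialValue

variable {E F G : Type*} [NormedAddCommGroup E] [NormedSpace ℝ E] [NormedAddCommGroup F]
  [NormedSpace ℝ F] [NormedAddCommGroup G] [NormedSpace ℝ G] {T : ℝ} {j : E →L[ℝ] F}
  {k : G →L[ℝ] F} {u u' : evolSpace T j} {a a' : G}

theorem HasInitialValue.add (h : HasInitialValue j k u a) (h' : HasInitialValue j k u' a') :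
    HasInitialValue j k (u + u') (a + a') := by
  obtain ⟨c, h1, h2, rfl⟩ := h
  obtain ⟨c', h1', h2', rfl⟩ := h'
  refine ⟨c + c', h1.add h1', ?_, rfl⟩
  filter_upwards [h2, h2', Lp.coeFn_add u.1.1 u'.1.1] with t e1 e2 e3
  have e4 : (u + u').1.1 t = u.1.1 t + u'.1.1 t := e3
  rw [e4, Pi.add_apply, map_add, map_add, e1, e2]

theorem HasInitialValue.sub (h : HasInitialValue j k u a) (h' : HasInitialValue j k u' a') :
    HasInitialValue j k (u - u') (a - a') := by
  obtain ⟨c, h1, h2, rfl⟩ := h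
  obtain ⟨c', h1', h2', rfl⟩ := h'
  refine ⟨c - c', h1.sub h1', ?_, rfl⟩
  filter_upwards [h2, h2', Lp.coeFn_sub u.1.1 u'.1.1] with t e1 e2 e3
  have e4 : (u - u').1.1 t = u.1.1 t - u'.1.1 t := e3
  rw [e4, Pi.sub_apply, map_sub, map_sub, e1, e2]

theorem HasInitialValue.unique (hT : 0 < T) (hk : Function.Injective k)
    (h : HasInitialValue j k u a) (h' : HasInitialValue j k u a') : a = a' := by
  obtain ⟨c, h1, h2, rfl⟩ := h
  obtain ⟨c', h1', h2', rfl⟩ := h'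
  refine eqOn_Icc_of_ae_eq hT h1 h1' ?_ (left_mem_Icc.2 hT.le)
  filter_upwards [h2, h2'] with t e1 e2
  exact hk (e1.trans e2.symm)

end InitialValue

namespace LiftingFramework

open SpectralOperator SemilinearData

variable {H : Type*} [NormedAddCommGroup H] [InnerProductSpace ℝ H] [CompleteSpace H]
  {P : SemilinearData H} {T : ℝ}
  {Ut : Type*} [NormedAddCommGroup Ut] [NormedSpace ℝ Ut]
  {Wt : Type*} [NormedAddCommGroup Wt] [NormedSpace ℝ Wt]
  {Z : Type*} [AddCommGroup Z] [Module ℝ Z]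
  {XT : Type*} [NormedAddCommGroup XT] [NormedSpace ℝ XT]
  (L : LiftingFramework P T Ut Wt Z XT)

theorem jU_iU (x : P.U) : L.jU (L.iU x) = P.UtoVdual x := by
  rw [← L.jU_comp_iU]
  rfl

theorem jW_iW (x : P.W) : L.jW (L.iW x) = P.WtoVdual x := by
  rw [← L.jW_comp_iW]
  rfl

/-- The inclusion `X ⊂ X̃`. -/
theorem exists_inclusion : ∃ ι : evolSpace T P.UtoVdual →L[ℝ] L.Xt,
    (∀ v, ∀ᵐ t ∂timeMeasure T, (ι v).1.1 t = L.iU (v.1.1 t)) ∧ (∀ v, (ι v).1.2 = v.1.2) := by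
  have hw : ∀ v : evolSpace T P.UtoVdual,
      (L.iU.compLpL 2 (timeMeasure T) v.1.1, v.1.2) ∈ evolSpace T L.jU := fun v => by
    refine IsWeakDeriv.congr (u := fun t => P.UtoVdual (v.1.1 t)) v.2 ?_ (.of_forall fun _ => rfl)
    filter_upwards [L.iU.coeFn_compLpL v.1.1] with t e1
    rw [e1, jU_iU]
  let ι : evolSpace T P.UtoVdual →L[ℝ] L.Xt :=
    (((L.iU.compLpL 2 (timeMeasure T)).prodMap (ContinuousLinearMap.id ℝ (L2 T P.Vdual))) ∘L
      (evolSpace T P.UtoVdual).subtypeL).codRestrict (evolSpace T L.jU) hw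
  exact ⟨ι, fun v => L.iU.coeFn_compLpL v.1.1, fun v => rfl⟩

variable {L} {ι : evolSpace T P.UtoVdual →L[ℝ] L.Xt}
  (hι : ∀ v, ∀ᵐ t ∂timeMeasure T, (ι v).1.1 t = L.iU (v.1.1 t)) (hι' : ∀ v, (ι v).1.2 = v.1.2)

include hι in
theorem trace_inclusion (v : evolSpace T P.UtoVdual) : L.trace (ι v) = 0 := by
  rw [L.trace_eq_zero_iff]
  exact ⟨v, (hι v).mono fun t ht => ht.symm⟩

include hι hι' in
/-- The elements of `X̃` with trace zero lie in `X`: both weak derivatives are formed in `V*`. -/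
theorem exists_inclusion_eq {u : L.Xt} (hu : L.trace u = 0) :
    ∃ v : evolSpace T P.UtoVdual, ι v = u := by
  obtain ⟨v, hv⟩ := (L.trace_eq_zero_iff u).1 hu
  have hw : (v.1.1, u.1.2) ∈ evolSpace T P.UtoVdual := by
    refine IsWeakDeriv.congr (u := fun t => L.jU (u.1.1 t)) u.2 ?_ (.of_forall fun _ => rfl)
    filter_upwards [hv] with t ht
    rw [← ht, jU_iU]
  refine ⟨⟨_, hw⟩, Subtype.ext (Prod.ext (Lp.ext ?_) ?_)⟩
  · filter_upwards [hι ⟨_, hw⟩, hv] with t e1 e2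
    rw [e1]
    exact e2
  · exact hι' _

variable (L)

/-- The operator `𝒮̃ : X̃ → L²(0, T; V*)`. -/
theorem exists_St_clm : ∃ S : L.Xt →L[ℝ] L2 T P.Vdual,
    ∀ u, ∀ᵐ t ∂timeMeasure T, S u t = L.St (u.1.1 t) := by
  obtain ⟨C, hC⟩ := L.St_bounded
  choose y hy hn using hC
  refine ⟨LinearMap.mkContinuous ⟨⟨y, fun u v => ?_⟩, fun r u => ?_⟩ C hn, hy⟩
  · apply Lp.ext
    filter_upwards [hy (u + v), hy u, hy v, Lp.coeFn_add (y u) (y v), Lp.coeFn_add u.1.1 v.1.1]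
      with t e1 e2 e3 e4 e5
    have e6 : (u + v).1.1 t = u.1.1 t + v.1.1 t := e5
    rw [e1, e4, Pi.add_apply, e2, e3, e6, map_add]
  · apply Lp.ext
    filter_upwards [hy (r • u), hy u, Lp.coeFn_smul r (y u), Lp.coeFn_smul r u.1.1]
      with t e1 e2 e4 e5
    have e6 : (r • u).1.1 t = r • u.1.1 t := e5
    change y (r • u) t = (r • y u : Lp P.Vdual 2 (timeMeasure T)) t
    rw [e1, e4, Pi.smul_apply, e2, e6, map_smul]

/-- The bilinear map `𝔅̃ : X̃ × X̃ → L²(0, T; V*)`. -/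
theorem exists_Bt_clm : ∃ B : L.Xt →L[ℝ] L.Xt →L[ℝ] L2 T P.Vdual,
    ∀ u w, ∀ᵐ t ∂timeMeasure T, B u w t = L.Bt (u.1.1 t) (w.1.1 t) := by
  obtain ⟨C, hC⟩ := L.Bt_bounded
  choose y hy hn using hC
  refine ⟨LinearMap.mkContinuous₂ (LinearMap.mk₂ ℝ y ?_ ?_ ?_ ?_) C hn, hy⟩
  · intro u v w
    apply Lp.ext
    filter_upwards [hy (u + v) w, hy u w, hy v w, Lp.coeFn_add (y u w) (y v w),
      Lp.coeFn_add u.1.1 v.1.1] with t e1 e2 e3 e4 e5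
    have e6 : (u + v).1.1 t = u.1.1 t + v.1.1 t := e5
    rw [e1, e4, Pi.add_apply, e2, e3, e6, map_add, LinearMap.add_apply]
  · intro r u w
    apply Lp.ext
    filter_upwards [hy (r • u) w, hy u w, Lp.coeFn_smul r (y u w), Lp.coeFn_smul r u.1.1]
      with t e1 e2 e4 e5
    have e6 : (r • u).1.1 t = r • u.1.1 t := e5
    rw [e1, e4, Pi.smul_apply, e2, e6, map_smul, LinearMap.smul_apply]
  · intro w u v
    apply Lp.ext
    filter_upwards [hy w (u + v), hy w u, hy w v, Lp.coeFn_add (y w u) (y w v),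
      Lp.coeFn_add u.1.1 v.1.1] with t e1 e2 e3 e4 e5
    have e6 : (u + v).1.1 t = u.1.1 t + v.1.1 t := e5
    rw [e1, e4, Pi.add_apply, e2, e3, e6, map_add]
  · intro r w u
    apply Lp.ext
    filter_upwards [hy w (r • u), hy w u, Lp.coeFn_smul r (y w u), Lp.coeFn_smul r u.1.1]
      with t e1 e2 e4 e5
    have e6 : (r • u).1.1 t = r • u.1.1 t := e5
    rw [e1, e4, Pi.smul_apply, e2, e6, map_smul]

section Pointwise

variable (hT : 0 < T)
include hT

/-- Applied to time-independent functions, boundedness of `𝒮̃ : X̃ → L²(0, T; V*)` gives boundedness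
of `𝒮̃ : Ut → V*`. -/
theorem norm_St_le : ∃ C : ℝ, ∀ x : Ut, ‖L.St x‖ ≤ C * ‖x‖ := by
  obtain ⟨C, hC⟩ := L.St_bounded
  refine ⟨C, fun x => ?_⟩
  obtain ⟨u, hu, hn⟩ := exists_evolSpace_const hT L.jU x
  obtain ⟨y, hy, hyn⟩ := hC u
  have h := norm_const_timeMeasure hT (L.St x) (y := y) (by
    filter_upwards [hu, hy] with t e1 e2
    rw [e2, e1])
  rw [h, hn] at hyn
  have hs : 0 < Real.sqrt T := Real.sqrt_pos.2 hT
  refine le_of_mul_le_mul_left (hyn.trans (le_of_eq ?_)) hs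
  ring

/-- Applied to time-independent functions, boundedness of `𝔅̃ : X̃ × X̃ → L²(0, T; V*)` gives
boundedness of `𝔅̃ : Ut × Ut → V*`. -/
theorem norm_Bt_le : ∃ C : ℝ, ∀ x y : Ut, ‖L.Bt x y‖ ≤ C * ‖x‖ * ‖y‖ := by
  obtain ⟨C, hC⟩ := L.Bt_bounded
  refine ⟨C * Real.sqrt T, fun x x' => ?_⟩
  obtain ⟨u, hu, hn⟩ := exists_evolSpace_const hT L.jU x
  obtain ⟨u', hu', hn'⟩ := exists_evolSpace_const hT L.jU x'
  obtain ⟨y, hy, hyn⟩ := hC u u'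
  have h := norm_const_timeMeasure hT (L.Bt x x') (y := y) (by
    filter_upwards [hu, hu', hy] with t e1 e2 e3
    rw [e3, e1, e2])
  rw [h, hn, hn'] at hyn
  have hs : 0 < Real.sqrt T := Real.sqrt_pos.2 hT
  refine le_of_mul_le_mul_left (hyn.trans (le_of_eq ?_)) hs
  ring

/-- On `U`, the operator `𝒮̃` is determined by its values on `D(𝒜)`, by density. -/
theorem St_iU_eq (x : P.U) : L.St (L.iU x) = P.extS x := by
  obtain ⟨C, hC⟩ := L.norm_St_le hT
  have hc : Continuous (L.St.mkContinuous C hC ∘L L.iU) := ContinuousLinearMap.continuous _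
  have h := Continuous.ext_on (P.A.dense_val_mem_domain P.U_nonneg) hc P.extS.continuous
    fun y hy => (L.St_iU y hy).trans (P.extS_eq_of_mem y hy).symm
  exact congrFun h x

/-- The estimate for `𝔅` extends from `D(𝒜) × D(𝒜)` to `U × U` by density; it is stronger than the
boundedness of `𝔅̃`, as the second argument enters through its norm in `W`. -/
theorem norm_Bt_iU_le : ∃ C : ℝ, 0 ≤ C ∧ ∀ x y : P.U,
    ‖L.Bt (L.iU x) (L.iU y)‖ ≤ C * ‖x‖ * ‖P.UtoW y‖ := by
  obtain ⟨C, hC⟩ := L.norm_Bt_le hT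
  obtain ⟨C', hC0, hC'⟩ := P.norm_toVdual_B_le
  refine ⟨C', hC0, ?_⟩
  obtain ⟨B, hB⟩ : ∃ B : Ut →L[ℝ] Ut →L[ℝ] P.Vdual, ∀ x y, B x y = L.Bt x y :=
    ⟨L.Bt.mkContinuous₂ C hC, fun _ _ => rfl⟩
  have hcont : Continuous fun p : P.U × P.U => ‖B (L.iU p.1) (L.iU p.2)‖ := by fun_prop
  have hcont2 : Continuous fun p : P.U × P.U => C' * ‖p.1‖ * ‖P.UtoW p.2‖ := by fun_prop
  have hd := (P.A.dense_val_mem_domain P.U_nonneg).prod (P.A.dense_val_mem_domain P.U_nonneg)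
  have hall : ∀ p : P.U × P.U, ‖B (L.iU p.1) (L.iU p.2)‖ ≤ C' * ‖p.1‖ * ‖P.UtoW p.2‖ := by
    intro p
    have hp := hd p
    refine closure_minimal ?_ (isClosed_le hcont hcont2) hp
    rintro ⟨x, y⟩ ⟨hx, hy⟩
    have h := hC' x y hx hy
    rw [← L.Bt_iU x y hx hy, ← hB] at h
    exact h
  intro x y
  rw [← hB]
  exact hall (x, y)

end Pointwise

section Initial

variable {L} (hT : 0 < T)
include hT hι

/-- The embedding `X ↪ C([0, T]; W)`: since `W` is closed in `Wt`, it follows from the embedding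
`X̃ ↪ C([0, T]; Wt)`. -/
theorem exists_continuous_representative (v : evolSpace T P.UtoVdual) :
    ∃ d : ℝ → P.W, ContinuousOn d (Icc 0 T) ∧ (∀ᵐ t ∂timeMeasure T, d t = P.UtoW (v.1.1 t)) ∧
      HasInitialValue L.jU L.jW (ι v) (L.iW (d 0)) := by
  obtain ⟨C, hC⟩ := L.embed
  obtain ⟨c, hc, hcu, -⟩ := hC (ι v)
  have hca : ∀ᵐ t ∂timeMeasure T, c t = L.iW (P.UtoW (v.1.1 t)) := by
    filter_upwards [hcu, hι v] with t e1 e2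
    apply L.jW_injective
    rw [e1, e2, jU_iU, jW_iW, WtoVdual_UtoW]
  have hcl := L.iW_closed.isClosed_range
  have hne : (range L.iW).Nonempty := range_nonempty _
  -- the representative stays in the closed subspace `W` at every time, not only almost everywhere
  have hdist : EqOn (fun t => Metric.infDist (c t) (range L.iW)) (fun _ => 0) (Icc 0 T) := by
    refine eqOn_Icc_of_ae_eq hT ((Metric.continuous_infDist_pt _).comp_continuousOn hc)
      continuousOn_const ?_
    filter_upwards [hca] with t e1
    rw [e1]
    exact Metric.infDist_zero_of_mem (mem_range_self _)
  have hmem : ∀ t ∈ Icc 0 T, ∃ d, L.iW d = c t := fun t ht =>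
    (hcl.mem_iff_infDist_zero hne).2 (hdist ht)
  choose! d hd using hmem
  refine ⟨d, ?_, ?_, c, hc, hcu, (hd 0 (left_mem_Icc.2 hT.le)).symm⟩
  · rw [L.iW_closed.isInducing.continuousOn_iff]
    exact hc.congr fun t ht => hd t ht
  · filter_upwards [hca, ae_restrict_mem measurableSet_Ioo] with t e1 e2
    apply L.iW_closed.injective
    rw [hd t (Ioo_subset_Icc_self e2), e1]

/-- For elements of `X`, initial values can be read in the coordinates of the eigenbasis. -/
theorem hasInitialValue_inclusion_iff (v : evolSpace T P.UtoVdual) (w : P.W) :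
    HasInitialValue L.jU L.jW (ι v) (L.iW w) ↔
      P.A.CoordInit (P.coordsU.compLpL 2 (timeMeasure T) v.1.1) (FracDom.toLp w) := by
  obtain ⟨d, hd, hdv, h1⟩ := exists_continuous_representative hι hT v
  have h2 : P.A.CoordInit (P.coordsU.compLpL 2 (timeMeasure T) v.1.1) (FracDom.toLp (d 0)) := by
    intro k
    refine ⟨fun t => P.A.eigval k ^ (-(1 / 2) : ℝ) * FracDom.toLp (d t) k, ?_, ?_, rfl⟩
    · refine continuousOn_const.mul ?_
      exact ((lp.evalCLM ℝ (fun _ : ℕ => ℝ) 2 k).continuous.comp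
        (FracDom.toLpₗᵢ (A := P.A)).continuous).comp_continuousOn hd
    · filter_upwards [hdv, P.coordsU.coeFn_compLpL v.1.1] with t e1 e2
      rw [e1, e2, toLp_UtoW, negPow_apply, coordsU_apply, ← mul_assoc,
        ← Real.rpow_add (P.A.eigval_pos' k)]
      norm_num
  constructor
  · intro h
    have : L.iW w = L.iW (d 0) := h.unique hT L.jW_injective h1
    rw [L.iW_closed.injective this]
    exact h2
  · intro h
    have : w = d 0 := by
      apply FracDom.toLp_injective
      ext k
      obtain ⟨c, c1, c2, c3⟩ := h k
      obtain ⟨c', c1', c2', c3'⟩ := h2 k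
      have hcc := eqOn_Icc_of_ae_eq hT c1 c1'
        (by filter_upwards [c2, c2'] with t e1 e2; rw [e1, e2]) (left_mem_Icc.2 hT.le)
      rw [c3, c3'] at hcc
      exact mul_left_cancel₀ (Real.rpow_pos_of_pos (P.A.eigval_pos' k) _).ne' hcc
    rw [this]
    exact h1

end Initial

end LiftingFramework

/-! ### The semilinear problem -/

/-- A quadratic perturbation of a bounded linear problem with small data has a small solution. -/
theorem exists_quadratic_fixedPoint {X Y : Type*} [NormedAddCommGroup X] [NormedSpace ℝ X]
    [NormedAddCommGroup Y] [NormedSpace ℝ Y] [CompleteSpace Y] (S : Y →L[ℝ] X)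
    (B : X →L[ℝ] X →L[ℝ] Y) {ρ : ℝ} (hρ : 0 < ρ) :
    ∃ ε : ℝ, 0 < ε ∧ ∀ (f : Y) (e : X), ‖f‖ ≤ ε → ‖e‖ ≤ ε →
      ∃ F : Y, F = f - B (e + S F) (e + S F) ∧ ‖e + S F‖ ≤ ρ := by
  set s := 1 + ‖S‖ with hs
  have hs0 : 0 < s := by positivity
  set δ := min (ρ / s) (1 / (4 * (‖B‖ + 1) * s ^ 2)) with hδ
  have hδ0 : 0 < δ := lt_min (by positivity) (by positivity)
  have h1 : s * δ ≤ ρ := by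
    have : δ ≤ ρ / s := min_le_left _ _
    rwa [le_div_iff₀ hs0, mul_comm] at this
  have h2 : ‖B‖ * s ^ 2 * δ ≤ 1 / 4 := by
    have h : δ ≤ 1 / (4 * (‖B‖ + 1) * s ^ 2) := min_le_right _ _
    rw [le_div_iff₀ (by positivity)] at h
    have : 0 ≤ δ * s ^ 2 := by positivity
    nlinarith
  refine ⟨δ / 2, by positivity, fun f e hf he => ?_⟩
  have hball : ∀ F : Y, ‖F‖ ≤ δ → ‖e + S F‖ ≤ s * δ := fun F hF => by
    have h3 : ‖S F‖ ≤ ‖S‖ * δ := (S.le_opNorm F).trans (by gcongr)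
    have h4 := norm_add_le e (S F)
    rw [hs]
    linarith
  set Ψ : Y → Y := fun F => f - B (e + S F) (e + S F) with hΨ
  have hmaps : MapsTo Ψ (Metric.closedBall 0 δ) (Metric.closedBall 0 δ) := by
    intro F hF
    rw [mem_closedBall_zero_iff] at hF ⊢
    have h3 : ‖B (e + S F) (e + S F)‖ ≤ ‖B‖ * (s * δ) * (s * δ) :=
      (B.le_opNorm₂ _ _).trans (by gcongr <;> exact hball F hF)
    have h4 : ‖B‖ * (s * δ) * (s * δ) ≤ 1 / 4 * δ := by
      calc ‖B‖ * (s * δ) * (s * δ) = ‖B‖ * s ^ 2 * δ * δ := by ring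
        _ ≤ 1 / 4 * δ := by gcongr
    have h5 := norm_sub_le f (B (e + S F) (e + S F))
    linarith
  have hcontr : ContractingWith (1 / 2) (hmaps.restrict Ψ _ _) := by
    refine ⟨by norm_num, LipschitzWith.of_dist_le_mul ?_⟩
    rintro ⟨F, hF⟩ ⟨G, hG⟩
    rw [mem_closedBall_zero_iff] at hF hG
    change dist (Ψ F) (Ψ G) ≤ _ * dist F G
    rw [dist_eq_norm, dist_eq_norm]
    have e1 : Ψ F - Ψ G = -(B (e + S F) (S (F - G)) + B (S (F - G)) (e + S G)) := by
      simp only [hΨ, map_sub, map_add, sub_apply, add_apply]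
      abel
    have e2 : ‖S (F - G)‖ ≤ s * ‖F - G‖ := (S.le_opNorm _).trans (by gcongr; linarith)
    rw [e1, norm_neg]
    calc _ ≤ ‖B (e + S F) (S (F - G))‖ + ‖B (S (F - G)) (e + S G)‖ := norm_add_le _ _
      _ ≤ ‖B‖ * (s * δ) * (s * ‖F - G‖) + ‖B‖ * (s * ‖F - G‖) * (s * δ) := by
          refine add_le_add ((B.le_opNorm₂ _ _).trans ?_) ((B.le_opNorm₂ _ _).trans ?_)
          · gcongr
            exact hball F hF
          · gcongr
            exact hball G hG
      _ = 2 * (‖B‖ * s ^ 2 * δ) * ‖F - G‖ := by ring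
      _ ≤ 2 * (1 / 4) * ‖F - G‖ := by gcongr
      _ = ((1 / 2 : NNReal) : ℝ) * ‖F - G‖ := by push_cast; ring
  obtain ⟨F, hF, hfix, -⟩ := hcontr.exists_fixedPoint' (x := 0)
    Metric.isClosed_closedBall.isComplete hmaps (Metric.mem_closedBall_self hδ0.le)
    (edist_ne_top _ _)
  rw [mem_closedBall_zero_iff] at hF
  exact ⟨F, hfix.symm, (hball F hF).trans h1⟩

/-- The operator norm bound, with the norm of `B` hidden in a constant. -/
theorem exists_norm_apply_apply_le {X Y : Type*} [NormedAddCommGroup X] [NormedSpace ℝ X]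
    [NormedAddCommGroup Y] [NormedSpace ℝ Y] (B : X →L[ℝ] X →L[ℝ] Y) :
    ∃ b : ℝ, 0 ≤ b ∧ ∀ u w, ‖B u w‖ ≤ b * ‖u‖ * ‖w‖ :=
  ⟨‖B‖, norm_nonneg B, B.le_opNorm₂⟩

/-- A linear embedding of normed spaces is bounded below. -/
theorem exists_norm_le_of_isEmbedding {E F : Type*} [NormedAddCommGroup E] [NormedSpace ℝ E]
    [NormedAddCommGroup F] [NormedSpace ℝ F] {i : E →L[ℝ] F} (hi : Topology.IsEmbedding i) :
    ∃ K : ℝ, 0 ≤ K ∧ ∀ x, ‖x‖ ≤ K * ‖i x‖ := by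
  have h : Metric.ball (0 : E) 1 ∈ nhds (0 : E) := Metric.ball_mem_nhds _ one_pos
  rw [hi.nhds_eq_comap, map_zero, Filter.mem_comap] at h
  obtain ⟨s, hs, hsub⟩ := h
  obtain ⟨δ, hδ, hball⟩ := Metric.mem_nhds_iff.1 hs
  refine ⟨2 / δ, by positivity, fun x => ?_⟩
  by_cases hx : x = 0
  · simp [hx]
  have hix : 0 < ‖i x‖ := norm_pos_iff.2 fun h0 => hx (hi.injective (by rw [h0, map_zero]))
  set r := δ / (2 * ‖i x‖) with hr
  have hr0 : 0 < r := by positivity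
  have h1 : i (r • x) ∈ Metric.ball (0 : F) δ := by
    rw [mem_ball_zero_iff, map_smul, norm_smul, Real.norm_of_nonneg hr0.le]
    have : r * ‖i x‖ = δ / 2 := by rw [hr]; field_simp
    linarith
  have h2 : r • x ∈ Metric.ball (0 : E) 1 := hsub (hball h1)
  rw [mem_ball_zero_iff, norm_smul, Real.norm_of_nonneg hr0.le] at h2
  have h3 : 2 / δ * ‖i x‖ = 1 / r := by rw [hr]; field_simp
  rw [h3, le_div_iff₀ hr0]
  linarith

theorem ae_eq_sub_sub_sub {E : Type*} [NormedAddCommGroup E] {F f y₁ y₂ y₃ : L2 T E}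
    (h : F = f - y₁ - y₂ - y₃) : ∀ᵐ t ∂timeMeasure T, F t = f t - y₁ t - y₂ t - y₃ t := by
  rw [h]
  filter_upwards [Lp.coeFn_sub (f - y₁ - y₂) y₃, Lp.coeFn_sub (f - y₁) y₂, Lp.coeFn_sub f y₁]
    with t e1 e2 e3
  rw [e1, Pi.sub_apply, e2, Pi.sub_apply, e3, Pi.sub_apply]

theorem cut_eq_neg_of_ae {E : Type*} [NormedAddCommGroup E] [NormedSpace ℝ E] {T τ : ℝ}
    {F y₁ y₂ y₃ : L2 T E}
    (h : ∀ᵐ t ∂timeMeasure T, t < τ → F t = -(y₁ t + y₂ t + y₃ t)) :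
    cut τ F = -(cut τ y₁ + cut τ y₂ + cut τ y₃) := by
  rw [eq_neg_iff_add_eq_zero, ← map_add, ← map_add, ← map_add, cut_eq_zero_iff]
  filter_upwards [h, Lp.coeFn_add F (y₁ + y₂ + y₃), Lp.coeFn_add (y₁ + y₂) y₃, Lp.coeFn_add y₁ y₂]
    with t e1 e2 e3 e4 ht
  rw [e2, Pi.add_apply, e3, Pi.add_apply, e4, Pi.add_apply, e1 ht, neg_add_cancel]

namespace LiftingFramework

open SpectralOperator SemilinearData

variable {H : Type*} [NormedAddCommGroup H] [InnerProductSpace ℝ H] [CompleteSpace H]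
  {P : SemilinearData H} {T : ℝ}
  {Ut : Type*} [NormedAddCommGroup Ut] [NormedSpace ℝ Ut]
  {Wt : Type*} [NormedAddCommGroup Wt] [NormedSpace ℝ Wt]
  {Z : Type*} [AddCommGroup Z] [Module ℝ Z]
  {XT : Type*} [NormedAddCommGroup XT] [NormedSpace ℝ XT]
  {L : LiftingFramework P T Ut Wt Z XT} {ι : evolSpace T P.UtoVdual →L[ℝ] L.Xt}

/-- The bilinear term, cut off at the time `τ`, is small if the second factor is small in `W` before
`τ`: on `U × U`, the map `𝔅̃` needs only the norm of `W` of its second argument. -/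
theorem norm_cut_bilinear_le (hι : ∀ v, ∀ᵐ t ∂timeMeasure T, (ι v).1.1 t = L.iU (v.1.1 t))
    {B : L.Xt →L[ℝ] L.Xt →L[ℝ] L2 T P.Vdual}
    (hB : ∀ u w, ∀ᵐ t ∂timeMeasure T, B u w t = L.Bt (u.1.1 t) (w.1.1 t)) {C : ℝ} (hC0 : 0 ≤ C)
    (hC : ∀ x y : P.U, ‖L.Bt (L.iU x) (L.iU y)‖ ≤ C * ‖x‖ * ‖P.UtoW y‖)
    {v v' : evolSpace T P.UtoVdual} {τ κ : ℝ} (hκ : 0 ≤ κ)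
    (hv : ∀ᵐ t ∂timeMeasure T, t < τ → ‖P.UtoW (v.1.1 t)‖ ≤ κ) :
    ‖cut τ (B (ι v') (ι v))‖ ≤ C * κ * ‖v'‖ := by
  have h : ‖cut τ (B (ι v') (ι v))‖ ≤ C * κ * ‖v'.1.1‖ := by
    refine Lp.norm_le_mul_norm_of_ae_le_mul ?_
    filter_upwards [coeFn_cut τ (B (ι v') (ι v)), hB (ι v') (ι v), hι v, hι v', hv]
      with t e1 e2 e3 e4 e5
    rw [e1, e2, e3, e4]
    by_cases ht : t < τ
    · rw [indicator_of_mem (mem_Iio.2 ht), one_smul]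
      calc _ ≤ C * ‖v'.1.1 t‖ * ‖P.UtoW (v.1.1 t)‖ := hC _ _
        _ ≤ C * ‖v'.1.1 t‖ * κ := by gcongr; exact e5 ht
        _ = _ := by ring
    · rw [indicator_of_notMem (fun h => ht (mem_Iio.1 h)), zero_smul, norm_zero]
      positivity
  exact h.trans (mul_le_mul_of_nonneg_left (le_max_left _ _) (by positivity))

/-- If `v` solves the equation for the difference of two solutions and is small in `W` before the
time `τ`, then it vanishes before `τ`: up to `τ` it agrees with the solution `v'` for the right-hand
side cut off at `τ`, which depends on `v'` through a contraction. -/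
theorem ae_eq_zero_of_small (hT : 0 < T)
    (hι : ∀ v, ∀ᵐ t ∂timeMeasure T, (ι v).1.1 t = L.iU (v.1.1 t))
    {S : L2 T P.Vdual →L[ℝ] evolSpace T P.UtoVdual} (hS : ∀ F, P.SolvesLinear F 0 (S F))
    {B : L.Xt →L[ℝ] L.Xt →L[ℝ] L2 T P.Vdual}
    (hB : ∀ u w, ∀ᵐ t ∂timeMeasure T, B u w t = L.Bt (u.1.1 t) (w.1.1 t)) {b : ℝ} (hb0 : 0 ≤ b)
    (hb : ∀ u w, ‖B u w‖ ≤ b * ‖u‖ * ‖w‖) {C : ℝ} (hC0 : 0 ≤ C)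
    (hC : ∀ x y : P.U, ‖L.Bt (L.iU x) (L.iU y)‖ ≤ C * ‖x‖ * ‖P.UtoW y‖) {u : L.Xt} {κ : ℝ}
    (hκ0 : 0 ≤ κ) (hsmall1 : ‖S‖ * (2 * b * ‖u‖ * ‖ι‖) ≤ 1 / 4) (hsmall2 : ‖S‖ * (C * κ) ≤ 1 / 4)
    {v : evolSpace T P.UtoVdual} {F : L2 T P.Vdual} (hv : P.SolvesLinear F 0 v)
    (hF : ∀ᵐ t ∂timeMeasure T, F t = -(L.Bt (u.1.1 t) (L.iU (v.1.1 t)) +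
      L.Bt (L.iU (v.1.1 t)) (u.1.1 t) + L.Bt (L.iU (v.1.1 t)) (L.iU (v.1.1 t)))) {τ : ℝ}
    (hsm : ∀ᵐ t ∂timeMeasure T, t < τ → ‖P.UtoW (v.1.1 t)‖ ≤ κ) :
    ∀ᵐ t ∂timeMeasure T, t < τ → v.1.1 t = 0 := by
  -- `v` need not be small after `τ`, hence the comparison with the solution `v'` for `cut τ F`
  obtain ⟨v', hv'⟩ : ∃ v', v' = S (cut τ F) := ⟨_, rfl⟩
  have hSv : P.SolvesLinear (cut τ F) 0 v' := hv' ▸ hS _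
  obtain ⟨z, hz⟩ : ∃ z, z = (-1 : ℝ) • v' + v := ⟨_, rfl⟩
  have hdiff := hSv.combination hv (-1)
  rw [← hz] at hdiff
  have hag : ∀ᵐ t ∂timeMeasure T, t < τ → v'.1.1 t = v.1.1 t := by
    have hz0 := hdiff.2
    rw [smul_zero, add_zero, map_zero] at hz0
    have h := ae_eq_zero_of_linear hT (τ := τ) hz0 (by
      filter_upwards [hdiff.1, coeFn_cut_of_lt τ F, Lp.coeFn_add ((-1 : ℝ) • cut τ F) F,
        Lp.coeFn_smul (-1 : ℝ) (cut τ F)] with t e1 e2 e3 e4 ht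
      rw [e1, e3, Pi.add_apply, e4, Pi.smul_apply, e2 ht]
      module)
    filter_upwards [h, Lp.coeFn_add ((-1 : ℝ) • v'.1.1) v.1.1,
      Lp.coeFn_smul (-1 : ℝ) v'.1.1] with t e1 e2 e3 ht
    have e4 : z.1.1 t = (-1 : ℝ) • v'.1.1 t + v.1.1 t := by
      rw [← Pi.smul_apply, ← e3, ← Pi.add_apply, hz]
      exact e2
    rw [e1 ht] at e4
    have e6 : v.1.1 t - v'.1.1 t = 0 := by
      rw [e4]
      module
    exact (sub_eq_zero.1 e6).symm
  -- before `τ`, one factor `v` of each term may be replaced by `v'`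
  have hcutF : cut τ F = -(cut τ (B u (ι v')) + cut τ (B (ι v') u) + cut τ (B (ι v') (ι v))) := by
    refine cut_eq_neg_of_ae ?_
    filter_upwards [hag, hι v, hι v', hB u (ι v'), hB (ι v') u, hB (ι v') (ι v), hF]
      with t a1 a2 a3 b1 b2 b3 c ht
    have a4 := a1 ht
    rw [b1, b2, b3, c, a2, a3, a4]
  have hn : ‖v'‖ ≤ 1 / 2 * ‖v'‖ := by
    have hιv : ‖ι v'‖ ≤ ‖ι‖ * ‖v'‖ := ι.le_opNorm v'
    have n1 : ‖cut τ (B u (ι v'))‖ ≤ b * ‖u‖ * (‖ι‖ * ‖v'‖) :=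
      (norm_cut_le _ _).trans ((hb _ _).trans (by gcongr))
    have n2 : ‖cut τ (B (ι v') u)‖ ≤ b * (‖ι‖ * ‖v'‖) * ‖u‖ :=
      (norm_cut_le _ _).trans ((hb _ _).trans (by gcongr))
    have n3 : ‖cut τ (B (ι v') (ι v))‖ ≤ C * κ * ‖v'‖ :=
      norm_cut_bilinear_le hι hB hC0 hC hκ0 hsm
    have n4 : ‖cut τ F‖ ≤ (2 * b * ‖u‖ * ‖ι‖ + C * κ) * ‖v'‖ := by
      rw [hcutF, norm_neg]
      refine (norm_add₃_le).trans ?_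
      linarith
    calc ‖v'‖ = ‖S (cut τ F)‖ := by rw [hv']
      _ ≤ ‖S‖ * ‖cut τ F‖ := S.le_opNorm _
      _ ≤ ‖S‖ * ((2 * b * ‖u‖ * ‖ι‖ + C * κ) * ‖v'‖) := by gcongr
      _ = (‖S‖ * (2 * b * ‖u‖ * ‖ι‖) + ‖S‖ * (C * κ)) * ‖v'‖ := by ring
      _ ≤ (1 / 4 + 1 / 4) * ‖v'‖ := by gcongr
      _ = 1 / 2 * ‖v'‖ := by ring
  have hv0 : v' = 0 := by
    rw [← norm_le_zero_iff]
    linarith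
  filter_upwards [hag, Lp.coeFn_zero P.U 2 (timeMeasure T)] with t e1 e2 ht
  rw [← e1 ht, hv0]
  exact e2

/-- Two solutions with the same data, one of which is small, agree: the difference `v` solves the
equation below. By continuity in `W`, the set of times up to which `v` vanishes is open in
`[0, T]`. -/
theorem exists_difference_eq_zero (hT : 0 < T)
    (hι : ∀ v, ∀ᵐ t ∂timeMeasure T, (ι v).1.1 t = L.iU (v.1.1 t))
    {B : L.Xt →L[ℝ] L.Xt →L[ℝ] L2 T P.Vdual}
    (hB : ∀ u w, ∀ᵐ t ∂timeMeasure T, B u w t = L.Bt (u.1.1 t) (w.1.1 t)) :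
    ∃ ρ : ℝ, 0 < ρ ∧ ∀ (u : L.Xt) (v : evolSpace T P.UtoVdual) (F : L2 T P.Vdual), ‖u‖ ≤ ρ →
      (∀ᵐ t ∂timeMeasure T, F t = -(L.Bt (u.1.1 t) (L.iU (v.1.1 t)) +
        L.Bt (L.iU (v.1.1 t)) (u.1.1 t) + L.Bt (L.iU (v.1.1 t)) (L.iU (v.1.1 t)))) →
      P.SolvesLinear F 0 v → v = 0 := by
  obtain ⟨S, hS⟩ := P.exists_linear_solution_operator hT
  obtain ⟨C, hC0, hC⟩ := L.norm_Bt_iU_le hT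
  obtain ⟨b, hb0, hb⟩ := exists_norm_apply_apply_le B
  refine ⟨1 / (8 * (‖S‖ + 1) * (b + 1) * (‖ι‖ + 1)), by positivity, fun u v F hu hF hv => ?_⟩
  obtain ⟨d, hd, hdv, hdi⟩ := exists_continuous_representative hι hT v
  have hd0 : d 0 = 0 := by
    have h := (hasInitialValue_inclusion_iff hι hT v 0).2 hv.2
    exact L.iW_closed.injective (hdi.unique hT L.jW_injective h)
  set κ := 1 / (4 * (‖S‖ + 1) * (C + 1)) with hκ
  have hκ0 : 0 < κ := by positivity
  have hsmall1 : ‖S‖ * (2 * b * ‖u‖ * ‖ι‖) ≤ 1 / 4 := by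
    rw [le_div_iff₀ (by positivity)] at hu
    have h1 : ‖S‖ * (2 * b * ‖u‖ * ‖ι‖) ≤ (‖S‖ + 1) * (2 * (b + 1) * ‖u‖ * (‖ι‖ + 1)) := by
      gcongr <;> linarith
    linarith
  have hsmall2 : ‖S‖ * (C * κ) ≤ 1 / 4 := by
    have h1 : ‖S‖ * (C * κ) ≤ (‖S‖ + 1) * ((C + 1) * κ) := by gcongr <;> linarith
    refine h1.trans (le_of_eq ?_)
    rw [hκ]
    field_simp
  have hstep : ∀ τ, (∀ᵐ t ∂timeMeasure T, t < τ → ‖P.UtoW (v.1.1 t)‖ ≤ κ) →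
      ∀ᵐ t ∂timeMeasure T, t < τ → v.1.1 t = 0 := fun τ =>
    ae_eq_zero_of_small hT hι hS hB hb0 hb hC0 hC hκ0.le hsmall1 hsmall2 hv hF
  have hzero : ∀ τ ≤ T, 0 < τ → (∀ᵐ t ∂timeMeasure T, t < τ → d t = 0) →
      ∀ s ∈ Icc 0 τ, d s = 0 := by
    intro τ hτT hτ h
    refine eqOn_Icc_of_ae_eq hτ (hd.mono (Icc_subset_Icc_right hτT)) continuousOn_const ?_
    have h' := ae_restrict_of_ae_restrict_of_subset (Ioo_subset_Ioo_right hτT) h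
    filter_upwards [h', ae_restrict_mem measurableSet_Ioo] with t e1 e2 using e1 e2.2
  -- the times up to which the continuous representative `d` of `v` in `W` vanishes
  set Q : Set ℝ := {x | x ∈ Icc 0 T ∧ ∀ s ∈ Icc 0 x, d s = 0}
  have hQ0 : (0 : ℝ) ∈ Q := ⟨left_mem_Icc.2 hT.le, fun s hs => by
    rw [Icc_self, mem_singleton_iff] at hs
    rw [hs, hd0]⟩
  have hQb : BddAbove Q := ⟨T, fun x hx => hx.1.2⟩
  set x := sSup Q
  have hx0 : 0 ≤ x := le_csSup hQb hQ0
  have hxT : x ≤ T := csSup_le ⟨0, hQ0⟩ fun y hy => hy.1.2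
  have hlt : ∀ s, 0 ≤ s → s < x → d s = 0 := fun s hs hsx => by
    obtain ⟨y, hy, hsy⟩ := exists_lt_of_lt_csSup ⟨0, hQ0⟩ hsx
    exact hy.2 s ⟨hs, hsy.le⟩
  have hle : ∀ s ∈ Icc 0 x, d s = 0 := by
    rcases hx0.eq_or_lt with h | h
    · rw [← h, Icc_self]
      intro s hs
      rw [mem_singleton_iff.1 hs, hd0]
    · refine hzero x hxT h ?_
      filter_upwards [ae_restrict_mem measurableSet_Ioo] with t ht htx using hlt t ht.1.le htx
  have hxeq : x = T := by
    by_contra hne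
    have hxlt : x < T := lt_of_le_of_ne hxT hne
    have hcont := hd x ⟨hx0, hxT⟩
    rw [Metric.continuousWithinAt_iff] at hcont
    obtain ⟨δ, hδ, hδ'⟩ := hcont κ hκ0
    -- slightly beyond `x`, continuity keeps `v` small in `W`, so that `v` vanishes there as well
    set τ := min (x + δ) T with hτ
    have hxτ : x < τ := lt_min (by linarith) hxlt
    have hτT : τ ≤ T := min_le_right _ _
    have hsm : ∀ᵐ t ∂timeMeasure T, t < τ → ‖P.UtoW (v.1.1 t)‖ ≤ κ := by
      filter_upwards [hdv, ae_restrict_mem measurableSet_Ioo] with t e1 e2 ht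
      rw [← e1]
      by_cases htx : t ≤ x
      · rw [hle t ⟨e2.1.le, htx⟩, norm_zero]
        exact hκ0.le
      · have h1 : dist t x < δ := by
          rw [Real.dist_eq, abs_of_pos (by linarith [not_le.1 htx])]
          have := ht.trans_le (min_le_left _ _)
          linarith
        have h2 := hδ' (Ioo_subset_Icc_self e2) h1
        rw [hle x ⟨hx0, le_rfl⟩, dist_zero_right] at h2
        exact h2.le
    have hτQ : τ ∈ Q := by
      refine ⟨⟨hx0.trans hxτ.le, hτT⟩, hzero τ hτT (hx0.trans_lt hxτ) ?_⟩
      filter_upwards [hstep τ hsm, hdv] with t e1 e2 ht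
      rw [e2, e1 ht, map_zero]
    exact absurd (le_csSup hQb hτQ) (not_le.2 hxτ)
  have hv0 : ∀ᵐ t ∂timeMeasure T, v.1.1 t = 0 := by
    have h := hstep T (by
      filter_upwards [hdv, ae_restrict_mem measurableSet_Ioo] with t e1 e2 _
      rw [← e1, hle t ⟨e2.1.le, hxeq ▸ e2.2.le⟩, norm_zero]
      exact hκ0.le)
    filter_upwards [h, ae_restrict_mem measurableSet_Ioo] with t e1 e2 using e1 e2.2
  have hF0 : F = 0 := by
    apply Lp.ext
    filter_upwards [hv0, hF, Lp.coeFn_zero P.Vdual 2 (timeMeasure T)] with t a c1 c2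
    rw [c1, c2, a]
    simp
  rw [hF0] at hv
  exact hv.eq_zero hT

/-- The lifting: `h̃ + v` solves the nonhomogeneous problem if `v ∈ X` solves the linear problem
with the remaining terms as right-hand side and `w` as initial value. -/
theorem isSolution_add_inclusion (hT : 0 < T)
    (hι : ∀ v, ∀ᵐ t ∂timeMeasure T, (ι v).1.1 t = L.iU (v.1.1 t)) (hι' : ∀ v, (ι v).1.2 = v.1.2)
    {f F : L2 T P.Vdual} {h : XT} {ht : L.Xt} {a : Wt} {w : P.W} {v : evolSpace T P.UtoVdual}
    (hh : L.IsHarmonicExtension h ht) (ha : HasInitialValue L.jU L.jW ht a)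
    (hv : P.SolvesLinear F w v)
    (hF : ∀ᵐ t ∂timeMeasure T, F t = f t - ht.1.2 t - L.St (ht.1.1 t) -
      L.Bt ((ht + ι v).1.1 t) ((ht + ι v).1.1 t)) :
    L.IsSolution f (a + L.iW w) h (ht + ι v) := by
  refine ⟨?_, ha.add ((hasInitialValue_inclusion_iff hι hT v w).2 hv.2), ?_⟩
  · filter_upwards [hF, hv.1, hh.1, hι v, Lp.coeFn_add ht.1.1 (ι v).1.1,
      Lp.coeFn_add ht.1.2 (ι v).1.2] with t e1 e2 e3 e4 e5 e6
    have e7 : (ht + ι v).1.1 t = ht.1.1 t + L.iU (v.1.1 t) := by rw [← e4]; exact e5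
    have e8 : (ht + ι v).1.2 t = ht.1.2 t + v.1.2 t := by rw [← hι' v]; exact e6
    obtain ⟨y, hy⟩ : ∃ y, y = L.Bt ((ht + ι v).1.1 t) ((ht + ι v).1.1 t) := ⟨_, rfl⟩
    rw [← hy] at e1 ⊢
    rw [e8, e7, map_add, map_add, e3, L.At_iU, L.St_iU_eq hT]
    rw [e1] at e2
    rw [← sub_eq_zero] at e2 ⊢
    refine Eq.trans ?_ e2
    abel
  · rw [map_add, trace_inclusion hι, add_zero, hh.2]

/-- The equation for the difference `v` of two solutions, as a linear problem with homogeneous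
boundary and initial data. -/
theorem IsSolution.solvesLinear_of_inclusion_eq_sub (hT : 0 < T)
    (hι : ∀ v, ∀ᵐ t ∂timeMeasure T, (ι v).1.1 t = L.iU (v.1.1 t)) (hι' : ∀ v, (ι v).1.2 = v.1.2)
    {f F : L2 T P.Vdual} {g : Wt} {h : XT} {u u' : L.Xt} {v : evolSpace T P.UtoVdual}
    (hu : L.IsSolution f g h u) (hu' : L.IsSolution f g h u') (hv : ι v = u' - u)
    (hF : ∀ᵐ t ∂timeMeasure T, F t = -(L.Bt (u.1.1 t) (L.iU (v.1.1 t)) +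
        L.Bt (L.iU (v.1.1 t)) (u.1.1 t) + L.Bt (L.iU (v.1.1 t)) (L.iU (v.1.1 t)))) :
    P.SolvesLinear F 0 v := by
  refine ⟨?_, (hasInitialValue_inclusion_iff hι hT v 0).1 ?_⟩
  · obtain rfl : u' = u + ι v := by rw [hv]; abel
    filter_upwards [hF, hu.1, hu'.1, hι v, Lp.coeFn_add u.1.1 (ι v).1.1,
      Lp.coeFn_add u.1.2 (ι v).1.2] with t e1 e2 e3 e4 e5 e6
    have e7 : (u + ι v).1.1 t = u.1.1 t + L.iU (v.1.1 t) := by rw [← e4]; exact e5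
    have e8 : (u + ι v).1.2 t = u.1.2 t + v.1.2 t := by rw [← hι' v]; exact e6
    rw [e7, e8, ← e2] at e3
    simp only [map_add, LinearMap.add_apply, L.At_iU, L.St_iU_eq hT] at e3
    rw [e1]
    rw [← sub_eq_zero] at e3 ⊢
    refine Eq.trans ?_ e3
    abel
  · have h0 := hu'.2.1.sub hu.2.1
    rw [← hv, sub_self] at h0
    rwa [map_zero]

/-- The embedding `X̃ ↪ C([0, T]; Wt)`, at the time `0`. -/
theorem exists_initialValue_bound (hT : 0 < T) : ∃ C : ℝ, 0 ≤ C ∧ ∀ (u : L.Xt) (a : Wt),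
    HasInitialValue L.jU L.jW u a → ‖a‖ ≤ C * ‖u‖ := by
  obtain ⟨C, hC⟩ := L.embed
  refine ⟨|C|, abs_nonneg C, fun u a ha => ?_⟩
  obtain ⟨c, h1, h2, h3⟩ := hC u
  have hc : HasInitialValue L.jU L.jW u (c 0) := ⟨c, h1, h2, rfl⟩
  rw [ha.unique hT L.jW_injective hc]
  exact (h3 0 (left_mem_Icc.2 hT.le)).trans
    (mul_le_mul_of_nonneg_right (le_abs_self C) (norm_nonneg u))

/-- Two solutions have the same trace, hence differ by an element of `X`, and the equation for this
difference decides whether they agree. -/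
theorem IsSolution.eq_of_difference (hT : 0 < T)
    (hι : ∀ v, ∀ᵐ t ∂timeMeasure T, (ι v).1.1 t = L.iU (v.1.1 t)) (hι' : ∀ v, (ι v).1.2 = v.1.2)
    {B : L.Xt →L[ℝ] L.Xt →L[ℝ] L2 T P.Vdual}
    (hB : ∀ u w, ∀ᵐ t ∂timeMeasure T, B u w t = L.Bt (u.1.1 t) (w.1.1 t))
    {f : L2 T P.Vdual} {g : Wt} {h : XT} {u u' : L.Xt}
    (hρ : ∀ (v : evolSpace T P.UtoVdual) (F : L2 T P.Vdual),
      (∀ᵐ t ∂timeMeasure T, F t = -(L.Bt (u.1.1 t) (L.iU (v.1.1 t)) +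
        L.Bt (L.iU (v.1.1 t)) (u.1.1 t) + L.Bt (L.iU (v.1.1 t)) (L.iU (v.1.1 t)))) →
      P.SolvesLinear F 0 v → v = 0)
    (hu : L.IsSolution f g h u) (hu' : L.IsSolution f g h u') : u' = u := by
  have htr : L.trace (u' - u) = 0 := by rw [map_sub, hu.2.2, hu'.2.2, sub_self]
  obtain ⟨v, hv⟩ := exists_inclusion_eq hι hι' htr
  obtain ⟨F, hF⟩ : ∃ F : L2 T P.Vdual, ∀ᵐ t ∂timeMeasure T,
      F t = -(L.Bt (u.1.1 t) (L.iU (v.1.1 t)) +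
        L.Bt (L.iU (v.1.1 t)) (u.1.1 t) + L.Bt (L.iU (v.1.1 t)) (L.iU (v.1.1 t))) := by
    obtain ⟨y₁, h₁⟩ : ∃ y, y = B u (ι v) := ⟨_, rfl⟩
    obtain ⟨y₂, h₂⟩ : ∃ y, y = B (ι v) u := ⟨_, rfl⟩
    obtain ⟨y₃, h₃⟩ : ∃ y, y = B (ι v) (ι v) := ⟨_, rfl⟩
    have k₁ := hB u (ι v)
    have k₂ := hB (ι v) u
    have k₃ := hB (ι v) (ι v)
    rw [← h₁] at k₁
    rw [← h₂] at k₂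
    rw [← h₃] at k₃
    refine ⟨-(y₁ + y₂ + y₃), ?_⟩
    filter_upwards [hι v, k₁, k₂, k₃, Lp.coeFn_neg (y₁ + y₂ + y₃), Lp.coeFn_add (y₁ + y₂) y₃,
      Lp.coeFn_add y₁ y₂] with t e0 e1 e2 e3 e4 e5 e6
    rw [e4, Pi.neg_apply, e5, Pi.add_apply, e6, Pi.add_apply, e1, e2, e3, e0]
  have h0 := hρ v F hF (hu.solvesLinear_of_inclusion_eq_sub hT hι hι' hu' hv hF)
  rw [h0, map_zero] at hv
  exact sub_eq_zero.1 hv.symm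

/-- Existence of small solutions for small data. The solution sought is `h̃ + ι (v₀ + Λ F)`, where
`Λ` is the solution operator of the linear problem with zero initial value, `v₀` the linear
evolution of `g - h̃(0) ∈ W`, and `F` a fixed point of
`F ↦ f - ∂ₜ h̃ - 𝒮̃ h̃ - 𝔅̃[u, u]` with `u = h̃ + v₀ + Λ F`. -/
theorem exists_small_solution (hT : 0 < T)
    (hι : ∀ v, ∀ᵐ t ∂timeMeasure T, (ι v).1.1 t = L.iU (v.1.1 t)) (hι' : ∀ v, (ι v).1.2 = v.1.2)
    {B : L.Xt →L[ℝ] L.Xt →L[ℝ] L2 T P.Vdual}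
    (hB : ∀ u w, ∀ᵐ t ∂timeMeasure T, B u w t = L.Bt (u.1.1 t) (w.1.1 t)) {ρ : ℝ} (hρ : 0 < ρ) :
    ∃ r : ℝ, 0 < r ∧ ∀ (f : L2 T P.Vdual) (g : Wt) (h : XT) (ht : L.Xt),
      L.IsHarmonicExtension h ht →
      (∃ a : Wt, HasInitialValue L.jU L.jW ht a ∧ ∃ w : P.W, L.iW w = a - g) →
      ‖f‖ + ‖g‖ + ‖h‖ < r → ∃ u : L.Xt, L.IsSolution f g h u ∧ ‖u‖ ≤ ρ := by
  obtain ⟨Sm, hSm⟩ := L.exists_St_clm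
  obtain ⟨Λ, hΛ⟩ := P.exists_linear_solution_operator hT
  obtain ⟨c₁, hc₁, hlin⟩ := P.exists_solvesLinear hT
  obtain ⟨c₂, hc₂, hinit⟩ := exists_initialValue_bound (L := L) hT
  obtain ⟨c₃, hlift⟩ := L.lift_bounded
  obtain ⟨c₄, hc₄, hiW⟩ := exists_norm_le_of_isEmbedding L.iW_closed.isEmbedding
  obtain ⟨ε, hε, hfix⟩ := exists_quadratic_fixedPoint (ι ∘L Λ) B hρ
  obtain ⟨s, hs, hSs⟩ : ∃ s : ℝ, 0 ≤ s ∧ ∀ u, ‖Sm u‖ ≤ s * ‖u‖ :=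
    ⟨‖Sm‖, norm_nonneg Sm, Sm.le_opNorm⟩
  obtain ⟨i, hi, hιi⟩ : ∃ i : ℝ, 0 ≤ i ∧ ∀ v, ‖ι v‖ ≤ i * ‖v‖ :=
    ⟨‖ι‖, norm_nonneg ι, ι.le_opNorm⟩
  -- data of size `N` have a lifting of size `l * N`; the right-hand side `f - ∂ₜ h̃ - 𝒮̃ h̃` and
  -- the affine part `h̃ + ι v₀` have size at most `M * N`
  set l := |c₃|
  have hl : 0 ≤ l := abs_nonneg _
  set M := 1 + (1 + s) * l + l + i * (c₁ * (c₄ * (1 + c₂ * l))) with hM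
  have hM0 : 0 < M := by positivity
  refine ⟨ε / M, by positivity, fun f g h ht hh ⟨a, ha, w, hw⟩ hsmall => ?_⟩
  set N := ‖f‖ + ‖g‖ + ‖h‖ with hN
  have hN0 : 0 ≤ N := by positivity
  have hMN : M * N ≤ ε := by
    rw [lt_div_iff₀ hM0] at hsmall
    linarith [mul_comm M N]
  have hf : ‖f‖ ≤ N := by linarith [norm_nonneg g, norm_nonneg h]
  have hg : ‖g‖ ≤ N := by linarith [norm_nonneg f, norm_nonneg h]
  have hhN : ‖h‖ ≤ N := by linarith [norm_nonneg f, norm_nonneg g]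
  have hht : ‖ht‖ ≤ l * N := (hlift h ht hh.1 hh.2).trans <|
    (mul_le_mul_of_nonneg_right (le_abs_self c₃) (norm_nonneg h)).trans
      (mul_le_mul_of_nonneg_left hhN hl)
  have hwN : ‖-w‖ ≤ c₄ * ((1 + c₂ * l) * N) := by
    rw [norm_neg]
    refine (hiW w).trans (mul_le_mul_of_nonneg_left ?_ hc₄)
    rw [hw]
    have h1 := norm_sub_le a g
    have h2 := (hinit ht a ha).trans (mul_le_mul_of_nonneg_left hht hc₂)
    linarith
  obtain ⟨v₀, hv₀, hv₀n⟩ := hlin 0 (-w)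
  have hv₀N : ‖ι v₀‖ ≤ i * (c₁ * (c₄ * ((1 + c₂ * l) * N))) := by
    refine (hιi v₀).trans (mul_le_mul_of_nonneg_left (hv₀n.trans ?_) hi)
    rw [norm_zero, zero_add]
    exact mul_le_mul_of_nonneg_left hwN hc₁
  have hf₀ : ‖f - ht.1.2 - Sm ht‖ ≤ ε := by
    have h1 : ‖f - ht.1.2 - Sm ht‖ ≤ ‖f‖ + ‖ht.1.2‖ + ‖Sm ht‖ :=
      (norm_sub_le _ _).trans (add_le_add_left (norm_sub_le _ _) _)
    have h2 : ‖ht.1.2‖ ≤ ‖ht‖ := norm_snd_le ht.1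
    have h3 := (hSs ht).trans (mul_le_mul_of_nonneg_left hht hs)
    have h4 : 0 ≤ i * (c₁ * (c₄ * (1 + c₂ * l))) * N := by positivity
    have h5 : 0 ≤ l * N := by positivity
    rw [hM] at hMN
    linarith
  have he₀ : ‖ht + ι v₀‖ ≤ ε := by
    have h1 := norm_add_le ht (ι v₀)
    have h4 : 0 ≤ (1 + (1 + s) * l) * N := by positivity
    rw [hM] at hMN
    linarith
  obtain ⟨F, hF, hFn⟩ := hfix _ _ hf₀ he₀
  have hsum : ht + ι v₀ + (ι ∘L Λ) F = ht + ι (v₀ + Λ F) := by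
    rw [map_add, add_assoc, ContinuousLinearMap.comp_apply]
  rw [hsum] at hF hFn
  have hv : P.SolvesLinear F (-w) (v₀ + Λ F) := by
    have h1 := hv₀.combination (hΛ F) 1
    simpa only [one_smul, zero_add, add_zero] using h1
  have hsol := isSolution_add_inclusion (f := f) hT hι hι' hh ha hv ?_
  · rw [map_neg, hw, neg_sub, add_sub_cancel] at hsol
    exact ⟨_, hsol, hFn⟩
  · obtain ⟨y, hy⟩ : ∃ y, y = B (ht + ι (v₀ + Λ F)) (ht + ι (v₀ + Λ F)) := ⟨_, rfl⟩
    have hyB := hB (ht + ι (v₀ + Λ F)) (ht + ι (v₀ + Λ F))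
    rw [← hy] at hF hyB
    filter_upwards [hSm ht, hyB, ae_eq_sub_sub_sub hF] with t e1 e2 e3
    rw [e3, e1, e2]

end LiftingFramework

end NonhomBVP

end

theorem mainTheorem4
    {H : Type*} [NormedAddCommGroup H] [InnerProductSpace ℝ H] [CompleteSpace H]
    {Ut : Type*} [NormedAddCommGroup Ut] [NormedSpace ℝ Ut] [CompleteSpace Ut]
    {Wt : Type*} [NormedAddCommGroup Wt] [NormedSpace ℝ Wt] [CompleteSpace Wt]
    {Z : Type*} [AddCommGroup Z] [Module ℝ Z]
    {XT : Type*} [NormedAddCommGroup XT] [NormedSpace ℝ XT] [CompleteSpace XT]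
    (P : NonhomBVP.SemilinearData H) {T : ℝ} (hT : 0 < T)
    (L : NonhomBVP.LiftingFramework P T Ut Wt Z XT) :
    ∃ r : ℝ, 0 < r ∧
      ∀ (f : NonhomBVP.L2 T P.Vdual) (g : Wt) (h : XT) (ht : L.Xt),
        L.IsHarmonicExtension h ht →
        (∃ a : Wt, NonhomBVP.HasInitialValue L.jU L.jW ht a ∧ ∃ w : P.W, L.iW w = a - g) →
        ‖f‖ + ‖g‖ + ‖h‖ < r →
        ∃! u : L.Xt, L.IsSolution f g h u := by
  obtain ⟨ι, hι, hι'⟩ := L.exists_inclusion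
  obtain ⟨B, hB⟩ := L.exists_Bt_clm
  obtain ⟨ρ, hρ, hdiff⟩ := NonhomBVP.LiftingFramework.exists_difference_eq_zero hT hι hB
  obtain ⟨r, hr, hsol⟩ := NonhomBVP.LiftingFramework.exists_small_solution hT hι hι' hB hρ
  refine ⟨r, hr, fun f g h ht hh ha hsmall => ?_⟩
  obtain ⟨u, hu, hun⟩ := hsol f g h ht hh ha hsmall
  exact ⟨u, hu, fun u' hu' =>
    hu.eq_of_difference hT hι hι' hB (fun v F => hdiff u v F hun) hu'⟩
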